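/- **Conventions.** A *totally traced category* is a symmetric monoidal category $\mathcal C$ with functions $\mathrm{Tr}^U_{A,B}:\mathcal C(A\otimes U,B\otimes U)\to\mathcal C(A,B)$ that satisfy (writing as if $\mathcal C$ were strict) naturality $h\circ\mathrm{Tr}^U(f)\circ g=\mathrm{Tr}^U((h\otimes 1_U)\circ f\circ(g\otimes 1_U))$, dinaturality $\mathrm{Tr}^{U}((1_B\otimes g)\circ f)=\mathrm{Tr}^{U'}(f\circ(1_A\otimes g))$ for $f:A\otimes U\to B\otimes U'$ and $g:U'\to U$, strength $g\otimes\mathrm{Tr}^U(f)=\mathrm{Tr}^U(g\otimes f)$, vanishing I $f=\mathrm{Tr}^I(f)$, vanishing II $\mathrm{Tr}^U(\mathrm{Tr}^V(f))=\mathrm{Tr}^{U\otimes V}(f)$, and yanking $\mathrm{Tr}^A(\sigma_{A,A})=1_A$. A *partially traced category* is a symmetric monoidal category with partial functions $\mathrm{Tr}^U_{A,B}$ for which dinaturality, vanishing I and yanking hold as Kleene equalities (both sides undefined, or both defined and equal), naturality and strength hold as directed Kleene equalities (if the left-hand side is defined, then so is the right-hand side, and they are equal), and vanishing II holds as a Kleene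 equality whenever $\mathrm{Tr}^V(f)$ is defined. Fix a set of object variables and a set of morphism variables, each morphism variable having a domain and a codomain that are object terms built from the object variables, $I$ and $\otimes$. *Morphism terms* $A\to B$ are built from the morphism variables by identities, composition, $\otimes$, the associativity and unit isomorphisms and their inverses, symmetries, and $\mathrm{Tr}$. Given an assignment of objects and morphisms of a totally traced category to the variables, every term has a value; in a partially traced category the value of a term is defined if and only if the values of all its subterms are. The *expanded diagram* of a term is its string diagram, in which wires are labelled by object variables (an object term is drawn as one wire for each occurrence of a variable in it), boxes are labelled by morphism variables, composition joins output wires to input wires, $\otimes$ is juxtaposition, and the trace joins the output wires of $U$ to the input wires of $U$ (which may create closed loops). **Statement.** Let $s,t:A\to B$ be morphism terms. 1. If the equation $s=t$ holds in every totally traced category under every assignment of the variables, then in every partially traced category, under every assignment for which the values of $s$ and $t$ are both defined, these values are equal. 2. If there is a chain of morphism terms $s=t_0,t_1,\dots,t_n=t$ from $A$ to $B$ such that for each $i<n$ the expanded diagrams of $t_i$ and $t_{i+1}$ are isomorphic (by bijections of wires and of boxes that respect the labels and the attachment of wires to the ports of the boxes and of the diagram), then in every partially traced category, under every assignment for which the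 values of $s$ and $t$ are both defined, these values are equal. The values of $t_1,\dots,t_{n-1}$ need not be defined. -/

import Mathlib

open CategoryTheory MonoidalCategory

universe w u v u' v'

/-! ### Totally and partially traced symmetric monoidal categories -/

/-- A (total) trace on a symmetric monoidal category. The associators and unitors that are
suppressed when one writes as if the category were strict are written out. -/
class TracedCategory (C : Type u) [Category.{v} C] [MonoidalCategory C] [SymmetricCategory C] where
  /-- The trace `Tr^U_{A,B}`. -/
  tr : ∀ {A B U : C}, (A ⊗ U ⟶ B ⊗ U) → (A ⟶ B)
  naturality : ∀ {A B U A' B' : C} (f : A ⊗ U ⟶ B ⊗ U) (g : A' ⟶ A) (h : B ⟶ B'),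
    g ≫ tr f ≫ h = tr ((g ▷ U) ≫ f ≫ (h ▷ U))
  dinaturality : ∀ {A B U U' : C} (f : A ⊗ U ⟶ B ⊗ U') (g : U' ⟶ U),
    tr (f ≫ (B ◁ g)) = tr ((A ◁ g) ≫ f)
  strength : ∀ {A B U X Y : C} (f : A ⊗ U ⟶ B ⊗ U) (g : X ⟶ Y),
    g ⊗ₘ tr f = tr ((α_ X A U).hom ≫ (g ⊗ₘ f) ≫ (α_ Y B U).inv)
  vanishing_I : ∀ {A B : C} (f : A ⊗ 𝟙_ C ⟶ B ⊗ 𝟙_ C),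
    (ρ_ A).inv ≫ f ≫ (ρ_ B).hom = tr f
  vanishing_II : ∀ {A B U V : C} (f : (A ⊗ U) ⊗ V ⟶ (B ⊗ U) ⊗ V),
    tr (tr f) = tr ((α_ A U V).inv ≫ f ≫ (α_ B U V).hom)
  yanking : ∀ A : C, tr (β_ A A).hom = 𝟙 A

/-- A partial trace on a symmetric monoidal category. On `Part`, equality is Kleene equality
(both sides undefined, or both defined and equal), and `p ≤ q` is directed Kleene equality
(if `p` is defined, then so is `q`, with the same value). -/
class PartiallyTracedCategory (C : Type u) [Category.{v} C] [MonoidalCategory C]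
    [SymmetricCategory C] where
  /-- The partial trace `Tr^U_{A,B}`. -/
  tr : ∀ {A B U : C}, (A ⊗ U ⟶ B ⊗ U) → Part (A ⟶ B)
  naturality : ∀ {A B U A' B' : C} (f : A ⊗ U ⟶ B ⊗ U) (g : A' ⟶ A) (h : B ⟶ B'),
    (tr f).map (fun k => g ≫ k ≫ h) ≤ tr ((g ▷ U) ≫ f ≫ (h ▷ U))
  dinaturality : ∀ {A B U U' : C} (f : A ⊗ U ⟶ B ⊗ U') (g : U' ⟶ U),
    tr (f ≫ (B ◁ g)) = tr ((A ◁ g) ≫ f)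
  strength : ∀ {A B U X Y : C} (f : A ⊗ U ⟶ B ⊗ U) (g : X ⟶ Y),
    (tr f).map (fun k => g ⊗ₘ k) ≤ tr ((α_ X A U).hom ≫ (g ⊗ₘ f) ≫ (α_ Y B U).inv)
  vanishing_I : ∀ {A B : C} (f : A ⊗ 𝟙_ C ⟶ B ⊗ 𝟙_ C),
    Part.some ((ρ_ A).inv ≫ f ≫ (ρ_ B).hom) = tr f
  vanishing_II : ∀ {A B U V : C} (f : (A ⊗ U) ⊗ V ⟶ (B ⊗ U) ⊗ V), (tr f).Dom →
    (tr f).bind (fun k => tr k) = tr ((α_ A U V).inv ≫ f ≫ (α_ B U V).hom)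
  yanking : ∀ A : C, tr (β_ A A).hom = Part.some (𝟙 A)

/-! ### The language of traced symmetric monoidal categories -/

/-- Object terms over a type `O` of object variables. -/
inductive ObjTerm (O : Type w) : Type w
  | var (X : O) : ObjTerm O
  | unit : ObjTerm O
  | tensor (A B : ObjTerm O) : ObjTerm O

/-- A signature: object variables, and morphism variables, each with a domain and a codomain
that are object terms. -/
structure TraceSignature : Type (w + 1) where
  Obj : Type w
  Mor : Type w
  dom : Mor → ObjTerm Obj
  cod : Mor → ObjTerm Obj

/-- Well-formed morphism terms `A ⟶ B` of the language of traced symmetric monoidal categories.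
Composition is written in diagrammatic order. -/
inductive TraceTerm (S : TraceSignature.{w}) : ObjTerm S.Obj → ObjTerm S.Obj → Type w
  | var (m : S.Mor) : TraceTerm S (S.dom m) (S.cod m)
  | id (A : ObjTerm S.Obj) : TraceTerm S A A
  | comp {A B C : ObjTerm S.Obj} (f : TraceTerm S A B) (g : TraceTerm S B C) : TraceTerm S A C
  | tensor {A B C D : ObjTerm S.Obj} (f : TraceTerm S A B) (g : TraceTerm S C D) :
      TraceTerm S (.tensor A C) (.tensor B D)
  | assoc (A B C : ObjTerm S.Obj) :
      TraceTerm S (.tensor (.tensor A B) C) (.tensor A (.tensor B C))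
  | assocInv (A B C : ObjTerm S.Obj) :
      TraceTerm S (.tensor A (.tensor B C)) (.tensor (.tensor A B) C)
  | leftUnitor (A : ObjTerm S.Obj) : TraceTerm S (.tensor .unit A) A
  | leftUnitorInv (A : ObjTerm S.Obj) : TraceTerm S A (.tensor .unit A)
  | rightUnitor (A : ObjTerm S.Obj) : TraceTerm S (.tensor A .unit) A
  | rightUnitorInv (A : ObjTerm S.Obj) : TraceTerm S A (.tensor A .unit)
  | symm (A B : ObjTerm S.Obj) : TraceTerm S (.tensor A B) (.tensor B A)
  | trace {A B U : ObjTerm S.Obj} (f : TraceTerm S (.tensor A U) (.tensor B U)) : TraceTerm S A B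

/-! ### Interpretation in totally and in partially traced categories -/

section Interpretation

variable {C : Type u} [Category.{v} C] [MonoidalCategory C]

/-- The value of an object term. -/
def ObjTerm.eval {O : Type w} (o : O → C) : ObjTerm O → C
  | .var X => o X
  | .unit => 𝟙_ C
  | .tensor A B => A.eval o ⊗ B.eval o

variable (C) in
/-- An assignment of objects and morphisms of `C` to the variables of a signature. -/
structure TraceValuation (S : TraceSignature.{w}) where
  obj : S.Obj → C
  mor : ∀ m : S.Mor, (S.dom m).eval obj ⟶ (S.cod m).eval obj

variable [SymmetricCategory C] {S : TraceSignature.{w}}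

/-- The value of a morphism term in a totally traced category. -/
def TraceTerm.eval [TracedCategory C] (x : TraceValuation C S) :
    ∀ {A B : ObjTerm S.Obj}, TraceTerm S A B → (A.eval x.obj ⟶ B.eval x.obj)
  | _, _, .var m => x.mor m
  | _, _, .id A => 𝟙 (A.eval x.obj)
  | _, _, .comp f g => f.eval x ≫ g.eval x
  | _, _, .tensor f g => f.eval x ⊗ₘ g.eval x
  | _, _, .assoc A B C => (α_ (A.eval x.obj) (B.eval x.obj) (C.eval x.obj)).hom
  | _, _, .assocInv A B C => (α_ (A.eval x.obj) (B.eval x.obj) (C.eval x.obj)).inv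
  | _, _, .leftUnitor A => (λ_ (A.eval x.obj)).hom
  | _, _, .leftUnitorInv A => (λ_ (A.eval x.obj)).inv
  | _, _, .rightUnitor A => (ρ_ (A.eval x.obj)).hom
  | _, _, .rightUnitorInv A => (ρ_ (A.eval x.obj)).inv
  | _, _, .symm A B => (β_ (A.eval x.obj) (B.eval x.obj)).hom
  | _, _, .trace f => TracedCategory.tr (f.eval x)

/-- The partially defined value of a morphism term in a partially traced category: it is defined
iff the values of all subterms are defined. -/
def TraceTerm.peval [PartiallyTracedCategory C] (x : TraceValuation C S) :
    ∀ {A B : ObjTerm S.Obj}, TraceTerm S A B → Part (A.eval x.obj ⟶ B.eval x.obj)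
  | _, _, .var m => Part.some (x.mor m)
  | _, _, .id A => Part.some (𝟙 (A.eval x.obj))
  | _, _, .comp f g => (f.peval x).bind fun a => (g.peval x).map fun b => a ≫ b
  | _, _, .tensor f g => (f.peval x).bind fun a => (g.peval x).map fun b => a ⊗ₘ b
  | _, _, .assoc A B C => Part.some (α_ (A.eval x.obj) (B.eval x.obj) (C.eval x.obj)).hom
  | _, _, .assocInv A B C => Part.some (α_ (A.eval x.obj) (B.eval x.obj) (C.eval x.obj)).inv
  | _, _, .leftUnitor A => Part.some (λ_ (A.eval x.obj)).hom
  | _, _, .leftUnitorInv A => Part.some (λ_ (A.eval x.obj)).inv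
  | _, _, .rightUnitor A => Part.some (ρ_ (A.eval x.obj)).hom
  | _, _, .rightUnitorInv A => Part.some (ρ_ (A.eval x.obj)).inv
  | _, _, .symm A B => Part.some (β_ (A.eval x.obj) (B.eval x.obj)).hom
  | _, _, .trace f => (f.peval x).bind fun a => PartiallyTracedCategory.tr a

end Interpretation

/-- The equation `s = t` is a law of totally traced categories: it holds in every totally traced
category under every assignment of its variables. -/
def IsTracedLaw {S : TraceSignature.{w}} {A B : ObjTerm S.Obj} (s t : TraceTerm S A B) : Prop :=
  ∀ (D : Type u) [Category.{v} D] [MonoidalCategory D] [SymmetricCategory D] [TracedCategory D]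
    (x : TraceValuation D S), s.eval x = t.eval x

/-- The equation `s = t` holds in every partially traced category, under every assignment of its
variables for which both sides are defined. -/
def HoldsWhenDefined {S : TraceSignature.{w}} {A B : ObjTerm S.Obj} (s t : TraceTerm S A B) :
    Prop :=
  ∀ (C : Type u) [Category.{v} C] [MonoidalCategory C] [SymmetricCategory C]
    [PartiallyTracedCategory C] (x : TraceValuation C S),
    ∀ f ∈ s.peval x, ∀ g ∈ t.peval x, f = g

/-! ### The graphical language

Diagrams are expanded: their wires are labelled by object variables and their boxes by morphism
variables. An object term `A` is drawn as one wire for each occurrence of a variable in `A`. -/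

/-- The occurrences of variables in an object term, i.e. the wires by which it is drawn. -/
def ObjTerm.Pos {O : Type w} : ObjTerm O → Type
  | .var _ => Unit
  | .unit => Empty
  | .tensor A B => A.Pos ⊕ B.Pos

/-- The variable that occurs at a given position. -/
def ObjTerm.label {O : Type w} : (A : ObjTerm O) → A.Pos → O
  | .var X, _ => X
  | .tensor A B, p => Sum.elim A.label B.label p

theorem ObjTerm.finite_pos {O : Type w} : (A : ObjTerm O) → Finite A.Pos
  | .var _ => inferInstanceAs (Finite Unit)
  | .unit => inferInstanceAs (Finite Empty)
  | .tensor A B =>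
    have := A.finite_pos
    have := B.finite_pos
    inferInstanceAs (Finite (A.Pos ⊕ B.Pos))

/-- An expanded diagram from `A` to `B`: finitely many wires, each labelled by an object variable;
finitely many boxes, each labelled by a morphism variable; and, for every input port and every
output port of the diagram and of its boxes, the wire that is attached there, which has the label
that the port requires. A wire that is attached to no port is a closed loop. -/
structure TraceDiagram (S : TraceSignature.{w}) (A B : ObjTerm S.Obj) where
  Wire : Type
  /-- `Box m` is the type of the boxes labelled `m`. -/
  Box : S.Mor → Type
  label : Wire → S.Obj
  inp : A.Pos → Wire
  out : B.Pos → Wire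
  boxIn : ∀ {m : S.Mor}, Box m → (S.dom m).Pos → Wire
  boxOut : ∀ {m : S.Mor}, Box m → (S.cod m).Pos → Wire
  finite_wire : Finite Wire
  finite_box : Finite (Σ m, Box m)
  label_inp : ∀ p, label (inp p) = A.label p
  label_out : ∀ p, label (out p) = B.label p
  label_boxIn : ∀ {m : S.Mor} (b : Box m) p, label (boxIn b p) = (S.dom m).label p
  label_boxOut : ∀ {m : S.Mor} (b : Box m) p, label (boxOut b p) = (S.cod m).label p

namespace TraceDiagram

variable {S : TraceSignature.{w}}

/-- An isomorphism of diagrams: bijections of the wires and of the boxes that respect the labels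
and the attachment of wires to ports. -/
structure Iso {A B : ObjTerm S.Obj} (D E : TraceDiagram S A B) where
  wire : D.Wire ≃ E.Wire
  box : ∀ m : S.Mor, D.Box m ≃ E.Box m
  label_wire : ∀ a, E.label (wire a) = D.label a
  wire_inp : ∀ p, wire (D.inp p) = E.inp p
  wire_out : ∀ p, wire (D.out p) = E.out p
  wire_boxIn : ∀ {m : S.Mor} (b : D.Box m) p, wire (D.boxIn b p) = E.boxIn (box m b) p
  wire_boxOut : ∀ {m : S.Mor} (b : D.Box m) p, wire (D.boxOut b p) = E.boxOut (box m b) p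

/-- The diagram that consists of a single box. -/
def single (m : S.Mor) : TraceDiagram S (S.dom m) (S.cod m) where
  Wire := (S.dom m).Pos ⊕ (S.cod m).Pos
  Box m' := PLift (m' = m)
  label := Sum.elim (S.dom m).label (S.cod m).label
  inp := Sum.inl
  out := Sum.inr
  boxIn := fun | ⟨rfl⟩, p => Sum.inl p
  boxOut := fun | ⟨rfl⟩, p => Sum.inr p
  finite_wire :=
    have := (S.dom m).finite_pos
    have := (S.cod m).finite_pos
    inferInstance
  finite_box :=
    have : Subsingleton (Σ m', PLift (m' = m)) :=
      ⟨by rintro ⟨_, ⟨rfl⟩⟩ ⟨_, ⟨rfl⟩⟩; rfl⟩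
    inferInstance
  label_inp _ := rfl
  label_out _ := rfl
  label_boxIn := by rintro _ ⟨rfl⟩ p; rfl
  label_boxOut := by rintro _ ⟨rfl⟩ p; rfl

/-- The diagram without boxes and loops in which the output wire at `p` is the input wire at
`e p`. -/
def wiring {A B : ObjTerm S.Obj} (e : B.Pos ≃ A.Pos) (he : ∀ p, A.label (e p) = B.label p) :
    TraceDiagram S A B where
  Wire := A.Pos
  Box _ := Empty
  label := A.label
  inp p := p
  out := e
  boxIn b := b.elim
  boxOut b := b.elim
  finite_wire := A.finite_pos
  finite_box :=
    have : IsEmpty (Σ _ : S.Mor, Empty) := ⟨fun b => b.2.elim⟩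
    inferInstance
  label_inp _ := rfl
  label_out := he
  label_boxIn b := b.elim
  label_boxOut b := b.elim

/-- Juxtaposition of diagrams. -/
def tensor {A B A' B' : ObjTerm S.Obj} (D : TraceDiagram S A B) (E : TraceDiagram S A' B') :
    TraceDiagram S (.tensor A A') (.tensor B B') where
  Wire := D.Wire ⊕ E.Wire
  Box m := D.Box m ⊕ E.Box m
  label := Sum.elim D.label E.label
  inp := Sum.map D.inp E.inp
  out := Sum.map D.out E.out
  boxIn b p := b.elim (fun b => Sum.inl (D.boxIn b p)) (fun b => Sum.inr (E.boxIn b p))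
  boxOut b p := b.elim (fun b => Sum.inl (D.boxOut b p)) (fun b => Sum.inr (E.boxOut b p))
  finite_wire :=
    have := D.finite_wire
    have := E.finite_wire
    inferInstance
  finite_box :=
    have := D.finite_box
    have := E.finite_box
    Finite.of_equiv _ (Equiv.sigmaSumDistrib D.Box E.Box).symm
  label_inp := Sum.rec D.label_inp E.label_inp
  label_out := Sum.rec D.label_out E.label_out
  label_boxIn := Sum.rec D.label_boxIn E.label_boxIn
  label_boxOut := Sum.rec D.label_boxOut E.label_boxOut

/-- In the composite of two diagrams, the output wires of the first are joined to the
corresponding input wires of the second. -/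
inductive CompRel {A B C : ObjTerm S.Obj} (D : TraceDiagram S A B) (E : TraceDiagram S B C) :
    D.Wire ⊕ E.Wire → D.Wire ⊕ E.Wire → Prop
  | join (p : B.Pos) : CompRel D E (Sum.inl (D.out p)) (Sum.inr (E.inp p))

/-- Composition of diagrams. -/
def comp {A B C : ObjTerm S.Obj} (D : TraceDiagram S A B) (E : TraceDiagram S B C) :
    TraceDiagram S A C where
  Wire := Quot (CompRel D E)
  Box m := D.Box m ⊕ E.Box m
  label := Quot.lift (Sum.elim D.label E.label) (by
    rintro _ _ ⟨p⟩
    exact (D.label_out p).trans (E.label_inp p).symm)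
  inp p := Quot.mk _ (Sum.inl (D.inp p))
  out p := Quot.mk _ (Sum.inr (E.out p))
  boxIn b p := Quot.mk _
    (b.elim (fun b => Sum.inl (D.boxIn b p)) (fun b => Sum.inr (E.boxIn b p)))
  boxOut b p := Quot.mk _
    (b.elim (fun b => Sum.inl (D.boxOut b p)) (fun b => Sum.inr (E.boxOut b p)))
  finite_wire :=
    have := D.finite_wire
    have := E.finite_wire
    Finite.of_surjective _ Quot.mk_surjective
  finite_box :=
    have := D.finite_box
    have := E.finite_box
    Finite.of_equiv _ (Equiv.sigmaSumDistrib D.Box E.Box).symm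
  label_inp := D.label_inp
  label_out := E.label_out
  label_boxIn := Sum.rec D.label_boxIn E.label_boxIn
  label_boxOut := Sum.rec D.label_boxOut E.label_boxOut

/-- In the trace of a diagram, the output wires that belong to `U` are joined to the corresponding
input wires. -/
inductive TraceRel {A B U : ObjTerm S.Obj} (D : TraceDiagram S (.tensor A U) (.tensor B U)) :
    D.Wire → D.Wire → Prop
  | join (p : U.Pos) : TraceRel D (D.out (Sum.inr p)) (D.inp (Sum.inr p))

/-- The trace of a diagram. -/
def trace {A B U : ObjTerm S.Obj} (D : TraceDiagram S (.tensor A U) (.tensor B U)) :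
    TraceDiagram S A B where
  Wire := Quot (TraceRel D)
  Box := D.Box
  label := Quot.lift D.label (by
    rintro _ _ ⟨p⟩
    exact (D.label_out (Sum.inr p)).trans (D.label_inp (Sum.inr p)).symm)
  inp p := Quot.mk _ (D.inp (Sum.inl p))
  out p := Quot.mk _ (D.out (Sum.inl p))
  boxIn b p := Quot.mk _ (D.boxIn b p)
  boxOut b p := Quot.mk _ (D.boxOut b p)
  finite_wire :=
    have := D.finite_wire
    Finite.of_surjective _ Quot.mk_surjective
  finite_box := D.finite_box
  label_inp p := D.label_inp (Sum.inl p)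
  label_out p := D.label_out (Sum.inl p)
  label_boxIn := D.label_boxIn
  label_boxOut := D.label_boxOut

end TraceDiagram

/-- The expanded diagram of a morphism term. -/
def TraceTerm.diagram {S : TraceSignature.{w}} :
    ∀ {A B : ObjTerm S.Obj}, TraceTerm S A B → TraceDiagram S A B
  | _, _, .var m => TraceDiagram.single m
  | _, _, .id A => TraceDiagram.wiring (Equiv.refl A.Pos) fun _ => rfl
  | _, _, .comp f g => f.diagram.comp g.diagram
  | _, _, .tensor f g => f.diagram.tensor g.diagram
  | _, _, .assoc A B C =>
      TraceDiagram.wiring (Equiv.sumAssoc A.Pos B.Pos C.Pos).symm (by rintro (_ | _ | _) <;> rfl)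
  | _, _, .assocInv A B C =>
      TraceDiagram.wiring (Equiv.sumAssoc A.Pos B.Pos C.Pos) (by rintro ((_ | _) | _) <;> rfl)
  | _, _, .leftUnitor A =>
      TraceDiagram.wiring (Equiv.emptySum Empty A.Pos).symm fun _ => rfl
  | _, _, .leftUnitorInv A =>
      TraceDiagram.wiring (Equiv.emptySum Empty A.Pos) (by rintro (h | _); exacts [h.elim, rfl])
  | _, _, .rightUnitor A =>
      TraceDiagram.wiring (Equiv.sumEmpty A.Pos Empty).symm fun _ => rfl
  | _, _, .rightUnitorInv A =>
      TraceDiagram.wiring (Equiv.sumEmpty A.Pos Empty) (by rintro (_ | h); exacts [rfl, h.elim])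
  | _, _, .symm A B =>
      TraceDiagram.wiring (Equiv.sumComm B.Pos A.Pos) (by rintro (_ | _) <;> rfl)
  | _, _, .trace f => f.diagram.trace

/-- A graphical proof of `s = t`: a chain of morphism terms from `s` to `t` in which any two
successive terms have the same expanded diagram up to isomorphism. -/
def GraphicallyProvable {S : TraceSignature.{w}} {A B : ObjTerm S.Obj} (s t : TraceTerm S A B) :
    Prop :=
  Relation.ReflTransGen (fun p q : TraceTerm S A B => Nonempty (p.diagram.Iso q.diagram)) s t

/-! ### Label-preserving bijections between object terms -/

/-! A term whose value is defined can be brought, with the same value, into a form with a single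
trace: all boxes side by side, together with some additional wires, fed back along a permutation of
wires. Such a network is one partial trace of a morphism that always exists, so the undefinedness of
nested subterms no longer matters. The directed axioms suffice for this reduction, because each step
starts from a trace known to be defined (`exists_net_of_mem_peval`): by yanking and naturality a
composite is a juxtaposition with feedback (`comp_mem_ptr`), strength pulls traces out of
juxtapositions (`tens_mem_ptr`), and vanishing II merges nested traces (`ptr_mem_net`).

Networks are then compared by Kleene equalities, with no assumption of definedness. Dinaturality
renumbers boxes and additional wires (`net_congr`). An additional wire that is not a loop can be
pulled straight (`net_eq_of_yank`): its own trace is defined by yanking, strength and naturality,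
and this is the case in which vanishing II is an equality. Afterwards all additional wires are loops
(`exists_normal_net`), and such a network is determined up to renumbering by the diagram that it
draws (`net_eq_of_drawnBy`). Hence defined values of terms with isomorphic diagrams belong to the
same partial value (`eq_of_diagram_iso`). Underneath lies coherence for symmetric monoidal
categories (`StructTerm.eval_eq_of_perm_eq`), which gives a permutation of wires a well-defined
value.

Both parts of the theorem reduce to an isomorphism of diagrams. Isomorphisms compose, so a graphical
proof yields one whatever becomes of the intermediate terms. For total laws, terms modulo
isomorphism of diagrams form a totally traced category in which every term denotes its own class
(`TermObj.eval_valuation`); a law holds there, so its two sides have isomorphic diagrams. -/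

instance ObjTerm.instFinitePos {O : Type w} (A : ObjTerm O) : Finite A.Pos := A.finite_pos

/-- A rewiring from `A` to `B`: a label-preserving bijection from the wires of `A` to those
of `B`. -/
structure Rewiring {O : Type w} (A B : ObjTerm O) where
  toEquiv : A.Pos ≃ B.Pos
  label_eq : ∀ p, B.label (toEquiv p) = A.label p

namespace Rewiring

variable {O : Type w} {A B C D A' B' : ObjTerm O}

instance : CoeFun (Rewiring A B) (fun _ => A.Pos → B.Pos) := ⟨fun e => e.toEquiv⟩

theorem ext_fun {e f : Rewiring A B} (h : ∀ p, e p = f p) : e = f := by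
  obtain ⟨e, _⟩ := e
  obtain ⟨f, _⟩ := f
  obtain rfl : e = f := Equiv.ext h
  rfl

/-- The identity rewiring. -/
def refl (A : ObjTerm O) : Rewiring A A := ⟨Equiv.refl _, fun _ => rfl⟩

/-- The inverse of a rewiring. -/
def symm (e : Rewiring A B) : Rewiring B A :=
  ⟨e.toEquiv.symm, fun p => by rw [← e.label_eq, Equiv.apply_symm_apply]⟩

/-- The composite of two rewirings, in diagrammatic order. -/
def trans (e : Rewiring A B) (f : Rewiring B C) : Rewiring A C :=
  ⟨e.toEquiv.trans f.toEquiv, fun p => (f.label_eq _).trans (e.label_eq p)⟩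

/-- Juxtaposition of rewirings. -/
def sum (e : Rewiring A B) (f : Rewiring A' B') : Rewiring (A.tensor A') (B.tensor B') :=
  ⟨Equiv.sumCongr e.toEquiv f.toEquiv, Sum.rec e.label_eq f.label_eq⟩

/-- Reassociation. -/
def assoc (A B C : ObjTerm O) : Rewiring ((A.tensor B).tensor C) (A.tensor (B.tensor C)) :=
  ⟨Equiv.sumAssoc A.Pos B.Pos C.Pos, by rintro ((_ | _) | _) <;> rfl⟩

/-- Removal of a unit on the left. -/
def leftUnitor (A : ObjTerm O) : Rewiring (ObjTerm.unit.tensor A) A :=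
  ⟨Equiv.emptySum Empty A.Pos, by rintro (h | _); exacts [h.elim, rfl]⟩

/-- Removal of a unit on the right. -/
def rightUnitor (A : ObjTerm O) : Rewiring (A.tensor ObjTerm.unit) A :=
  ⟨Equiv.sumEmpty A.Pos Empty, by rintro (_ | h); exacts [rfl, h.elim]⟩

/-- The crossing of two bundles of wires. -/
def braid (A B : ObjTerm O) : Rewiring (A.tensor B) (B.tensor A) :=
  ⟨Equiv.sumComm A.Pos B.Pos, by rintro (_ | _) <;> rfl⟩

@[simp] theorem refl_apply (p : A.Pos) : refl A p = p := rfl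
@[simp] theorem trans_apply (e : Rewiring A B) (f : Rewiring B C) (p : A.Pos) :
    e.trans f p = f (e p) := rfl
@[simp] theorem symm_apply_apply (e : Rewiring A B) (p : A.Pos) : e.symm (e p) = p :=
  e.toEquiv.symm_apply_apply p
@[simp] theorem apply_symm_apply (e : Rewiring A B) (p : B.Pos) : e (e.symm p) = p :=
  e.toEquiv.apply_symm_apply p

theorem injective (e : Rewiring A B) {p q : A.Pos} (h : e p = e q) : p = q :=
  e.toEquiv.injective h

theorem symm_apply_eq (e : Rewiring A B) {p : A.Pos} {q : B.Pos} : e.symm q = p ↔ q = e p :=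
  e.toEquiv.symm_apply_eq

@[simp] theorem trans_symm_self (e : Rewiring A B) : e.trans e.symm = refl A :=
  ext_fun fun p => by simp

@[simp] theorem symm_trans_self (e : Rewiring A B) : e.symm.trans e = refl B :=
  ext_fun fun p => by simp

end Rewiring

/-! ### Structural terms -/

/-- Structural terms of symmetric monoidal categories. -/
inductive StructTerm {O : Type w} : ObjTerm O → ObjTerm O → Type w
  | id (A : ObjTerm O) : StructTerm A A
  | comp {A B C : ObjTerm O} (f : StructTerm A B) (g : StructTerm B C) : StructTerm A C
  | inv {A B : ObjTerm O} (f : StructTerm A B) : StructTerm B A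
  | tensor {A B C D : ObjTerm O} (f : StructTerm A B) (g : StructTerm C D) :
      StructTerm (.tensor A C) (.tensor B D)
  | assoc (A B C : ObjTerm O) :
      StructTerm (.tensor (.tensor A B) C) (.tensor A (.tensor B C))
  | leftUnitor (A : ObjTerm O) : StructTerm (.tensor .unit A) A
  | braid (A B : ObjTerm O) : StructTerm (.tensor A B) (.tensor B A)

namespace StructTerm

variable {O : Type w}

/-- The rewiring that underlies a structural term. -/
def perm : ∀ {A B : ObjTerm O}, StructTerm A B → Rewiring A B
  | _, _, .id A => .refl A
  | _, _, .comp f g => f.perm.trans g.perm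
  | _, _, .inv f => f.perm.symm
  | _, _, .tensor f g => f.perm.sum g.perm
  | _, _, .assoc A B C => .assoc A B C
  | _, _, .leftUnitor A => .leftUnitor A
  | _, _, .braid A B => .braid A B

section Eval

variable {C : Type u} [Category.{v} C] [MonoidalCategory C] [SymmetricCategory C]

/-- The value of a structural term in a symmetric monoidal category. -/
def eval (o : O → C) : ∀ {A B : ObjTerm O}, StructTerm A B → (A.eval o ≅ B.eval o)
  | _, _, .id A => Iso.refl _
  | _, _, .comp f g => f.eval o ≪≫ g.eval o
  | _, _, .inv f => (f.eval o).symm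
  | _, _, .tensor f g => f.eval o ⊗ᵢ g.eval o
  | _, _, .assoc A B C => α_ (A.eval o) (B.eval o) (C.eval o)
  | _, _, .leftUnitor A => λ_ (A.eval o)
  | _, _, .braid A B => β_ (A.eval o) (B.eval o)

end Eval

end StructTerm

/-! ### Deleting one wire from an object term. -/

namespace ObjTerm

variable {O : Type w}

/-- Replaces the variable at a position by the unit. -/
def erase : (A : ObjTerm O) → A.Pos → ObjTerm O
  | .var _, _ => .unit
  | .tensor A B, Sum.inl p => .tensor (A.erase p) B
  | .tensor A B, Sum.inr p => .tensor A (B.erase p)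

/-- The remaining positions after one of them is erased. -/
def incl : (A : ObjTerm O) → (p : A.Pos) → (A.erase p).Pos → A.Pos
  | .var _, _, x => Empty.elim x
  | .tensor A _, Sum.inl p, x => Sum.map (A.incl p) _root_.id x
  | .tensor _ B, Sum.inr p, x => Sum.map _root_.id (B.incl p) x

theorem incl_ne : ∀ (A : ObjTerm O) (p : A.Pos) (x : (A.erase p).Pos), A.incl p x ≠ p
  | .var _, _, x => Empty.elim x
  | .tensor A _, Sum.inl p, Sum.inl x => fun h => A.incl_ne p x (Sum.inl.inj h)
  | .tensor _ B, Sum.inl p, Sum.inr x => fun h => by cases h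
  | .tensor A _, Sum.inr p, Sum.inl x => fun h => by cases h
  | .tensor _ B, Sum.inr p, Sum.inr x => fun h => B.incl_ne p x (Sum.inr.inj h)

theorem incl_injective : ∀ (A : ObjTerm O) (p : A.Pos), Function.Injective (A.incl p)
  | .var _, _ => fun x => Empty.elim x
  | .tensor A _, Sum.inl p => (A.incl_injective p).sumMap Function.injective_id
  | .tensor _ B, Sum.inr p => Function.injective_id.sumMap (B.incl_injective p)

theorem exists_incl : ∀ (A : ObjTerm O) (p y : A.Pos), y ≠ p → ∃ x, A.incl p x = y
  | .var _, _, _ => fun h => (h rfl).elim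
  | .tensor A _, Sum.inl p, Sum.inl y => fun h =>
      (A.exists_incl p y fun h' => h (congrArg _ h')).elim fun x hx =>
        ⟨Sum.inl x, congrArg Sum.inl hx⟩
  | .tensor _ _, Sum.inl _, Sum.inr y => fun _ => ⟨Sum.inr y, rfl⟩
  | .tensor _ _, Sum.inr _, Sum.inl y => fun _ => ⟨Sum.inl y, rfl⟩
  | .tensor _ B, Sum.inr p, Sum.inr y => fun h =>
      (B.exists_incl p y fun h' => h (congrArg _ h')).elim fun x hx =>
        ⟨Sum.inr x, congrArg Sum.inr hx⟩

theorem label_incl : ∀ (A : ObjTerm O) (p : A.Pos) (x : (A.erase p).Pos),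
    A.label (A.incl p x) = (A.erase p).label x
  | .var _, _, x => Empty.elim x
  | .tensor A _, Sum.inl p, Sum.inl x => A.label_incl p x
  | .tensor _ _, Sum.inl _, Sum.inr _ => rfl
  | .tensor _ _, Sum.inr _, Sum.inl _ => rfl
  | .tensor _ B, Sum.inr p, Sum.inr x => B.label_incl p x

/-- The measure for the inductions on the number of wires: if it did not drop, the injection `A.incl
p` would be onto, yet it misses `p`. -/
theorem card_erase (A : ObjTerm O) (p : A.Pos) : Nat.card (A.erase p).Pos < Nat.card A.Pos := by
  by_contra h
  have hs := (A.incl_injective p).bijective_of_nat_card_le (not_lt.1 h)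
  obtain ⟨x, hx⟩ := hs.2 p
  exact A.incl_ne p x hx

end ObjTerm

/-! ### Moving one wire to the front. -/

namespace StructTerm

variable {O : Type w}

/-- The structural term that moves the wire at `p` to the left. -/
def extract : ∀ (A : ObjTerm O) (p : A.Pos) (X : O), A.label p = X →
    StructTerm A (.tensor (.var X) (A.erase p))
  -- The right unitor is not a generator of structural terms, so the variable acquires its unit on
  -- the left and is braided past it.
  | .var _, _, _, rfl => .comp (.inv (.leftUnitor _)) (.braid _ _)
  | .tensor A B, Sum.inl p, X, h => .comp (.tensor (extract A p X h) (.id B)) (.assoc _ _ _)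
  | .tensor A B, Sum.inr p, X, h =>
      .comp (.tensor (.id A) (extract B p X h)) (.comp (.inv (.assoc _ _ _))
        (.comp (.tensor (.braid _ _) (.id _)) (.assoc _ _ _)))

theorem perm_extract_self : ∀ (A : ObjTerm O) (p : A.Pos) (X : O) (h : A.label p = X),
    (extract A p X h).perm p = Sum.inl ()
  | .var _, _, _, rfl => rfl
  | .tensor A B, Sum.inl p, X, h => by
      change Equiv.sumAssoc _ _ _ (Sum.inl ((extract A p X h).perm p)) = _
      rw [perm_extract_self A p X h]; rfl
  | .tensor A B, Sum.inr p, X, h => by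
      have := perm_extract_self B p X h
      exact congrArg (fun y => Rewiring.assoc _ _ _ ((Rewiring.braid A (.var X)).sum (.refl _)
        ((Rewiring.assoc _ _ _).symm (Sum.inr y)))) this

theorem perm_extract_incl : ∀ (A : ObjTerm O) (p : A.Pos) (X : O) (h : A.label p = X)
    (x : (A.erase p).Pos), (extract A p X h).perm (A.incl p x) = Sum.inr x
  | .var _, _, _, rfl, x => Empty.elim x
  | .tensor A B, Sum.inl p, X, h, Sum.inl x => by
      change Equiv.sumAssoc _ _ _ (Sum.inl ((extract A p X h).perm (A.incl p x))) = _
      rw [perm_extract_incl A p X h]; rfl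
  | .tensor A B, Sum.inl p, X, h, Sum.inr x => rfl
  | .tensor A B, Sum.inr p, X, h, Sum.inl x => rfl
  | .tensor A B, Sum.inr p, X, h, Sum.inr x => by
      have := perm_extract_incl B p X h x
      change (extract (.tensor A B) (Sum.inr p) X h).perm (Sum.inr (B.incl p x)) = _
      exact congrArg (fun y => Rewiring.assoc _ _ _ ((Rewiring.braid A (.var X)).sum (.refl _)
        ((Rewiring.assoc _ _ _).symm (Sum.inr y)))) this

/-- A structural term to the unit, from an object term without variables. -/
def toUnit : ∀ A : ObjTerm O, IsEmpty A.Pos → StructTerm A .unit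
  | .var _, h => (h.false ()).elim
  | .unit, _ => .id _
  | .tensor A B, h => .comp (.tensor (toUnit A ⟨fun p => h.false (Sum.inl p)⟩)
      (toUnit B ⟨fun p => h.false (Sum.inr p)⟩)) (.leftUnitor _)

/-! ### Coherence for symmetric monoidal categories. -/

section Coherence

variable {C : Type u} [Category.{v} C] [MonoidalCategory C]

/-- The lemmas from here to `extract_braid_inr` are the cases of the inductions in `eval_toUnit` and
`exists_eval_extract`, for arbitrary objects of `C`. -/
theorem toUnit_assoc {A B D : C} (a : A ⟶ 𝟙_ C) (b : B ⟶ 𝟙_ C) (d : D ⟶ 𝟙_ C) :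
    (α_ A B D).hom ≫ (a ⊗ₘ ((b ⊗ₘ d) ≫ (λ_ _).hom)) ≫ (λ_ _).hom =
      (((a ⊗ₘ b) ≫ (λ_ _).hom) ⊗ₘ d) ≫ (λ_ _).hom := by
  simp only [MonoidalCategory.tensorHom_def]
  monoidal

theorem toUnit_leftUnitor {A : C} (a : A ⟶ 𝟙_ C) :
    (λ_ A).hom ≫ a = (𝟙 _ ⊗ₘ a) ≫ (λ_ _).hom := by
  simp

theorem extract_comp {A B D A' B' D' X : C} {f : A ⟶ B} {g : B ⟶ D} {f' : A' ⟶ B'} {g' : B' ⟶ D'}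
    {eA : A ⟶ X ⊗ A'} {eB : B ⟶ X ⊗ B'} {eD : D ⟶ X ⊗ D'} (hf : f ≫ eB = eA ≫ X ◁ f')
    (hg : g ≫ eD = eB ≫ X ◁ g') : (f ≫ g) ≫ eD = eA ≫ X ◁ (f' ≫ g') := by
  rw [Category.assoc, hg, reassoc_of% hf, whiskerLeft_comp]

theorem extract_inv {A B A' B' X : C} {f : A ≅ B} {f' : A' ≅ B'} {eA : A ⟶ X ⊗ A'}
    {eB : B ⟶ X ⊗ B'} (hf : f.hom ≫ eB = eA ≫ X ◁ f'.hom) : f.inv ≫ eA = eB ≫ X ◁ f'.inv := by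
  rw [Iso.inv_comp_eq, reassoc_of% hf, ← whiskerLeft_comp, Iso.hom_inv_id, whiskerLeft_id,
    Category.comp_id]

theorem extract_assoc_left {A A' B D X : C} (e : A ⟶ X ⊗ A') :
    (α_ A B D).hom ≫ (e ⊗ₘ 𝟙 (B ⊗ D)) ≫ (α_ _ _ _).hom =
      ((((e ⊗ₘ 𝟙 B) ≫ (α_ _ _ _).hom) ⊗ₘ 𝟙 D) ≫ (α_ _ _ _).hom) ≫ X ◁ (α_ A' B D).hom := by
  simp

theorem extract_tensor_inl {A A' B D F X : C} {E : C} (f : A ⟶ B) (g : D ⟶ F) (f' : A' ⟶ E)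
    (eA : A ⟶ X ⊗ A') (eB : B ⟶ X ⊗ E) (h : f ≫ eB = eA ≫ X ◁ f') :
    (f ⊗ₘ g) ≫ (eB ⊗ₘ 𝟙 F) ≫ (α_ _ _ _).hom =
      ((eA ⊗ₘ 𝟙 D) ≫ (α_ _ _ _).hom) ≫ X ◁ (f' ⊗ₘ g) := by
  rw [tensorHom_comp_tensorHom_assoc, h]
  simp [MonoidalCategory.tensorHom_def]

variable [SymmetricCategory C]

theorem toUnit_braid {A B : C} (a : A ⟶ 𝟙_ C) (b : B ⟶ 𝟙_ C) :
    (β_ A B).hom ≫ (b ⊗ₘ a) ≫ (λ_ _).hom = (a ⊗ₘ b) ≫ (λ_ _).hom := by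
  rw [← BraidedCategory.braiding_naturality_assoc, braiding_leftUnitor, unitors_equal]

theorem extract_tensor_inr {A B D D' F F' X : C} (f : A ⟶ B) (g : D ⟶ F) (g' : D' ⟶ F')
    (eD : D ⟶ X ⊗ D') (eF : F ⟶ X ⊗ F') (h : g ≫ eF = eD ≫ X ◁ g') :
    (f ⊗ₘ g) ≫ (𝟙 B ⊗ₘ eF) ≫ (α_ _ _ _).inv ≫ ((β_ _ _).hom ⊗ₘ 𝟙 _) ≫ (α_ _ _ _).hom =
      ((𝟙 A ⊗ₘ eD) ≫ (α_ _ _ _).inv ≫ ((β_ _ _).hom ⊗ₘ 𝟙 _) ≫ (α_ _ _ _).hom) ≫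
        X ◁ (f ⊗ₘ g') := by
  rw [tensorHom_comp_tensorHom_assoc, h]
  simp only [MonoidalCategory.tensorHom_def, Category.comp_id, whiskerLeft_comp, Category.assoc,
    whiskerLeft_id, id_whiskerRight, Category.id_comp]
  rw [associator_inv_naturality_right_assoc, whisker_exchange_assoc,
    associator_naturality_right, ← whisker_exchange_assoc, associator_inv_naturality_left_assoc,
    ← comp_whiskerRight_assoc, BraidedCategory.braiding_naturality_left, comp_whiskerRight_assoc,
    associator_naturality_middle_assoc]

theorem extract_assoc_middle {A B B' D X : C} (e : B ⟶ X ⊗ B') :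
    (α_ A B D).hom ≫ (𝟙 A ⊗ₘ ((e ⊗ₘ 𝟙 D) ≫ (α_ _ _ _).hom)) ≫
        (α_ _ _ _).inv ≫ ((β_ _ _).hom ⊗ₘ 𝟙 _) ≫ (α_ _ _ _).hom =
      ((((𝟙 A ⊗ₘ e) ≫ (α_ _ _ _).inv ≫ ((β_ _ _).hom ⊗ₘ 𝟙 _) ≫ (α_ _ _ _).hom) ⊗ₘ 𝟙 D) ≫
        (α_ _ _ _).hom) ≫ X ◁ (α_ A B' D).hom := by
  simp

theorem extract_assoc_right {A B D D' X : C} (e : D ⟶ X ⊗ D') :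
    (α_ A B D).hom ≫ (𝟙 A ⊗ₘ ((𝟙 B ⊗ₘ e) ≫ (α_ _ _ _).inv ≫ ((β_ _ _).hom ⊗ₘ 𝟙 _) ≫
        (α_ _ _ _).hom)) ≫ (α_ _ _ _).inv ≫ ((β_ _ _).hom ⊗ₘ 𝟙 _) ≫ (α_ _ _ _).hom =
      ((𝟙 (A ⊗ B) ⊗ₘ e) ≫ (α_ _ _ _).inv ≫ ((β_ _ _).hom ⊗ₘ 𝟙 _) ≫ (α_ _ _ _).hom) ≫
        X ◁ (α_ A B D').hom := by
  simp

theorem extract_leftUnitor {A A' X : C} (e : A ⟶ X ⊗ A') :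
    (λ_ A).hom ≫ e =
      ((𝟙 (𝟙_ C) ⊗ₘ e) ≫ (α_ _ _ _).inv ≫ ((β_ _ _).hom ⊗ₘ 𝟙 _) ≫ (α_ _ _ _).hom) ≫
        X ◁ (λ_ A').hom := by
  simp

theorem extract_braid_inl {A A' B X : C} (e : A ⟶ X ⊗ A') :
    (β_ A B).hom ≫ (𝟙 B ⊗ₘ e) ≫ (α_ _ _ _).inv ≫ ((β_ _ _).hom ⊗ₘ 𝟙 _) ≫ (α_ _ _ _).hom =
      ((e ⊗ₘ 𝟙 B) ≫ (α_ _ _ _).hom) ≫ X ◁ (β_ A' B).hom := by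
  rw [id_tensorHom, ← BraidedCategory.braiding_naturality_left_assoc]
  simp [← comp_whiskerRight_assoc, -comp_whiskerRight]

theorem extract_braid_inr {A B B' X : C} (e : B ⟶ X ⊗ B') :
    (β_ A B).hom ≫ (e ⊗ₘ 𝟙 A) ≫ (α_ _ _ _).hom =
      ((𝟙 A ⊗ₘ e) ≫ (α_ _ _ _).inv ≫ ((β_ _ _).hom ⊗ₘ 𝟙 _) ≫ (α_ _ _ _).hom) ≫
        X ◁ (β_ A B').hom := by
  rw [tensorHom_id, ← BraidedCategory.braiding_naturality_right_assoc]
  simp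

variable {O : Type w} (o : O → C)

/-- The base case of coherence: as `toUnit B` has an invertible value, only one value is left for a
structural term between object terms without wires. -/
theorem eval_toUnit {A B : ObjTerm O} (t : StructTerm A B) (hA : IsEmpty A.Pos)
    (hB : IsEmpty B.Pos) :
    (t.eval o).hom ≫ ((toUnit B hB).eval o).hom = ((toUnit A hA).eval o).hom := by
  induction t with
  | id A => exact Category.id_comp _
  | comp f g hf hg =>
    have := f.perm.toEquiv.symm.isEmpty
    exact (Category.assoc _ _ _).trans ((congrArg _ (hg this hB)).trans (hf hA this))
  | inv f hf => exact (Iso.inv_comp_eq _).2 (hf hB hA).symm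
  | tensor f g hf hg =>
    refine (tensorHom_comp_tensorHom_assoc _ _ _ _ _).trans ?_
    rw [hf ⟨fun p => hA.false (Sum.inl p)⟩, hg ⟨fun p => hA.false (Sum.inr p)⟩]
    rfl
  | assoc A B D => exact toUnit_assoc _ _ _
  | leftUnitor A => exact toUnit_leftUnitor _
  | braid A B => exact toUnit_braid _ _

/-- Naturality of extraction, the inductive step of coherence. Erasure keeps the bracketing and puts
a unit in place of the variable, so every generator restricts to a generator of the same kind and
`t'` has the shape of `t`. -/
theorem exists_eval_extract {A B : ObjTerm O} (t : StructTerm A B) :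
    ∀ (p : A.Pos) (q : B.Pos), t.perm p = q → ∃ t' : StructTerm (A.erase p) (B.erase q),
      (∀ x, B.incl q (t'.perm x) = t.perm (A.incl p x)) ∧
      ∀ (X : O) (hp : A.label p = X) (hq : B.label q = X),
        (t.eval o).hom ≫ ((extract B q X hq).eval o).hom =
          ((extract A p X hp).eval o).hom ≫ o X ◁ (t'.eval o).hom := by
  induction t with
  | id A =>
    rintro p _ rfl
    refine ⟨.id _, fun _ => rfl, fun X hp hq => ?_⟩
    refine (Category.id_comp _).trans ?_
    erw [whiskerLeft_id, Category.comp_id]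
    rfl
  | comp f g hf hg =>
    rintro p _ rfl
    obtain ⟨f', hf', ef⟩ := hf p _ rfl
    obtain ⟨g', hg', eg⟩ := hg _ _ rfl
    refine ⟨f'.comp g', fun x => (hg' _).trans (congrArg g.perm (hf' x)), fun X hp hq => ?_⟩
    have hm := (f.perm.label_eq p).trans hp
    exact extract_comp (ef X hp hm) (eg X hm hq)
  | inv f hf =>
    intro p q hq
    obtain ⟨f', hf', ef⟩ := hf q p (by rw [← hq]; exact f.perm.apply_symm_apply p)
    refine ⟨f'.inv, fun x => ?_, fun X hp hq => ?_⟩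
    · refine f.perm.injective ((hf' _).symm.trans ?_)
      refine (congrArg _ (f'.perm.apply_symm_apply x)).trans ?_
      exact (f.perm.apply_symm_apply _).symm
    · exact extract_inv (ef X hq hp)
  | tensor f g hf hg =>
    rintro (p | p) _ rfl
    · obtain ⟨f', hf', ef⟩ := hf p _ rfl
      refine ⟨.tensor f' g, ?_, fun X hp hq => extract_tensor_inl _ _ _ _ _ (ef X hp hq)⟩
      rintro (x | x)
      · exact congrArg Sum.inl (hf' x)
      · rfl
    · obtain ⟨g', hg', eg⟩ := hg p _ rfl
      refine ⟨.tensor f g', ?_, fun X hp hq => extract_tensor_inr _ _ _ _ _ (eg X hp hq)⟩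
      rintro (x | x)
      · rfl
      · exact congrArg Sum.inr (hg' x)
  | assoc A B D =>
    rintro ((p | p) | p) _ rfl
    · exact ⟨.assoc _ _ _, by rintro ((_ | _) | _) <;> rfl, fun X hp hq => extract_assoc_left _⟩
    · exact ⟨.assoc _ _ _, by rintro ((_ | _) | _) <;> rfl, fun X hp hq => extract_assoc_middle _⟩
    · exact ⟨.assoc _ _ _, by rintro ((_ | _) | _) <;> rfl, fun X hp hq => extract_assoc_right _⟩
  | leftUnitor A =>
    rintro (p | p) _ rfl
    · exact p.elim
    · refine ⟨.leftUnitor _, ?_, fun X hp hq => extract_leftUnitor _⟩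
      rintro (x | x)
      · exact x.elim
      · rfl
  | braid A B =>
    rintro (p | p) _ rfl
    · exact ⟨.braid _ _, by rintro (_ | _) <;> rfl, fun X hp hq => extract_braid_inl _⟩
    · exact ⟨.braid _ _, by rintro (_ | _) <;> rfl, fun X hp hq => extract_braid_inr _⟩

/-- Coherence for symmetric monoidal categories: the value of a structural term depends only on
its underlying rewiring. -/
theorem eval_eq_of_perm_eq {A B : ObjTerm O} (s t : StructTerm A B)
    (h : ∀ p, s.perm p = t.perm p) : s.eval o = t.eval o := by
  induction hn : Nat.card A.Pos using Nat.strong_induction_on generalizing A B with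
  | _ n ih =>
    apply Iso.ext
    rcases isEmpty_or_nonempty A.Pos with hA | ⟨⟨p⟩⟩
    · have hB := s.perm.toEquiv.symm.isEmpty
      rw [← cancel_mono ((toUnit B hB).eval o).hom, eval_toUnit o s hA, eval_toUnit o t hA]
    · obtain ⟨s', hs', es⟩ := exists_eval_extract o s p _ rfl
      obtain ⟨t', ht', et⟩ := exists_eval_extract o t p _ (h p).symm
      -- Both terms send `p` to the same position, so after extraction of that wire they differ at
      -- most in the values of the smaller terms `s'` and `t'`.
      have hst := ih _ (hn ▸ A.card_erase p) s' t'
        (fun x => B.incl_injective _ ((hs' x).trans ((h _).trans (ht' x).symm))) rfl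
      rw [← cancel_mono ((extract B (s.perm p) _ (s.perm.label_eq p)).eval o).hom,
        es _ rfl, et _ rfl, hst]

end Coherence

/-- The rewiring that a rewiring induces on the wires other than a given one. -/
theorem exists_erase {O : Type w} {A B : ObjTerm O} (e : Rewiring A B) (p : A.Pos) :
    ∃ f : Rewiring (A.erase p) (B.erase (e p)),
      ∀ x, B.incl _ (f x) = e (A.incl p x) := by
  have h : ∀ x, ∃ y, B.incl (e p) y = e (A.incl p x) := fun x =>
    B.exists_incl _ _ fun h => A.incl_ne p x (e.injective h)
  choose f hf using h
  refine ⟨⟨Equiv.ofBijective f ⟨fun x y hxy => ?_, fun y => ?_⟩, fun x => ?_⟩, hf⟩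
  · exact A.incl_injective p (e.injective ((hf x).symm.trans ((congrArg _ hxy).trans (hf y))))
  · obtain ⟨x, hx⟩ := A.exists_incl p (e.symm (B.incl _ y)) fun h =>
      B.incl_ne _ y ((e.symm_apply_eq).1 h)
    refine ⟨x, B.incl_injective _ ?_⟩
    rw [hf, hx, Rewiring.apply_symm_apply]
  · change (B.erase (e p)).label (f x) = _
    rw [← B.label_incl, hf, e.label_eq, A.label_incl]

/-- Every rewiring underlies a structural term. -/
theorem exists_perm_eq {O : Type w} {A B : ObjTerm O} (e : Rewiring A B) :
    ∃ t : StructTerm A B, t.perm = e := by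
  induction hn : Nat.card A.Pos using Nat.strong_induction_on generalizing A B with
  | _ n ih =>
    rcases isEmpty_or_nonempty A.Pos with hA | ⟨⟨p⟩⟩
    · have hB := e.toEquiv.symm.isEmpty
      exact ⟨(toUnit A hA).comp (toUnit B hB).inv, Rewiring.ext_fun fun p => hA.elim p⟩
    · obtain ⟨f, hf⟩ := exists_erase e p
      obtain ⟨t, ht⟩ := ih _ (hn ▸ A.card_erase p) f rfl
      -- Bring `p` to the front, rewire the other wires by induction, and put the front wire back at
      -- `e p`.
      refine ⟨(extract A p _ rfl).comp ((StructTerm.tensor (.id _) t).comp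
        (extract B (e p) _ (e.label_eq p)).inv), Rewiring.ext_fun fun q => ?_⟩
      refine (extract B (e p) _ (e.label_eq p)).perm.toEquiv.symm_apply_eq.2 ?_
      change (Rewiring.refl _).sum t.perm ((extract A p _ rfl).perm q) = _
      by_cases hq : q = p
      · rw [hq, perm_extract_self, perm_extract_self]
        rfl
      · obtain ⟨x, rfl⟩ := A.exists_incl p q hq
        rw [perm_extract_incl, ← hf, perm_extract_incl, ht]
        rfl

end StructTerm

/-! ### The value of a rewiring -/

section PermHom

variable {O : Type w} {C : Type u} [Category.{v} C] [MonoidalCategory C] [SymmetricCategory C]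
  (o : O → C)

/-- The canonical morphism that realizes a rewiring in a symmetric monoidal category. -/
noncomputable def permHom {A B : ObjTerm O} (e : Rewiring A B) : A.eval o ⟶ B.eval o :=
  ((StructTerm.exists_perm_eq e).choose.eval o).hom

/-- By coherence the choice made in `permHom` is immaterial. From here on, identities between
structural morphisms are proved by comparing bijections of wires. -/
theorem permHom_perm {A B : ObjTerm O} (t : StructTerm A B) :
    permHom o t.perm = (t.eval o).hom :=
  congrArg Iso.hom (StructTerm.eval_eq_of_perm_eq o _ _ fun p =>
    congrArg (fun e : Rewiring A B => e p) (StructTerm.exists_perm_eq t.perm).choose_spec)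

theorem permHom_refl (A : ObjTerm O) : permHom o (.refl A) = 𝟙 (A.eval o) :=
  permHom_perm o (.id A)

theorem permHom_trans {A B D : ObjTerm O} (e : Rewiring A B) (f : Rewiring B D) :
    permHom o (e.trans f) = permHom o e ≫ permHom o f := by
  obtain ⟨s, rfl⟩ := StructTerm.exists_perm_eq e
  obtain ⟨t, rfl⟩ := StructTerm.exists_perm_eq f
  rw [permHom_perm, permHom_perm]
  exact permHom_perm o (s.comp t)

theorem permHom_comp_symm {A B : ObjTerm O} (e : Rewiring A B) :
    permHom o e ≫ permHom o e.symm = 𝟙 _ := by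
  rw [← permHom_trans, Rewiring.trans_symm_self, permHom_refl]

theorem permHom_symm_comp {A B : ObjTerm O} (e : Rewiring A B) :
    permHom o e.symm ≫ permHom o e = 𝟙 _ := by
  rw [← permHom_trans, Rewiring.symm_trans_self, permHom_refl]

theorem permHom_sum {A B A' B' : ObjTerm O} (e : Rewiring A B) (f : Rewiring A' B') :
    permHom o (e.sum f) = (permHom o e ⊗ₘ permHom o f : A.eval o ⊗ A'.eval o ⟶ _) := by
  obtain ⟨s, rfl⟩ := StructTerm.exists_perm_eq e
  obtain ⟨t, rfl⟩ := StructTerm.exists_perm_eq f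
  rw [permHom_perm, permHom_perm]
  exact permHom_perm o (s.tensor t)

theorem permHom_assoc (A B D : ObjTerm O) :
    permHom o (.assoc A B D) = (α_ (A.eval o) (B.eval o) (D.eval o)).hom :=
  permHom_perm o (.assoc A B D)

theorem permHom_assoc_symm (A B D : ObjTerm O) :
    permHom o (Rewiring.assoc A B D).symm = (α_ (A.eval o) (B.eval o) (D.eval o)).inv :=
  permHom_perm o (.inv (.assoc A B D))

theorem permHom_leftUnitor (A : ObjTerm O) :
    permHom o (.leftUnitor A) = (λ_ (A.eval o)).hom :=
  permHom_perm o (.leftUnitor A)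

theorem permHom_leftUnitor_symm (A : ObjTerm O) :
    permHom o (Rewiring.leftUnitor A).symm = (λ_ (A.eval o)).inv :=
  permHom_perm o (.inv (.leftUnitor A))

theorem Rewiring.rightUnitor_eq (A : ObjTerm O) :
    Rewiring.rightUnitor A = (StructTerm.comp (.braid A .unit) (.leftUnitor A)).perm :=
  Rewiring.ext_fun (by rintro (p | p); exacts [rfl, p.elim])

theorem permHom_rightUnitor (A : ObjTerm O) :
    permHom o (.rightUnitor A) = (ρ_ (A.eval o)).hom := by
  rw [Rewiring.rightUnitor_eq, permHom_perm]
  exact braiding_leftUnitor _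

theorem permHom_rightUnitor_symm (A : ObjTerm O) :
    permHom o (Rewiring.rightUnitor A).symm = (ρ_ (A.eval o)).inv := by
  rw [Rewiring.rightUnitor_eq]
  refine (permHom_perm o (.inv (.comp (.braid A .unit) (.leftUnitor A)))).trans ?_
  exact (Iso.inv_eq_inv (β_ _ _ ≪≫ λ_ _) (ρ_ _)).2 (braiding_leftUnitor _)

theorem permHom_braid (A B : ObjTerm O) :
    permHom o (.braid A B) = (β_ (A.eval o) (B.eval o)).hom :=
  permHom_perm o (.braid A B)

end PermHom

/-! ### Substitution of object terms -/

namespace ObjTerm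

variable {N : Type w} {O : Type w}

/-- Substitutes an object term for every variable. -/
def subst (f : N → ObjTerm O) : ObjTerm N → ObjTerm O
  | .var n => f n
  | .unit => .unit
  | .tensor K K' => .tensor (K.subst f) (K'.subst f)

/-- The wire at `p` of the object term that is substituted at `b`. -/
def port (f : N → ObjTerm O) : (K : ObjTerm N) → (b : K.Pos) → (f (K.label b)).Pos → (K.subst f).Pos
  | .var _, _, p => p
  | .tensor K _, Sum.inl b, p => Sum.inl (port f K b p)
  | .tensor _ K', Sum.inr b, p => Sum.inr (port f K' b p)

theorem exists_port (f : N → ObjTerm O) : ∀ (K : ObjTerm N) (q : (K.subst f).Pos),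
    ∃ b p, port f K b p = q
  | .var _, q => ⟨(), q, rfl⟩
  | .unit, q => Empty.elim q
  | .tensor K _, Sum.inl q =>
      let ⟨b, p, h⟩ := exists_port f K q
      ⟨Sum.inl b, p, congrArg Sum.inl h⟩
  | .tensor _ K', Sum.inr q =>
      let ⟨b, p, h⟩ := exists_port f K' q
      ⟨Sum.inr b, p, congrArg Sum.inr h⟩

end ObjTerm

namespace StructTerm

variable {N : Type w} {O : Type w}

/-- Substitution in a structural term. -/
def subst (f : N → ObjTerm O) : ∀ {K K' : ObjTerm N}, StructTerm K K' →
    StructTerm (K.subst f) (K'.subst f)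
  | _, _, .id _ => .id _
  | _, _, .comp s t => .comp (s.subst f) (t.subst f)
  | _, _, .inv s => .inv (s.subst f)
  | _, _, .tensor s t => .tensor (s.subst f) (t.subst f)
  | _, _, .assoc _ _ _ => .assoc _ _ _
  | _, _, .leftUnitor _ => .leftUnitor _
  | _, _, .braid _ _ => .braid _ _

/-- Substitution makes a structural term move whole blocks of wires. The labels of `b` and `b'`
agree only propositionally, which is why the ports inside the blocks are compared by heterogeneous
equality. -/
theorem perm_subst_port (f : N → ObjTerm O) {K K' : ObjTerm N} (t : StructTerm K K') :
    ∀ (b : K.Pos) (p : (f (K.label b)).Pos) (b' : K'.Pos) (p' : (f (K'.label b')).Pos),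
      t.perm b = b' → HEq p p' → (t.subst f).perm (K.port f b p) = K'.port f b' p' := by
  induction t with
  | id A => rintro b p _ p' rfl h; cases h; rfl
  | comp s t hs ht =>
    rintro b p _ p' rfl h
    refine (congrArg _ (hs b p (s.perm b)
      (cast (congrArg (fun n => (f n).Pos) (s.perm.label_eq b).symm) p) rfl ?_)).trans
      (ht _ _ _ p' rfl ?_)
    · exact (cast_heq _ _).symm
    · exact (cast_heq _ _).trans h
  | inv s hs =>
    rintro b p _ p' rfl h
    refine (s.subst f).perm.symm_apply_eq.2 (hs _ _ _ _ ?_ h.symm).symm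
    exact s.perm.apply_symm_apply b
  | tensor s t hs ht =>
    rintro (b | b) p _ p' rfl h
    · exact congrArg Sum.inl (hs b p _ p' rfl h)
    · exact congrArg Sum.inr (ht b p _ p' rfl h)
  | assoc A B D => rintro ((b | b) | b) p _ p' rfl h <;> cases h <;> rfl
  | leftUnitor A =>
    rintro (b | b) p _ p' rfl h
    · exact b.elim
    · cases h; rfl
  | braid A B => rintro (b | b) p _ p' rfl h <;> cases h <;> rfl

end StructTerm

/-- The rewiring between substitution instances that a rewiring induces. -/
noncomputable def Rewiring.subst {N O : Type w} (f : N → ObjTerm O) {K K' : ObjTerm N}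
    (e : Rewiring K K') : Rewiring (K.subst f) (K'.subst f) :=
  ((StructTerm.exists_perm_eq e).choose.subst f).perm

theorem Rewiring.subst_port {N O : Type w} (f : N → ObjTerm O) {K K' : ObjTerm N}
    (e : Rewiring K K') (b : K.Pos) (p : (f (K.label b)).Pos) (p' : (f (K'.label (e b))).Pos)
    (h : HEq p p') : e.subst f (K.port f b p) = K'.port f (e b) p' :=
  StructTerm.perm_subst_port f _ b p _ p'
    (congrArg (fun e : Rewiring K K' => e b) (StructTerm.exists_perm_eq e).choose_spec) h

/-! ### Morphisms between values of object terms -/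

section Values

variable {O : Type w} {C : Type u} [Category.{v} C] [MonoidalCategory C] {o : O → C}

/-- The tensor product of morphisms between values of object terms. -/
def tens {A B A' B' : ObjTerm O} (f : A.eval o ⟶ B.eval o) (g : A'.eval o ⟶ B'.eval o) :
    (A.tensor A').eval o ⟶ (B.tensor B').eval o :=
  MonoidalCategoryStruct.tensorHom f g

variable {A B D A' B' D' E F : ObjTerm O}

theorem tens_id : tens (𝟙 (A.eval o)) (𝟙 (B.eval o)) = 𝟙 ((A.tensor B).eval o) :=
  id_tensorHom_id _ _

theorem tens_comp (f : A.eval o ⟶ B.eval o) (g : B.eval o ⟶ D.eval o)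
    (f' : A'.eval o ⟶ B'.eval o) (g' : B'.eval o ⟶ D'.eval o) :
    tens f f' ≫ tens g g' = tens (f ≫ g) (f' ≫ g') :=
  tensorHom_comp_tensorHom _ _ _ _

theorem tens_comp_assoc (f : A.eval o ⟶ B.eval o) (g : B.eval o ⟶ D.eval o)
    (f' : A'.eval o ⟶ B'.eval o) (g' : B'.eval o ⟶ D'.eval o)
    {Z : C} (k : (D.tensor D').eval o ⟶ Z) :
    tens f f' ≫ tens g g' ≫ k = tens (f ≫ g) (f' ≫ g') ≫ k := by
  rw [← Category.assoc, tens_comp]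

variable [SymmetricCategory C]

theorem tens_permHom (e : Rewiring A B) (e' : Rewiring A' B') :
    tens (permHom o e) (permHom o e') = permHom o (e.sum e') :=
  (permHom_sum o e e').symm

theorem permHom_trans_assoc (e : Rewiring A B) (f : Rewiring B D) {Z : C} (k : D.eval o ⟶ Z) :
    permHom o e ≫ permHom o f ≫ k = permHom o (e.trans f) ≫ k := by
  rw [permHom_trans, Category.assoc]

theorem tens_assoc (f : A.eval o ⟶ B.eval o) (g : A'.eval o ⟶ B'.eval o)
    (h : D.eval o ⟶ D'.eval o) :
    tens (tens f g) h ≫ permHom o (.assoc _ _ _) = permHom o (.assoc _ _ _) ≫ tens f (tens g h) := by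
  rw [permHom_assoc, permHom_assoc]
  exact associator_naturality f g h

theorem tens_assoc_symm (f : A.eval o ⟶ B.eval o) (g : A'.eval o ⟶ B'.eval o)
    (h : D.eval o ⟶ D'.eval o) :
    tens f (tens g h) ≫ permHom o (Rewiring.assoc _ _ _).symm =
      permHom o (Rewiring.assoc _ _ _).symm ≫ tens (tens f g) h := by
  rw [permHom_assoc_symm, permHom_assoc_symm]
  exact associator_inv_naturality f g h

theorem tens_braid (f : A.eval o ⟶ B.eval o) (g : A'.eval o ⟶ B'.eval o) :
    tens f g ≫ permHom o (.braid _ _) = permHom o (.braid _ _) ≫ tens g f := by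
  rw [permHom_braid, permHom_braid]
  exact BraidedCategory.braiding_naturality f g

theorem tens_rightUnitor (f : A.eval o ⟶ B.eval o) :
    tens f (𝟙 (ObjTerm.unit.eval o)) ≫ permHom o (.rightUnitor _) =
      permHom o (.rightUnitor _) ≫ f := by
  rw [permHom_rightUnitor, permHom_rightUnitor]
  exact (congrArg (· ≫ _) (tensorHom_id f (𝟙_ C))).trans (rightUnitor_naturality f)

end Values

/-- The exchange of the two middle factors of a tensor product of four. -/
def Rewiring.interchange {O : Type w} (A B D E : ObjTerm O) :
    Rewiring ((A.tensor B).tensor (D.tensor E)) ((A.tensor D).tensor (B.tensor E)) :=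
  ⟨Equiv.sumSumSumComm _ _ _ _, by rintro ((_ | _) | (_ | _)) <;> rfl⟩

section Values

variable {O : Type w} {C : Type u} [Category.{v} C] [MonoidalCategory C] [SymmetricCategory C]
  {o : O → C}
variable {A B D A' B' D' E E' F F' : ObjTerm O}

theorem tens_interchange (f : A.eval o ⟶ A'.eval o) (g : B.eval o ⟶ B'.eval o)
    (h : D.eval o ⟶ D'.eval o) (k : E.eval o ⟶ E'.eval o) :
    tens (tens f g) (tens h k) ≫ permHom o (.interchange _ _ _ _) =
      permHom o (.interchange _ _ _ _) ≫ tens (tens f h) (tens g k) := by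
  -- The interchange is the rewiring of a structural term that spells out `tensorμ`, whose
  -- naturality is thereby available.
  have key : ∀ A B D E : ObjTerm O, permHom o (.interchange A B D E) =
      tensorμ (A.eval o) (B.eval o) (D.eval o) (E.eval o) := by
    intro A B D E
    have h : Rewiring.interchange A B D E = (StructTerm.comp (.assoc A B (D.tensor E))
        (.comp (.tensor (.id A) (.inv (.assoc B D E)))
          (.comp (.tensor (.id A) (.tensor (.braid B D) (.id E)))
            (.comp (.tensor (.id A) (.assoc D B E)) (.inv (.assoc A D (B.tensor E))))))).perm :=
      Rewiring.ext_fun (by rintro ((_ | _) | (_ | _)) <;> rfl)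
    rw [h, permHom_perm]
    simp only [tensorμ, ← id_tensorHom, ← tensorHom_id]
    rfl
  rw [key, key]
  exact tensorμ_natural f g h k

end Values

/-! ### Partial traces between values of object terms -/

section Trace

variable {O : Type w} {C : Type u} [Category.{v} C] [MonoidalCategory C] [SymmetricCategory C]
  [PartiallyTracedCategory C] {o : O → C}
variable {A B D A' B' D' U V U' V' X Y : ObjTerm O}

/-- The partial trace of a morphism between values of object terms. -/
def ptr (U : ObjTerm O) (f : (A.tensor U).eval o ⟶ (B.tensor U).eval o) :
    Part (A.eval o ⟶ B.eval o) :=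
  PartiallyTracedCategory.tr (U := U.eval o) f

/-- Naturality is directed, so it takes the form of a membership that presupposes a value `k` of the
trace; likewise for `ptr_strength`. -/
theorem ptr_naturality {f : (A.tensor U).eval o ⟶ (B.tensor U).eval o} {k : A.eval o ⟶ B.eval o}
    (hk : k ∈ ptr U f) (g : A'.eval o ⟶ A.eval o) (h : B.eval o ⟶ B'.eval o) :
    g ≫ k ≫ h ∈ ptr U (tens g (𝟙 (U.eval o)) ≫ f ≫ tens h (𝟙 (U.eval o))) := by
  have := PartiallyTracedCategory.naturality (U := U.eval o) f g h _
    (Part.mem_map (fun k => g ≫ k ≫ h) hk)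
  rw [← tensorHom_id, ← tensorHom_id] at this
  exact this

theorem ptr_dinaturality (f : (A.tensor U).eval o ⟶ (B.tensor V).eval o)
    (g : V.eval o ⟶ U.eval o) :
    ptr U (f ≫ tens (𝟙 (B.eval o)) g) = ptr V (tens (𝟙 (A.eval o)) g ≫ f) := by
  have := PartiallyTracedCategory.dinaturality (U := U.eval o) (U' := V.eval o) f g
  rw [← id_tensorHom, ← id_tensorHom] at this
  exact this

theorem ptr_strength {f : (A.tensor U).eval o ⟶ (B.tensor U).eval o} {k : A.eval o ⟶ B.eval o}
    (hk : k ∈ ptr U f) (g : A'.eval o ⟶ B'.eval o) :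
    tens g k ∈ ptr U (permHom o (.assoc _ _ _) ≫ tens g f ≫ permHom o (Rewiring.assoc _ _ _).symm) := by
  rw [permHom_assoc, permHom_assoc_symm]
  exact PartiallyTracedCategory.strength (U := U.eval o) f g _ (Part.mem_map (fun k => g ⊗ₘ k) hk)

theorem ptr_unit (f : (A.tensor .unit).eval o ⟶ (B.tensor .unit).eval o) :
    permHom o (Rewiring.rightUnitor _).symm ≫ f ≫ permHom o (.rightUnitor _) ∈ ptr .unit f := by
  rw [permHom_rightUnitor, permHom_rightUnitor_symm]
  have := PartiallyTracedCategory.vanishing_I (A := A.eval o) (B := B.eval o) f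
  exact Part.eq_some_iff.1 this.symm

/-- Only the inner trace has to be defined. The conclusion is an equality of partial values, which
lets `net_eq_of_yank` remove a wire without assuming that the network has a value. -/
theorem ptr_tensor {f : ((A.tensor U).tensor V).eval o ⟶ ((B.tensor U).tensor V).eval o}
    {k : (A.tensor U).eval o ⟶ (B.tensor U).eval o} (hk : k ∈ ptr V f) :
    ptr U k = ptr (U.tensor V)
      (permHom o (Rewiring.assoc _ _ _).symm ≫ f ≫ permHom o (.assoc _ _ _)) := by
  rw [permHom_assoc, permHom_assoc_symm]
  have := PartiallyTracedCategory.vanishing_II (A := A.eval o) (B := B.eval o) (U := U.eval o)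
    (V := V.eval o) f hk.1
  have h2 : (PartiallyTracedCategory.tr (U := V.eval o) f) = Part.some k := Part.eq_some_iff.2 hk
  refine Eq.trans ?_ this
  exact ((congrArg (fun q => Part.bind q _) h2).trans (Part.bind_some _ _)).symm

theorem ptr_braid (A : ObjTerm O) : 𝟙 (A.eval o) ∈ ptr A (permHom o (.braid A A)) := by
  rw [permHom_braid]
  exact Part.eq_some_iff.1 (PartiallyTracedCategory.yanking (A.eval o))

end Trace

section Trace

variable {O : Type w} {C : Type u} [Category.{v} C] [MonoidalCategory C] [SymmetricCategory C]
  [PartiallyTracedCategory C] {o : O → C}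
variable {A B D A' B' D' U V U' V' X Y : ObjTerm O}

theorem ptr_permHom_conj {f : (A.tensor U).eval o ⟶ (B.tensor U).eval o}
    {k : A.eval o ⟶ B.eval o} (hk : k ∈ ptr U f) (a : Rewiring A' A) (b : Rewiring B B') :
    permHom o a ≫ k ≫ permHom o b ∈
      ptr U (permHom o (a.sum (.refl U)) ≫ f ≫ permHom o (b.sum (.refl U))) := by
  rw [← tens_permHom, ← tens_permHom, permHom_refl]
  exact ptr_naturality hk _ _

/-- The traced object may be rewired. -/
theorem ptr_rewire (h : V.eval o ⟶ V'.eval o) (a : Rewiring U V) (b : Rewiring V' U')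
    (e : Rewiring (A.tensor U') (B.tensor U)) :
    ptr U (tens (𝟙 (A.eval o)) (permHom o a ≫ h ≫ permHom o b) ≫ permHom o e) =
      ptr V (tens (𝟙 (A.eval o)) h ≫
        permHom o (((Rewiring.refl A).sum b).trans (e.trans ((Rewiring.refl B).sum a)))) := by
  have h1 : tens (𝟙 (A.eval o)) (permHom o a ≫ h ≫ permHom o b) =
      tens (𝟙 (A.eval o)) (permHom o a) ≫ tens (𝟙 (A.eval o)) h ≫
        tens (𝟙 (A.eval o)) (permHom o b) := by
    simp only [tens_comp, Category.id_comp]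
  -- Only `a` has to travel round the feedback loop; `b` is absorbed into the wiring where it
  -- stands.
  rw [h1, Category.assoc, ← ptr_dinaturality]
  congr 1
  simp only [Category.assoc, ← permHom_refl, tens_permHom, ← permHom_trans]
  rfl

/-- The axiom of strength has the trace in the right factor, so both ends are conjugated by the
braiding. -/
theorem ptr_strength_right {f : (A.tensor U).eval o ⟶ (B.tensor U).eval o}
    {k : A.eval o ⟶ B.eval o} (hk : k ∈ ptr U f) (g : A'.eval o ⟶ B'.eval o) :
    tens k g ∈ ptr U (permHom o ((Rewiring.braid A A').sum (.refl U) |>.trans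
        ((Rewiring.assoc _ _ _).trans (.braid _ _))) ≫ tens f g ≫
      permHom o ((Rewiring.braid B B').sum (.refl U) |>.trans
        ((Rewiring.assoc _ _ _).trans (.braid _ _))).symm) := by
  have h1 := ptr_permHom_conj (ptr_strength hk g) (.braid A A') (.braid B' B)
  have h2 : permHom o (.braid A A') ≫ tens g k ≫ permHom o (.braid B' B) = tens k g := by
    rw [tens_braid, permHom_trans_assoc]
    have : (Rewiring.braid A A').trans (.braid A' A) = .refl _ :=
      Rewiring.ext_fun (by rintro (_ | _) <;> rfl)
    rw [this, permHom_refl, Category.id_comp]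
  have h3 : tens g f = permHom o (.braid _ _) ≫ tens f g ≫ permHom o (.braid _ _) := by
    rw [tens_braid, permHom_trans_assoc]
    have : (Rewiring.braid A' (A.tensor U)).trans (.braid _ _) = .refl _ :=
      Rewiring.ext_fun (by rintro (_ | _) <;> rfl)
    rw [this, permHom_refl, Category.id_comp]
  rw [h2, h3] at h1
  simp only [Category.assoc, permHom_trans_assoc, ← permHom_trans] at h1
  convert h1 using 4
  exact congrArg _ (Rewiring.ext_fun (by rintro ((_ | _) | _) <;> rfl))

/-- Strength is used twice: `tens k k'` is a trace over `U` of a rewiring of `tens f k'`, and this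
in turn is a trace over `U'` of a rewiring of `tens f f'`. The inner trace is defined, so vanishing
II merges the two. -/
theorem tens_mem_ptr {f : (A.tensor U).eval o ⟶ (B.tensor U).eval o} {k : A.eval o ⟶ B.eval o}
    {f' : (A'.tensor U').eval o ⟶ (B'.tensor U').eval o} {k' : A'.eval o ⟶ B'.eval o}
    (hk : k ∈ ptr U f) (hk' : k' ∈ ptr U' f') :
    tens k k' ∈ ptr (U.tensor U') (permHom o (.interchange _ _ _ _) ≫ tens f f' ≫
      permHom o (.interchange _ _ _ _)) := by
  have h1 := ptr_strength_right hk k'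
  have h2 := ptr_permHom_conj (ptr_strength hk' f)
    ((Rewiring.braid A A').sum (.refl U) |>.trans ((Rewiring.assoc _ _ _).trans (.braid _ _)))
    ((Rewiring.braid B B').sum (.refl U) |>.trans
      ((Rewiring.assoc _ _ _).trans (.braid _ _))).symm
  rw [ptr_tensor h2] at h1
  simp only [Category.assoc, permHom_trans_assoc, ← permHom_trans] at h1
  convert h1 using 3
  · exact congrArg _ (Rewiring.ext_fun (by rintro ((_ | _) | (_ | _)) <;> rfl))
  · exact congrArg _ (congrArg _ (Rewiring.ext_fun (by rintro ((_ | _) | (_ | _)) <;> rfl)))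

/-- Naturality applied to the yanking axiom at `B`. This reduces composition to juxtaposition and
feedback, and the trace involved is always defined. -/
theorem comp_mem_ptr (f : A.eval o ⟶ B.eval o) (g : B.eval o ⟶ D.eval o) :
    f ≫ g ∈ ptr B (tens f g ≫ permHom o (.braid B D)) := by
  have h := ptr_naturality (ptr_braid (o := o) B) f g
  rw [Category.id_comp] at h
  convert h using 1
  rw [← tens_braid, tens_comp_assoc, Category.comp_id, Category.id_comp]

end Trace

/-! ### Boxes -/

section Box

variable {S : TraceSignature.{w}} {C : Type u} [Category.{v} C] [MonoidalCategory C]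
  (x : TraceValuation C S)

/-- The tensor product of a family of boxes. -/
def boxHom : (K : ObjTerm S.Mor) → ((K.subst S.dom).eval x.obj ⟶ (K.subst S.cod).eval x.obj)
  | .var m => x.mor m
  | .unit => 𝟙 (𝟙_ C)
  | .tensor K K' => tens (boxHom K) (boxHom K')

variable [SymmetricCategory C]

/-- Boxes may be permuted as whole blocks, before or after they act, because the structural
isomorphisms are natural. -/
theorem boxHom_eval {K K' : ObjTerm S.Mor} (t : StructTerm K K') :
    ((t.subst S.dom).eval x.obj).hom ≫ boxHom x K' =
      boxHom x K ≫ ((t.subst S.cod).eval x.obj).hom := by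
  induction t with
  | id A => exact (Category.id_comp _).trans (Category.comp_id _).symm
  | comp s t hs ht =>
    change (_ ≫ _) ≫ _ = _ ≫ _ ≫ _
    rw [Category.assoc, ht, reassoc_of% hs]
  | inv s hs =>
    change Iso.inv _ ≫ _ = _ ≫ Iso.inv _
    rw [Iso.inv_comp_eq, ← Category.assoc, hs, Category.assoc, Iso.hom_inv_id, Category.comp_id]
  | tensor s t hs ht =>
    change tens _ _ ≫ tens _ _ = tens _ _ ≫ tens _ _
    rw [tens_comp, tens_comp, hs, ht]
  | assoc A B D => exact (associator_naturality _ _ _).symm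
  | leftUnitor A =>
    exact (leftUnitor_naturality _).symm.trans (congrArg (· ≫ _) (id_tensorHom _ _).symm)
  | braid A B => exact (BraidedCategory.braiding_naturality _ _).symm

theorem boxHom_naturality {K K' : ObjTerm S.Mor} (e : Rewiring K K') :
    permHom x.obj (e.subst S.dom) ≫ boxHom x K' = boxHom x K ≫ permHom x.obj (e.subst S.cod) := by
  rw [Rewiring.subst, Rewiring.subst, permHom_perm, permHom_perm, boxHom_eval]

end Box

/-! ### Networks -/

namespace Rewiring

variable {O : Type w}

theorem interchange_trans_interchange (A B D E : ObjTerm O) :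
    (interchange A B D E).trans (interchange A D B E) = refl _ :=
  ext_fun (by rintro ((_ | _) | (_ | _)) <;> rfl)

/-- Gathers the two parts of a juxtaposition of networks. -/
def gather (A A' P P' L L' : ObjTerm O) :
    Rewiring ((A.tensor A').tensor ((P.tensor P').tensor (L.tensor L')))
      ((A.tensor (P.tensor L)).tensor (A'.tensor (P'.tensor L'))) :=
  ((refl _).sum (interchange _ _ _ _)).trans (interchange _ _ _ _)

/-- Moves the second factor of three to the front. -/
def exchange (A B D : ObjTerm O) : Rewiring (A.tensor (B.tensor D)) (B.tensor (A.tensor D)) :=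
  (assoc _ _ _).symm.trans (((braid A B).sum (refl D)).trans (assoc _ _ _))

theorem exchange_trans_exchange (A B D : ObjTerm O) :
    (exchange A B D).trans (exchange B A D) = refl _ :=
  ext_fun (by rintro (_ | _ | _) <;> rfl)

/-- Takes the wires `U` out of a network. -/
def regroup (A U P L : ObjTerm O) :
    Rewiring (A.tensor (P.tensor (U.tensor L))) ((A.tensor U).tensor (P.tensor L)) :=
  ((refl A).sum (exchange _ _ _)).trans (assoc _ _ _).symm

theorem regroup_symm (A U P L : ObjTerm O) :
    (regroup A U P L).symm = (assoc _ _ _).trans ((refl A).sum (exchange _ _ _)) :=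
  ext_fun (by rintro ((_ | _) | (_ | _)) <;> rfl)

/-- Singles out the last wire that passes through a network. -/
def split (A P L X : ObjTerm O) :
    Rewiring ((A.tensor (P.tensor L)).tensor X) (A.tensor (P.tensor (L.tensor X))) :=
  (assoc _ _ _).trans ((refl A).sum (assoc _ _ _))

end Rewiring

section Values

variable {O : Type w} {C : Type u} [Category.{v} C] [MonoidalCategory C] [SymmetricCategory C]
  {o : O → C} {A B D A' B' D' : ObjTerm O}

theorem tens_exchange (f : A.eval o ⟶ A'.eval o) (g : B.eval o ⟶ B'.eval o)
    (h : D.eval o ⟶ D'.eval o) :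
    tens f (tens g h) ≫ permHom o (.exchange _ _ _) =
      permHom o (.exchange _ _ _) ≫ tens g (tens f h) := by
  rw [Rewiring.exchange, Rewiring.exchange]
  simp only [permHom_trans, ← tens_permHom, permHom_refl, Category.assoc]
  rw [← tens_assoc, tens_comp_assoc, ← tens_braid, ← Category.assoc, tens_assoc_symm,
    Category.assoc, tens_comp_assoc, Category.id_comp, Category.comp_id]

end Values

section Net

variable {S : TraceSignature.{w}} {C : Type u} [Category.{v} C] [MonoidalCategory C]
  [SymmetricCategory C] [PartiallyTracedCategory C] (x : TraceValuation C S)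
variable {A B A' B' U : ObjTerm S.Obj}

/-- The type of the wirings of a network from `A` to `B` with boxes `M` and additional
wires `L`. -/
abbrev NetWiring (A B : ObjTerm S.Obj) (M : ObjTerm S.Mor) (L : ObjTerm S.Obj) :=
  Rewiring (A.tensor ((M.subst S.cod).tensor L)) (B.tensor ((M.subst S.dom).tensor L))

/-- The partially defined value of a network: boxes `M` and additional wires `L`, all of which
are fed back along the wiring `e`. -/
noncomputable def net {M : ObjTerm S.Mor} {L : ObjTerm S.Obj} (e : NetWiring A B M L) :
    Part (A.eval x.obj ⟶ B.eval x.obj) :=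
  ptr ((M.subst S.dom).tensor L)
    (tens (𝟙 (A.eval x.obj)) (tens (boxHom x M) (𝟙 (L.eval x.obj))) ≫ permHom x.obj e)

/-- `comp_mem_ptr` for `𝟙 ≫ x.mor m` puts the box into the feedback: the input of the diagram is fed
back into it, and its output leaves. The unit stands for the absence of additional wires. -/
theorem mor_mem_net (m : S.Mor) : x.mor m ∈ net x (M := .var m) (L := .unit)
    (((Rewiring.refl (S.dom m)).sum (.rightUnitor _)).trans
      ((Rewiring.braid (S.dom m) (S.cod m)).trans
        ((Rewiring.refl (S.cod m)).sum (Rewiring.rightUnitor (S.dom m)).symm))) := by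
  have h := comp_mem_ptr (o := x.obj) (𝟙 _) (x.mor m)
  rw [Category.id_comp] at h
  have h2 : x.mor m = permHom x.obj (Rewiring.rightUnitor _).symm ≫
      tens (x.mor m) (𝟙 (ObjTerm.unit.eval x.obj)) ≫ permHom x.obj (Rewiring.rightUnitor _) := by
    rw [tens_rightUnitor, ← Category.assoc, permHom_symm_comp, Category.id_comp]
  rw [congrArg (fun f => tens _ f ≫ _) h2, ptr_rewire] at h
  exact h

/-- With no boxes and no additional wires, the trace is over `unit ⊗ unit`; it is defined by
vanishing I after rewiring this to `unit`. -/
theorem permHom_mem_net (e : Rewiring A B) : permHom x.obj e ∈ net x (M := .unit) (L := .unit)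
    (e.sum (.refl (ObjTerm.unit.tensor ObjTerm.unit))) := by
  have h := ptr_unit (permHom x.obj (e.sum (.refl .unit)))
  have h2 : 𝟙 (ObjTerm.unit.eval x.obj) = permHom x.obj (Rewiring.rightUnitor .unit).symm ≫
      tens (𝟙 (ObjTerm.unit.eval x.obj)) (𝟙 (ObjTerm.unit.eval x.obj)) ≫
        permHom x.obj (.rightUnitor .unit) := by
    rw [tens_rightUnitor, Category.comp_id, permHom_symm_comp]
  have h3 : permHom x.obj (e.sum (.refl .unit)) =
      tens (𝟙 (A.eval x.obj)) (𝟙 (ObjTerm.unit.eval x.obj)) ≫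
        permHom x.obj (e.sum (.refl .unit)) := by
    rw [tens_id, Category.id_comp]
  rw [congrArg (ptr _) (h3.trans (congrArg (fun f => tens _ f ≫ _) h2)), ptr_rewire,
    ← permHom_trans, ← permHom_trans] at h
  convert h using 1
  · refine congrArg (fun e => ptr _ (_ ≫ permHom x.obj e)) (Rewiring.ext_fun ?_)
    rintro (p | (p | p))
    · rfl
    · exact p.elim
    · exact p.elim
  · exact congrArg _ (Rewiring.ext_fun fun p => rfl)

theorem permHom_conj_mem_net {M : ObjTerm S.Mor} {L : ObjTerm S.Obj} {e : NetWiring A B M L}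
    {f : A.eval x.obj ⟶ B.eval x.obj} (hf : f ∈ net x e) (a : Rewiring A' A) (b : Rewiring B B') :
    permHom x.obj a ≫ f ≫ permHom x.obj b ∈
      net x (M := M) (L := L) ((a.sum (.refl _)).trans (e.trans (b.sum (.refl _)))) := by
  have h := ptr_permHom_conj hf a b
  have h2 : permHom x.obj (a.sum (.refl _)) ≫
      tens (𝟙 (A.eval x.obj)) (tens (boxHom x M) (𝟙 (L.eval x.obj))) =
      tens (𝟙 (A'.eval x.obj)) (tens (boxHom x M) (𝟙 (L.eval x.obj))) ≫
        permHom x.obj (a.sum (.refl _)) := by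
    simp only [← tens_permHom, permHom_refl, tens_comp, Category.id_comp, Category.comp_id]
  rw [Category.assoc, reassoc_of% h2] at h
  rw [net, permHom_trans, permHom_trans]
  exact h

/-- `tens_mem_ptr` lists the feedback as boxes, wires, boxes, wires; dinaturality, in the form of
`ptr_rewire`, collects the boxes in front of the wires. -/
theorem tens_mem_net {M M' : ObjTerm S.Mor} {L L' : ObjTerm S.Obj} {e : NetWiring A B M L}
    {e' : NetWiring A' B' M' L'} {f : A.eval x.obj ⟶ B.eval x.obj}
    {f' : A'.eval x.obj ⟶ B'.eval x.obj} (hf : f ∈ net x e) (hf' : f' ∈ net x e') :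
    tens f f' ∈ net x (M := M.tensor M') (L := L.tensor L')
      ((Rewiring.gather _ _ _ _ _ _).trans ((e.sum e').trans
        (Rewiring.gather _ _ _ _ _ _).symm)) := by
  have h := tens_mem_ptr hf hf'
  have h2 : tens (tens (boxHom x M) (𝟙 (L.eval x.obj))) (tens (boxHom x M') (𝟙 (L'.eval x.obj))) =
      permHom x.obj (.interchange _ _ _ _) ≫ tens (tens (boxHom x M) (boxHom x M'))
        (𝟙 ((L.tensor L').eval x.obj)) ≫ permHom x.obj (.interchange _ _ _ _) := by
    rw [← tens_id]
    rw [tens_interchange, permHom_trans_assoc, Rewiring.interchange_trans_interchange,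
      permHom_refl, Category.id_comp]
  rw [← tens_comp, Category.assoc, ← Category.assoc (permHom _ _), ← tens_interchange, tens_id, h2,
    tens_permHom, Category.assoc, permHom_trans_assoc, ← permHom_trans, ptr_rewire] at h
  exact h

/-- The membership `hk` says that the inner trace is defined, so vanishing II merges it with the
trace over `U`, whose wires join the additional ones. -/
theorem ptr_mem_net {M : ObjTerm S.Mor} {L : ObjTerm S.Obj}
    {e : NetWiring (A.tensor U) (B.tensor U) M L}
    {k : (A.tensor U).eval x.obj ⟶ (B.tensor U).eval x.obj} {f : A.eval x.obj ⟶ B.eval x.obj}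
    (hk : k ∈ net x e) (hf : f ∈ ptr U k) :
    f ∈ net x (M := M) (L := U.tensor L)
      ((Rewiring.regroup _ _ _ _).trans (e.trans (Rewiring.regroup _ _ _ _).symm)) := by
  rw [ptr_tensor hk, ← tens_id, Category.assoc, ← Category.assoc (permHom _ _)] at hf
  have h1 : tens (𝟙 (U.eval x.obj)) (tens (boxHom x M) (𝟙 (L.eval x.obj))) =
      permHom x.obj (.exchange _ _ _) ≫ tens (boxHom x M) (𝟙 ((U.tensor L).eval x.obj)) ≫
        permHom x.obj (.exchange _ _ _) := by
    rw [← tens_id, tens_exchange, permHom_trans_assoc, Rewiring.exchange_trans_exchange,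
      permHom_refl, Category.id_comp]
  rw [← tens_assoc_symm, h1, Category.assoc, permHom_trans_assoc, ← permHom_trans,
    ptr_rewire] at hf
  rw [Rewiring.regroup_symm]
  exact hf

/-- Renumbering boxes and additional wires conjugates the traced object, so this is dinaturality
together with naturality of the boxes. Both are full equalities, so no network has to be defined. -/
theorem net_congr {M M' : ObjTerm S.Mor} {L L' : ObjTerm S.Obj} (e : NetWiring A B M L)
    (e' : NetWiring A B M' L') (φ : Rewiring M M') (ψ : Rewiring L L')
    (h : ∀ p, e' ((Rewiring.refl A).sum ((φ.subst S.cod).sum ψ) p) =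
      (Rewiring.refl B).sum ((φ.subst S.dom).sum ψ) (e p)) :
    net x e = net x e' := by
  have h1 : tens (boxHom x M) (𝟙 (L.eval x.obj)) =
      permHom x.obj ((φ.subst S.dom).sum ψ) ≫ tens (boxHom x M') (𝟙 (L'.eval x.obj)) ≫
        permHom x.obj ((φ.subst S.cod).sum ψ).symm := by
    rw [← Category.assoc, ← tens_permHom, tens_comp, boxHom_naturality, Category.comp_id,
      ← Category.id_comp (permHom _ ψ), ← tens_comp, tens_permHom, Category.assoc,
      permHom_comp_symm, Category.comp_id]
  rw [net, h1, ptr_rewire, net]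
  refine congrArg (fun e => ptr _ (_ ≫ permHom x.obj e)) (Rewiring.ext_fun fun p => ?_)
  obtain ⟨q, rfl⟩ := ((Rewiring.refl A).sum ((φ.subst S.cod).sum ψ)).toEquiv.surjective p
  refine Eq.trans ?_ (h q).symm
  refine congrArg _ (congrArg e ?_)
  rcases q with q | q
  · rfl
  · exact congrArg Sum.inr (Rewiring.symm_apply_apply _ q)

/-- Yanking: a wire that is fed back, but not to itself, can be pulled straight. -/
theorem ptr_var_permHom {o : S.Obj → C} {X : S.Obj} (e : Rewiring (A.tensor (.var X)) (B.tensor (.var X)))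
    (f : Rewiring A B) (p : A.Pos) (hp : e (Sum.inl p) = Sum.inr ())
    (hfp : e (Sum.inr ()) = Sum.inl (f p))
    (hf : ∀ q, q ≠ p → e (Sum.inl q) = Sum.inl (f q)) :
    permHom o f ∈ ptr (.var X) (permHom o e) := by
  have hX : A.label p = X := (e.label_eq (Sum.inl p)).symm.trans (by rw [hp]; rfl)
  -- `a` moves `p`, the wire that is fed into the loop, to the last place, next to the traced wire.
  obtain ⟨a, ha⟩ : ∃ a : Rewiring A ((A.erase p).tensor (.var X)),
      a p = Sum.inr () ∧ ∀ x, a (A.incl p x) = Sum.inl x := by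
    refine ⟨(StructTerm.extract A p X hX).perm.trans (.braid _ _), ?_, fun x => ?_⟩
    · rw [Rewiring.trans_apply, StructTerm.perm_extract_self]; rfl
    · rw [Rewiring.trans_apply, StructTerm.perm_extract_incl]; rfl
  -- Strength and yanking evaluate the trace of an identity beside a crossing of two wires `X`;
  -- naturality then conjugates it by `a` and by `a⁻¹` followed by `f`.
  have h1 := ptr_permHom_conj (ptr_strength (ptr_braid (o := o) (.var X))
    (𝟙 ((A.erase p).eval o))) a (a.symm.trans f)
  rw [tens_id, Category.id_comp, ← permHom_refl, tens_permHom, ← permHom_trans] at h1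
  simp only [← permHom_trans] at h1
  convert h1 using 1
  · refine congrArg (fun e => ptr _ (permHom o e)) (Rewiring.ext_fun ?_)
    have key : ∀ q, f (a.symm (a q)) = f q := fun q => by rw [Rewiring.symm_apply_apply]
    rintro (q | ⟨⟨⟩⟩)
    · by_cases hq : q = p
      · subst hq
        refine hp.trans (Eq.symm ?_)
        change (Rewiring.sum (a.symm.trans f) (.refl _)) ((Rewiring.assoc _ _ _).symm
          ((Rewiring.refl _).sum (.braid _ _) (Rewiring.assoc _ _ _ (Sum.inl (a q))))) = _
        rw [ha.1]
        rfl
      · obtain ⟨y, rfl⟩ := A.exists_incl p q hq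
        refine (hf _ hq).trans (Eq.symm ?_)
        change (Rewiring.sum (a.symm.trans f) (.refl _)) ((Rewiring.assoc _ _ _).symm
          ((Rewiring.refl _).sum (.braid _ _) (Rewiring.assoc _ _ _ (Sum.inl (a _))))) = _
        rw [ha.2, ← key, ha.2]
        rfl
    · refine hfp.trans (Eq.symm ?_)
      rw [← key, ha.1]
      rfl
  · exact congrArg _ (Rewiring.ext_fun fun q => by simp)

/-- Tracing out the single wire `X` first is always possible by `ptr_var_permHom`, so vanishing II
splits it off as an equality of partial values. -/
theorem net_eq_of_yank {M : ObjTerm S.Mor} {L : ObjTerm S.Obj} {X : S.Obj}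
    (e : Rewiring ((A.tensor ((M.subst S.cod).tensor L)).tensor (.var X))
      ((B.tensor ((M.subst S.dom).tensor L)).tensor (.var X))) (f : NetWiring A B M L)
    (p : (A.tensor ((M.subst S.cod).tensor L)).Pos) (hp : e (Sum.inl p) = Sum.inr ())
    (hfp : e (Sum.inr ()) = Sum.inl (f p))
    (hf : ∀ q, q ≠ p → e (Sum.inl q) = Sum.inl (f q)) :
    net x (M := M) (L := L.tensor (.var X))
      ((Rewiring.split _ _ _ _).symm.trans (e.trans (Rewiring.split _ _ _ _))) = net x f := by
  have h1 := ptr_naturality (ptr_var_permHom (o := x.obj) e f p hp hfp hf)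
    (tens (𝟙 (A.eval x.obj)) (tens (boxHom x M) (𝟙 (L.eval x.obj)))) (𝟙 _)
  rw [Category.comp_id] at h1
  rw [net, net, ptr_tensor h1, tens_id, Category.comp_id]
  have h2 : tens (boxHom x M) (tens (𝟙 (L.eval x.obj)) (𝟙 ((ObjTerm.var X).eval x.obj))) =
    permHom x.obj (Rewiring.assoc _ _ (.var X)).symm ≫
      tens (tens (boxHom x M) (𝟙 (L.eval x.obj))) (𝟙 ((ObjTerm.var X).eval x.obj)) ≫
        permHom x.obj (Rewiring.assoc _ _ (.var X)) := by
    rw [tens_assoc, ← Category.assoc, permHom_symm_comp, Category.id_comp]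
  rw [← tens_id, h2, ptr_rewire]
  congr 1
  rw [Category.assoc, ← Category.assoc (permHom _ _), ← tens_assoc_symm, Category.assoc,
    ← permHom_trans, ← permHom_trans]
  have hl : ((Rewiring.refl A).sum (.assoc (M.subst S.cod) L (.var X))).trans
      (Rewiring.split _ _ _ _).symm = (Rewiring.assoc _ _ _).symm :=
    Rewiring.ext_fun (by rintro (_ | ((_ | _) | _)) <;> rfl)
  have hr : (Rewiring.split _ _ _ _).trans
      ((Rewiring.refl B).sum (Rewiring.assoc (M.subst S.dom) L (.var X)).symm) =
        Rewiring.assoc _ _ _ :=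
    Rewiring.ext_fun (by rintro ((_ | (_ | _)) | _) <;> rfl)
  exact congrArg₂ (fun a b => _ ≫ permHom x.obj (a.trans (e.trans b))) hl hr

end Net

/-! ### Diagrams and networks -/

namespace TraceDiagram

variable {S : TraceSignature.{w}} {A B A' B' C U : ObjTerm S.Obj}

/-- A diagram is isomorphic to itself. -/
def Iso.refl (D : TraceDiagram S A B) : D.Iso D where
  wire := Equiv.refl _
  box _ := Equiv.refl _
  label_wire _ := rfl
  wire_inp _ := rfl
  wire_out _ := rfl
  wire_boxIn _ _ := rfl
  wire_boxOut _ _ := rfl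

/-- The inverse of an isomorphism of diagrams. -/
def Iso.symm {D E : TraceDiagram S A B} (i : D.Iso E) : E.Iso D where
  wire := i.wire.symm
  box m := (i.box m).symm
  label_wire a := by rw [← i.label_wire, Equiv.apply_symm_apply]
  wire_inp p := by rw [← i.wire_inp, Equiv.symm_apply_apply]
  wire_out p := by rw [← i.wire_out, Equiv.symm_apply_apply]
  wire_boxIn b p := by rw [Equiv.symm_apply_eq, i.wire_boxIn, Equiv.apply_symm_apply]
  wire_boxOut b p := by rw [Equiv.symm_apply_eq, i.wire_boxOut, Equiv.apply_symm_apply]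

/-- The composite of two isomorphisms of diagrams. -/
def Iso.trans {D E F : TraceDiagram S A B} (i : D.Iso E) (j : E.Iso F) : D.Iso F where
  wire := i.wire.trans j.wire
  box m := (i.box m).trans (j.box m)
  label_wire a := (j.label_wire _).trans (i.label_wire a)
  wire_inp p := (congrArg j.wire (i.wire_inp p)).trans (j.wire_inp p)
  wire_out p := (congrArg j.wire (i.wire_out p)).trans (j.wire_out p)
  wire_boxIn b p := (congrArg j.wire (i.wire_boxIn b p)).trans (j.wire_boxIn _ p)
  wire_boxOut b p := (congrArg j.wire (i.wire_boxOut b p)).trans (j.wire_boxOut _ p)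

/-- Permutes the outputs of a diagram. -/
def post (D : TraceDiagram S A B) (e : B'.Pos ≃ B.Pos) (he : ∀ p, B.label (e p) = B'.label p) :
    TraceDiagram S A B' where
  __ := D
  out p := D.out (e p)
  label_out p := (D.label_out _).trans (he p)

/-- The composite of two diagrams as a trace of their juxtaposition. -/
def compIsoTrace (D : TraceDiagram S A B) (E : TraceDiagram S B C) :
    (trace (B := C) (U := B) ((D.tensor E).post (B' := C.tensor B) (Equiv.sumComm C.Pos B.Pos)
      (by rintro (_ | _) <;> rfl))).Iso (D.comp E) where
  wire :=
    { toFun := Quot.map _root_.id (by rintro _ _ ⟨p⟩; exact ⟨p⟩)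
      invFun := Quot.map _root_.id (by rintro _ _ ⟨p⟩; exact ⟨p⟩)
      left_inv := by rintro ⟨_⟩; rfl
      right_inv := by rintro ⟨_⟩; rfl }
  box _ := Equiv.refl _
  label_wire := by rintro ⟨_⟩; rfl
  wire_inp _ := rfl
  wire_out _ := rfl
  wire_boxIn := by rintro _ (_ | _) _ <;> rfl
  wire_boxOut := by rintro _ (_ | _) _ <;> rfl

/-- A diagram is drawn by a network: its boxes are those of the network, and its wires are the
equivalence classes of the sources of the network, when every additional wire is joined to the
source from which it is fed. -/
structure DrawnBy (D : TraceDiagram S A B) {M : ObjTerm S.Mor} {L : ObjTerm S.Obj}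
    (e : NetWiring A B M L) where
  box : ∀ b : M.Pos, D.Box (M.label b)
  box_bijective : Function.Bijective fun b => (⟨M.label b, box b⟩ : Σ m, D.Box m)
  -- Sources are the inputs of the diagram, the outputs of boxes and the starts of additional wires;
  -- targets are the outputs of the diagram, the inputs of boxes and the ends of additional wires.
  src : (A.tensor ((M.subst S.cod).tensor L)).Pos → D.Wire
  tgt : (B.tensor ((M.subst S.dom).tensor L)).Pos → D.Wire
  tgt_apply : ∀ p, tgt (e p) = src p
  label_src : ∀ p, D.label (src p) = (A.tensor ((M.subst S.cod).tensor L)).label p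
  src_inp : ∀ p, src (Sum.inl p) = D.inp p
  tgt_out : ∀ p, tgt (Sum.inl p) = D.out p
  src_box : ∀ b p, src (Sum.inr (Sum.inl (M.port S.cod b p))) = D.boxOut (box b) p
  tgt_box : ∀ b p, tgt (Sum.inr (Sum.inl (M.port S.dom b p))) = D.boxIn (box b) p
  tgt_loop : ∀ l, tgt (Sum.inr (Sum.inr l)) = src (Sum.inr (Sum.inr l))
  surjective : Function.Surjective src
  -- Nothing is identified beyond what the joins force: sources on the same wire are not separated
  -- by any function that is constant along the joins.
  exact : ∀ {T : Type} (k : (A.tensor ((M.subst S.cod).tensor L)).Pos → T)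
    (k' : (B.tensor ((M.subst S.dom).tensor L)).Pos → T), (∀ p, k' (e p) = k p) →
    (∀ l, k' (Sum.inr (Sum.inr l)) = k (Sum.inr (Sum.inr l))) →
    ∀ p q, src p = src q → k p = k q

namespace DrawnBy

/-- A network that draws a diagram draws every isomorphic diagram. -/
def ofIso {D E : TraceDiagram S A B} (i : D.Iso E) {M : ObjTerm S.Mor} {L : ObjTerm S.Obj}
    {e : NetWiring A B M L} (d : D.DrawnBy e) : E.DrawnBy e where
  box b := i.box _ (d.box b)
  box_bijective := (Equiv.sigmaCongrRight i.box).bijective.comp d.box_bijective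
  src p := i.wire (d.src p)
  tgt p := i.wire (d.tgt p)
  tgt_apply p := congrArg i.wire (d.tgt_apply p)
  label_src p := (i.label_wire _).trans (d.label_src p)
  src_inp p := (congrArg i.wire (d.src_inp p)).trans (i.wire_inp p)
  tgt_out p := (congrArg i.wire (d.tgt_out p)).trans (i.wire_out p)
  src_box b p := (congrArg i.wire (d.src_box b p)).trans (i.wire_boxOut _ p)
  tgt_box b p := (congrArg i.wire (d.tgt_box b p)).trans (i.wire_boxIn _ p)
  tgt_loop l := congrArg i.wire (d.tgt_loop l)
  surjective := i.wire.surjective.comp d.surjective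
  exact k k' h h' p q hpq := d.exact k k' h h' p q (i.wire.injective hpq)

/-- The network that draws a single box. -/
def single (m : S.Mor) : (single m).DrawnBy (M := .var m) (L := .unit)
    (((Rewiring.refl (S.dom m)).sum (.rightUnitor _)).trans
      ((Rewiring.braid (S.dom m) (S.cod m)).trans
        ((Rewiring.refl (S.cod m)).sum (Rewiring.rightUnitor (S.dom m)).symm))) where
  box _ := ⟨rfl⟩
  box_bijective := ⟨fun _ _ _ => rfl, by rintro ⟨_, ⟨rfl⟩⟩; exact ⟨(), rfl⟩⟩
  src := Sum.elim Sum.inl (Sum.elim Sum.inr Empty.elim)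
  tgt := Sum.elim Sum.inr (Sum.elim Sum.inl Empty.elim)
  tgt_apply := by
    rintro (p | p | p)
    · rfl
    · rfl
    · exact p.elim
  label_src := by
    rintro (p | p | p)
    · rfl
    · rfl
    · exact p.elim
  src_inp _ := rfl
  tgt_out _ := rfl
  src_box _ _ := rfl
  tgt_box _ _ := rfl
  tgt_loop l := Empty.elim l
  surjective := by
    rintro (p | p)
    · exact ⟨Sum.inl p, rfl⟩
    · exact ⟨Sum.inr (Sum.inl p), rfl⟩
  exact k k' h h' := by
    rintro (p | p | p) (q | q | q) hpq
    all_goals first | exact p.elim | exact q.elim | cases hpq <;> rfl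

/-- The network that draws a wiring. -/
def wiring (e : B.Pos ≃ A.Pos) (he : ∀ p, A.label (e p) = B.label p) :
    (wiring (S := S) e he).DrawnBy (M := .unit) (L := .unit)
      ((Rewiring.symm ⟨e, he⟩).sum (.refl (ObjTerm.unit.tensor ObjTerm.unit))) where
  box b := Empty.elim b
  box_bijective := ⟨fun b => Empty.elim b, fun b => Empty.elim b.2⟩
  src := Sum.elim _root_.id (Sum.elim Empty.elim Empty.elim)
  tgt := Sum.elim e (Sum.elim Empty.elim Empty.elim)
  tgt_apply := by
    rintro (p | p | p)
    · exact e.apply_symm_apply p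
    · exact p.elim
    · exact p.elim
  label_src := by
    rintro (p | p | p)
    · rfl
    · exact p.elim
    · exact p.elim
  src_inp _ := rfl
  tgt_out _ := rfl
  src_box b := Empty.elim b
  tgt_box b := Empty.elim b
  tgt_loop l := Empty.elim l
  surjective p := ⟨Sum.inl p, rfl⟩
  exact k k' h h' := by
    rintro (p | p | p) (q | q | q) hpq
    all_goals first | exact p.elim | exact q.elim | cases hpq; rfl

/-- Permuting the outputs of a network permutes those of the diagram. -/
def post {D : TraceDiagram S A B} {M : ObjTerm S.Mor} {L : ObjTerm S.Obj}
    {e : NetWiring A B M L} (d : D.DrawnBy e) (f : Rewiring B B') :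
    (D.post f.toEquiv.symm f.symm.label_eq).DrawnBy (M := M) (L := L)
      -- The identity in front makes this the very wiring that `permHom_conj_mem_net` produces when
      -- the inputs are left alone.
      (((Rewiring.refl A).sum (.refl _)).trans (e.trans (f.sum (.refl _)))) where
  box := d.box
  box_bijective := d.box_bijective
  src := d.src
  tgt p := d.tgt ((f.symm.sum (.refl _)) p)
  tgt_apply p := by
    refine Eq.trans (congrArg d.tgt ?_) (d.tgt_apply p)
    change f.symm.sum (.refl _) (f.sum (.refl _) (e ((Rewiring.refl A).sum (.refl _) p))) = e p
    have h : (Rewiring.refl A).sum (.refl _) p = p := by rcases p with _ | _ <;> rfl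
    rw [h]
    generalize e p = q
    rcases q with q | q
    · exact congrArg Sum.inl (f.symm_apply_apply q)
    · rfl
  label_src := d.label_src
  src_inp := d.src_inp
  tgt_out p := d.tgt_out _
  src_box := d.src_box
  tgt_box := d.tgt_box
  tgt_loop := d.tgt_loop
  surjective := d.surjective
  exact k k' h h' := by
    refine d.exact k (fun p => k' (f.sum (.refl _) p)) (fun p => ?_) h'
    refine Eq.trans ?_ (h p)
    rcases p with _ | _ <;> rfl

/-- The juxtaposition of networks draws the juxtaposition of diagrams. -/
def tensor {D : TraceDiagram S A B} {E : TraceDiagram S A' B'} {M M' : ObjTerm S.Mor}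
    {L L' : ObjTerm S.Obj} {e : NetWiring A B M L} {e' : NetWiring A' B' M' L'}
    (d : D.DrawnBy e) (d' : E.DrawnBy e') :
    (D.tensor E).DrawnBy (M := M.tensor M') (L := L.tensor L')
      ((Rewiring.gather _ _ _ _ _ _).trans ((e.sum e').trans
        (Rewiring.gather _ _ _ _ _ _).symm)) where
  box := Sum.rec (fun b => Sum.inl (d.box b)) (fun b => Sum.inr (d'.box b))
  box_bijective := by
    constructor
    · rintro (b | b) (b' | b') h <;> have h1 := congrArg (Equiv.sigmaSumDistrib D.Box E.Box) h
      · exact congrArg Sum.inl (d.box_bijective.1 (Sum.inl.inj h1))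
      · cases h1
      · cases h1
      · exact congrArg Sum.inr (d'.box_bijective.1 (Sum.inr.inj h1))
    · rintro ⟨m, b | b⟩
      · obtain ⟨a, ha⟩ := d.box_bijective.2 ⟨m, b⟩
        cases ha
        exact ⟨Sum.inl a, rfl⟩
      · obtain ⟨a, ha⟩ := d'.box_bijective.2 ⟨m, b⟩
        cases ha
        exact ⟨Sum.inr a, rfl⟩
  src p := Sum.map d.src d'.src (Rewiring.gather _ _ _ _ _ _ p)
  tgt p := Sum.map d.tgt d'.tgt (Rewiring.gather _ _ _ _ _ _ p)
  tgt_apply p := by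
    change Sum.map d.tgt d'.tgt (Rewiring.gather _ _ _ _ _ _ ((Rewiring.gather _ _ _ _ _ _).symm
      (e.sum e' (Rewiring.gather _ _ _ _ _ _ p)))) = _
    rw [Rewiring.apply_symm_apply]
    generalize Rewiring.gather _ _ _ _ _ _ p = q
    rcases q with q | q
    · exact congrArg Sum.inl (d.tgt_apply q)
    · exact congrArg Sum.inr (d'.tgt_apply q)
  label_src p := by
    refine Eq.trans ?_ ((Rewiring.gather _ _ _ _ _ _).label_eq p)
    generalize Rewiring.gather _ _ _ _ _ _ p = q
    rcases q with q | q
    · exact d.label_src q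
    · exact d'.label_src q
  src_inp := by
    rintro (p | p)
    · exact congrArg Sum.inl (d.src_inp p)
    · exact congrArg Sum.inr (d'.src_inp p)
  tgt_out := by
    rintro (p | p)
    · exact congrArg Sum.inl (d.tgt_out p)
    · exact congrArg Sum.inr (d'.tgt_out p)
  src_box := by
    rintro (b | b) p
    · exact congrArg Sum.inl (d.src_box b p)
    · exact congrArg Sum.inr (d'.src_box b p)
  tgt_box := by
    rintro (b | b) p
    · exact congrArg Sum.inl (d.tgt_box b p)
    · exact congrArg Sum.inr (d'.tgt_box b p)
  tgt_loop := by
    rintro (l | l)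
    · exact congrArg Sum.inl (d.tgt_loop l)
    · exact congrArg Sum.inr (d'.tgt_loop l)
  surjective := (Sum.map_surjective.2 ⟨d.surjective, d'.surjective⟩).comp
    (Rewiring.gather _ _ _ _ _ _).toEquiv.surjective
  exact k k' h h' := by
    have h1 : ∀ p, k' ((Rewiring.gather _ _ _ _ _ _).symm (e.sum e' p)) =
        k ((Rewiring.gather _ _ _ _ _ _).symm p) := fun p =>
      (congrArg (fun q => k' ((Rewiring.gather _ _ _ _ _ _).symm (e.sum e' q)))
        ((Rewiring.gather _ _ _ _ _ _).apply_symm_apply p)).symm.trans (h _)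
    have h2 : ∀ p q, Sum.map d.src d'.src p = Sum.map d.src d'.src q →
        k ((Rewiring.gather _ _ _ _ _ _).symm p) = k ((Rewiring.gather _ _ _ _ _ _).symm q) := by
      rintro (p | p) (q | q) hpq
      · exact d.exact _ (fun p => k' ((Rewiring.gather _ _ _ _ _ _).symm (Sum.inl p)))
          (fun p => h1 (Sum.inl p)) (fun l => h' (Sum.inl l)) p q (Sum.inl.inj hpq)
      · cases hpq
      · cases hpq
      · exact d'.exact _ (fun p => k' ((Rewiring.gather _ _ _ _ _ _).symm (Sum.inr p)))
          (fun p => h1 (Sum.inr p)) (fun l => h' (Sum.inr l)) p q (Sum.inr.inj hpq)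
    intro p q hpq
    exact (congrArg k (Rewiring.symm_apply_apply _ p)).symm.trans
      ((h2 _ _ hpq).trans (congrArg k (Rewiring.symm_apply_apply _ q)))

/-- Feeding back some wires of a network traces the diagram. -/
def trace {D : TraceDiagram S (A.tensor U) (B.tensor U)} {M : ObjTerm S.Mor} {L : ObjTerm S.Obj}
    {e : NetWiring (A.tensor U) (B.tensor U) M L} (d : D.DrawnBy e) :
    D.trace.DrawnBy (M := M) (L := U.tensor L)
      ((Rewiring.regroup _ _ _ _).trans (e.trans (Rewiring.regroup _ _ _ _).symm)) where
  box := d.box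
  box_bijective := d.box_bijective
  src p := Quot.mk _ (d.src (Rewiring.regroup _ _ _ _ p))
  tgt p := Quot.mk _ (d.tgt (Rewiring.regroup _ _ _ _ p))
  tgt_apply p := by
    rw [Rewiring.trans_apply, Rewiring.trans_apply, Rewiring.apply_symm_apply, d.tgt_apply]
  label_src p := (d.label_src _).trans ((Rewiring.regroup _ _ _ _).label_eq p)
  src_inp p := congrArg (Quot.mk _) (d.src_inp (Sum.inl p))
  tgt_out p := congrArg (Quot.mk _) (d.tgt_out (Sum.inl p))
  src_box b p := congrArg (Quot.mk _) (d.src_box b p)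
  tgt_box b p := congrArg (Quot.mk _) (d.tgt_box b p)
  tgt_loop := by
    rintro (l | l)
    · refine (congrArg (Quot.mk _) (d.tgt_out (Sum.inr l))).trans ?_
      refine Eq.trans ?_ (congrArg (Quot.mk _) (d.src_inp (Sum.inr l))).symm
      exact Quot.sound ⟨l⟩
    · exact congrArg (Quot.mk _) (d.tgt_loop l)
  surjective := Quot.mk_surjective.comp
    (d.surjective.comp (Rewiring.regroup _ _ _ _).toEquiv.surjective)
  exact {T} k k' h h' p q hpq := by
    have h1 : ∀ p, k' ((Rewiring.regroup _ _ _ _).symm (e p)) =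
        k ((Rewiring.regroup _ _ _ _).symm p) := fun p => by
      rw [← h, Rewiring.trans_apply, Rewiring.trans_apply, Rewiring.apply_symm_apply]
    have h2 := d.exact (fun p => k ((Rewiring.regroup _ _ _ _).symm p))
      (fun p => k' ((Rewiring.regroup _ _ _ _).symm p)) h1 (fun l => h' (Sum.inr l))
    -- Exactness for `D` lets `k` descend to a function `r` on the wires of `D`; it then remains to
    -- see that `r` respects the joins added by the trace.
    obtain ⟨r, hr⟩ : ∃ r : D.Wire → T, ∀ p, r (d.src p) = k ((Rewiring.regroup _ _ _ _).symm p) :=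
      ⟨fun a => k ((Rewiring.regroup _ _ _ _).symm (Function.surjInv d.surjective a)),
        fun p => h2 _ _ (Function.surjInv_eq d.surjective _)⟩
    have hout : ∀ q, r (d.tgt q) = k' ((Rewiring.regroup _ _ _ _).symm q) := fun q => by
      obtain ⟨p, rfl⟩ := e.toEquiv.surjective q
      rw [d.tgt_apply, hr, h1]
    have h3 : ∀ a b, TraceRel D a b → r a = r b := by
      rintro _ _ ⟨u⟩
      exact (congrArg r (d.tgt_out (Sum.inr u))).symm.trans ((hout _).trans
        ((h' (Sum.inl u)).trans ((hr _).symm.trans (congrArg r (d.src_inp (Sum.inr u))))))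
    have h4 := congrArg (Quot.lift r h3) hpq
    change r _ = r _ at h4
    rwa [hr, hr, Rewiring.symm_apply_apply, Rewiring.symm_apply_apply] at h4

/-- A network that draws a composite. -/
def comp {D : TraceDiagram S A B} {E : TraceDiagram S B C} {M M' : ObjTerm S.Mor}
    {L L' : ObjTerm S.Obj} {e : NetWiring A B M L} {e' : NetWiring B C M' L'}
    (d : D.DrawnBy e) (d' : E.DrawnBy e') :=
  (((d.tensor d').post (.braid B C)).trace).ofIso (compIsoTrace D E)

/-- The additional wires of a network may be permuted. -/
def rewire {D : TraceDiagram S A B} {M : ObjTerm S.Mor} {L L' : ObjTerm S.Obj}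
    {e : NetWiring A B M L} (d : D.DrawnBy e) (f : Rewiring L L') (e' : NetWiring A B M L')
    (he : ∀ p, e' ((Rewiring.refl _).sum ((Rewiring.refl _).sum f) p) =
      (Rewiring.refl _).sum ((Rewiring.refl _).sum f) (e p)) : D.DrawnBy e' where
  box := d.box
  box_bijective := d.box_bijective
  src p := d.src (((Rewiring.refl _).sum ((Rewiring.refl _).sum f)).symm p)
  tgt p := d.tgt (((Rewiring.refl _).sum ((Rewiring.refl _).sum f)).symm p)
  tgt_apply p := by
    obtain ⟨q, rfl⟩ := ((Rewiring.refl _).sum ((Rewiring.refl _).sum f)).toEquiv.surjective p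
    rw [he, Rewiring.symm_apply_apply, Rewiring.symm_apply_apply, d.tgt_apply]
  label_src p := (d.label_src _).trans (Rewiring.label_eq _ p)
  src_inp := d.src_inp
  tgt_out := d.tgt_out
  src_box := d.src_box
  tgt_box := d.tgt_box
  tgt_loop l := d.tgt_loop _
  surjective := d.surjective.comp (Equiv.surjective _)
  exact k k' h h' p q hpq := by
    have := d.exact (fun p => k ((Rewiring.refl _).sum ((Rewiring.refl _).sum f) p))
      (fun p => k' ((Rewiring.refl _).sum ((Rewiring.refl _).sum f) p))
      (fun p => by rw [← he, h]) (fun l => h' _) _ _ hpq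
    simpa only [Rewiring.apply_symm_apply] using this

/-- An additional wire that is not a loop can be pulled straight. -/
def yank {D : TraceDiagram S A B} {M : ObjTerm S.Mor} {L : ObjTerm S.Obj} {X : S.Obj}
    {e : Rewiring ((A.tensor ((M.subst S.cod).tensor L)).tensor (.var X))
      ((B.tensor ((M.subst S.dom).tensor L)).tensor (.var X))}
    (d : D.DrawnBy (M := M) (L := L.tensor (.var X))
      ((Rewiring.split _ _ _ _).symm.trans (e.trans (Rewiring.split _ _ _ _))))
    (f : NetWiring A B M L)
    (p : (A.tensor ((M.subst S.cod).tensor L)).Pos) (hp : e (Sum.inl p) = Sum.inr ())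
    (hfp : e (Sum.inr ()) = Sum.inl (f p))
    (hf : ∀ q, q ≠ p → e (Sum.inl q) = Sum.inl (f q)) : D.DrawnBy f :=
  have tgt_split : ∀ z, d.tgt (Rewiring.split _ _ _ _ (e z)) = d.src (Rewiring.split _ _ _ _ z) :=
    fun z => by
      rw [← d.tgt_apply, Rewiring.trans_apply, Rewiring.trans_apply, Rewiring.symm_apply_apply]
  -- The wire to be removed is fed from `p`, so both sources already lie on one wire of `D`.
  have src_last : d.src (Rewiring.split _ _ _ _ (Sum.inr ())) =
      d.src (Rewiring.split _ _ _ _ (Sum.inl p)) :=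
    (d.tgt_loop (Sum.inr ())).symm.trans
      ((congrArg (fun z => d.tgt (Rewiring.split _ _ _ _ z)) hp).symm.trans (tgt_split _))
  { box := d.box
    box_bijective := d.box_bijective
    src := fun q => d.src (Rewiring.split _ _ _ _ (Sum.inl q))
    tgt := fun q => d.tgt (Rewiring.split _ _ _ _ (Sum.inl q))
    tgt_apply := fun q => by
      by_cases hq : q = p
      · subst hq
        exact (congrArg (fun z => d.tgt (Rewiring.split _ _ _ _ z)) hfp).symm.trans
          ((tgt_split _).trans src_last)
      · exact (congrArg (fun z => d.tgt (Rewiring.split _ _ _ _ z)) (hf q hq)).symm.trans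
          (tgt_split _)
    label_src := fun q => (d.label_src _).trans ((Rewiring.split _ _ _ _).label_eq (Sum.inl q))
    src_inp := d.src_inp
    tgt_out := d.tgt_out
    src_box := d.src_box
    tgt_box := d.tgt_box
    tgt_loop := fun l => d.tgt_loop (Sum.inl l)
    surjective := fun a => by
      obtain ⟨y, rfl⟩ := d.surjective a
      obtain ⟨z, rfl⟩ := (Rewiring.split _ _ _ _).toEquiv.surjective y
      rcases z with q | ⟨⟨⟩⟩
      · exact ⟨q, rfl⟩
      · exact ⟨p, src_last.symm⟩
    exact := fun k k' h h' q r hqr => by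
      -- A test function for the shorter network is extended to the removed wire by its value at the
      -- source `p` that feeds it.
      refine (congrArg (Sum.elim k fun _ => k p) ((Rewiring.split _ _ _ (.var X)).symm_apply_apply
        (Sum.inl q))).symm.trans (Eq.trans ?_ (congrArg (Sum.elim k fun _ => k p)
          ((Rewiring.split _ _ _ (.var X)).symm_apply_apply (Sum.inl r))))
      refine d.exact (fun y => Sum.elim k (fun _ => k p) ((Rewiring.split _ _ _ _).symm y))
        (fun y => Sum.elim k' (fun _ => k p) ((Rewiring.split _ _ _ _).symm y)) ?_ ?_ _ _ hqr
      · intro y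
        obtain ⟨z, rfl⟩ := (Rewiring.split _ _ _ _).toEquiv.surjective y
        rw [Rewiring.trans_apply, Rewiring.trans_apply, Rewiring.symm_apply_apply,
          Rewiring.symm_apply_apply]
        rcases z with q | ⟨⟨⟩⟩
        · by_cases hq : q = p
          · subst hq
            exact congrArg (Sum.elim k' fun _ => k q) hp
          · exact (congrArg (Sum.elim k' fun _ => k p) (hf q hq)).trans (h q)
        · exact (congrArg (Sum.elim k' fun _ => k p) hfp).trans (h p)
      · rintro (l | l)
        · exact h' l
        · rfl }

/-- If all additional wires are loops, the identity and the inverse of `e` are admissible test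
functions in `exact`, and they separate all sources. -/
theorem src_injective {D : TraceDiagram S A B} {M : ObjTerm S.Mor} {L : ObjTerm S.Obj}
    {e : NetWiring A B M L} (d : D.DrawnBy e)
    (he : ∀ l, e (Sum.inr (Sum.inr l)) = Sum.inr (Sum.inr l)) : Function.Injective d.src :=
  fun p q hpq => d.exact _root_.id e.symm (fun p => e.symm_apply_apply p)
    (fun l => e.symm_apply_eq.2 (he l).symm) p q hpq

end DrawnBy

end TraceDiagram

/-! ### Normal forms: networks whose additional wires are all loops. -/

theorem Rewiring.subst_refl {N O : Type w} (f : N → ObjTerm O) (K : ObjTerm N) :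
    (Rewiring.refl K).subst f = .refl _ := by
  refine Rewiring.ext_fun fun q => ?_
  obtain ⟨b, p, rfl⟩ := K.exists_port f q
  exact Rewiring.subst_port f (.refl K) b p p HEq.rfl

/-- A bijection that does not fix the last wire induces a bijection between the other wires. -/
theorem Rewiring.exists_yank {O : Type w} {A B : ObjTerm O} {X : O}
    (e : Rewiring (A.tensor (.var X)) (B.tensor (.var X))) (he : e (Sum.inr ()) ≠ Sum.inr ()) :
    ∃ (f : Rewiring A B) (p : A.Pos), e (Sum.inl p) = Sum.inr () ∧
      e (Sum.inr ()) = Sum.inl (f p) ∧ ∀ q, q ≠ p → e (Sum.inl q) = Sum.inl (f q) := by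
  obtain ⟨p, hp⟩ : ∃ p, e (Sum.inl p) = Sum.inr () := by
    obtain ⟨p | ⟨⟨⟩⟩, hp⟩ := e.toEquiv.surjective (Sum.inr ())
    · exact ⟨p, hp⟩
    · exact (he hp).elim
  -- The shortcut: `q` goes where `e` sends it, except that `p` goes straight to where the last wire
  -- was sent.
  have h : ∀ q, ∃ r, (q = p → e (Sum.inr ()) = Sum.inl r) ∧
      (q ≠ p → e (Sum.inl q) = Sum.inl r) := by
    intro q
    by_cases hq : q = p
    · rcases hr : e (Sum.inr ()) with r | ⟨⟨⟩⟩
      · exact ⟨r, fun _ => rfl, fun h => (h hq).elim⟩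
      · exact (he hr).elim
    · rcases hr : e (Sum.inl q) with r | ⟨⟨⟩⟩
      · exact ⟨r, fun h => (hq h).elim, fun _ => rfl⟩
      · exact (hq (Sum.inl.inj (e.injective (hr.trans hp.symm)))).elim
  choose f hf hf' using h
  refine ⟨⟨Equiv.ofBijective f ⟨fun q r hqr => ?_, fun r => ?_⟩, fun q => ?_⟩, p, hp,
    hf p rfl, hf'⟩
  · by_cases hq : q = p
    · by_cases hr : r = p
      · rw [hq, hr]
      · have h1 := (hf q hq).trans ((congrArg Sum.inl hqr).trans (hf' r hr).symm)
        cases e.injective h1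
    · by_cases hr : r = p
      · have h1 := (hf' q hq).trans ((congrArg Sum.inl hqr).trans (hf r hr).symm)
        cases e.injective h1
      · exact Sum.inl.inj (e.injective
          ((hf' q hq).trans ((congrArg Sum.inl hqr).trans (hf' r hr).symm)))
  · obtain ⟨q | ⟨⟨⟩⟩, hq⟩ := e.toEquiv.surjective (Sum.inl r)
    · have hqp : q ≠ p := by
        rintro rfl
        cases hp.symm.trans hq
      exact ⟨q, Sum.inl.inj ((hf' q hqp).symm.trans hq)⟩
    · exact ⟨p, Sum.inl.inj ((hf p rfl).symm.trans hq)⟩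
  · change B.label (f q) = _
    by_cases hq : q = p
    · have h1 := e.label_eq (Sum.inr ())
      rw [hf q hq] at h1
      have h2 := e.label_eq (Sum.inl p)
      rw [hp] at h2
      rw [hq]
      rw [hq] at h1
      exact h1.trans h2
    · have h1 := e.label_eq (Sum.inl q)
      rw [hf' q hq] at h1
      exact h1

section Normalization

variable {S : TraceSignature.{w}} {C : Type u} [Category.{v} C] [MonoidalCategory C]
  [SymmetricCategory C] [PartiallyTracedCategory C] (x : TraceValuation C S)
variable {A B : ObjTerm S.Obj}

/-- The value of a term, if defined, is the value of a network that draws the same diagram. -/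
theorem exists_net_of_mem_peval (t : TraceTerm S A B) :
    ∀ f ∈ t.peval x, ∃ (M : ObjTerm S.Mor) (L : ObjTerm S.Obj) (e : NetWiring A B M L),
      f ∈ net x e ∧ Nonempty (t.diagram.DrawnBy e) := by
  -- All structural generators at once. A wiring maps outputs to inputs while a rewiring follows the
  -- direction of the morphism, hence the inverse.
  have key : ∀ {A B : ObjTerm S.Obj} (e : B.Pos ≃ A.Pos) (he : ∀ p, A.label (e p) = B.label p)
      (f : A.eval x.obj ⟶ B.eval x.obj), f = permHom x.obj (Rewiring.symm ⟨e, he⟩) →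
      ∃ (M : ObjTerm S.Mor) (L : ObjTerm S.Obj) (e' : NetWiring A B M L),
      f ∈ net x e' ∧ Nonempty ((TraceDiagram.wiring (S := S) e he).DrawnBy e') := by
    rintro A B e he _ rfl
    exact ⟨_, _, _, permHom_mem_net x _, ⟨.wiring e he⟩⟩
  induction t with
  | var m =>
    rintro f hf
    rw [TraceTerm.peval, Part.mem_some_iff] at hf
    subst hf
    exact ⟨_, _, _, mor_mem_net x m, ⟨.single m⟩⟩
  | id A =>
    exact fun f hf => key _ _ f ((Part.mem_some_iff.1 hf).trans (permHom_refl x.obj A).symm)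
  | @comp A B D s t hs ht =>
    intro f hf
    rw [TraceTerm.peval, Part.mem_bind_iff] at hf
    obtain ⟨a, ha, hf⟩ := hf
    obtain ⟨b, hb, rfl⟩ := (Part.mem_map_iff _).1 hf
    obtain ⟨M, L, e, he, ⟨d⟩⟩ := hs a ha
    obtain ⟨M', L', e', he', ⟨d'⟩⟩ := ht b hb
    -- The composite is the trace over `B` of the juxtaposition with its outputs crossed, matching
    -- `compIsoTrace` on the side of diagrams.
    have h1 := permHom_conj_mem_net x (tens_mem_net x he he') (.refl _) (.braid B D)
    rw [permHom_refl, Category.id_comp] at h1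
    exact ⟨_, _, _, ptr_mem_net x h1 (comp_mem_ptr a b), ⟨d.comp d'⟩⟩
  | tensor s t hs ht =>
    intro f hf
    rw [TraceTerm.peval, Part.mem_bind_iff] at hf
    obtain ⟨a, ha, hf⟩ := hf
    obtain ⟨b, hb, rfl⟩ := (Part.mem_map_iff _).1 hf
    obtain ⟨M, L, e, he, ⟨d⟩⟩ := hs a ha
    obtain ⟨M', L', e', he', ⟨d'⟩⟩ := ht b hb
    exact ⟨_, _, _, tens_mem_net x he he', ⟨d.tensor d'⟩⟩
  | assoc A B D =>
    exact fun f hf => key _ _ f ((Part.mem_some_iff.1 hf).trans (permHom_assoc x.obj A B D).symm)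
  | assocInv A B D =>
    exact fun f hf => key _ _ f
      ((Part.mem_some_iff.1 hf).trans (permHom_assoc_symm x.obj A B D).symm)
  | leftUnitor A =>
    exact fun f hf => key _ _ f ((Part.mem_some_iff.1 hf).trans (permHom_leftUnitor x.obj A).symm)
  | leftUnitorInv A =>
    exact fun f hf => key _ _ f
      ((Part.mem_some_iff.1 hf).trans (permHom_leftUnitor_symm x.obj A).symm)
  | rightUnitor A =>
    exact fun f hf => key _ _ f ((Part.mem_some_iff.1 hf).trans (permHom_rightUnitor x.obj A).symm)
  | rightUnitorInv A =>
    exact fun f hf => key _ _ f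
      ((Part.mem_some_iff.1 hf).trans (permHom_rightUnitor_symm x.obj A).symm)
  | symm A B =>
    exact fun f hf => key _ _ f ((Part.mem_some_iff.1 hf).trans (permHom_braid x.obj A B).symm)
  | trace t ht =>
    intro f hf
    rw [TraceTerm.peval, Part.mem_bind_iff] at hf
    obtain ⟨a, ha, hf⟩ := hf
    obtain ⟨M, L, e, he, ⟨d⟩⟩ := ht a ha
    exact ⟨_, _, _, ptr_mem_net x he hf, ⟨d.trace⟩⟩

/-- Additional wires that are not loops are pulled straight one at a time, and their number
decreases. Loops remain, being wires of the diagram in their own right. -/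
theorem exists_normal_net {D : TraceDiagram S A B} {M : ObjTerm S.Mor} {L : ObjTerm S.Obj}
    (e : NetWiring A B M L) (d : D.DrawnBy e) :
    ∃ (L' : ObjTerm S.Obj) (e' : NetWiring A B M L'), net x e = net x e' ∧
      Nonempty (D.DrawnBy e') ∧ ∀ l, e' (Sum.inr (Sum.inr l)) = Sum.inr (Sum.inr l) := by
  induction hn : Nat.card L.Pos using Nat.strong_induction_on generalizing L with
  | _ n ih =>
    by_cases he : ∀ l, e (Sum.inr (Sum.inr l)) = Sum.inr (Sum.inr l)
    · exact ⟨L, e, rfl, ⟨d⟩, he⟩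
    push Not at he
    obtain ⟨l, hl⟩ := he
    -- The offending wire is moved to the last place among the additional wires, where it can be
    -- yanked.
    obtain ⟨ψ, hψ⟩ : ∃ ψ : Rewiring L ((L.erase l).tensor (.var (L.label l))),
        ψ l = Sum.inr () :=
      ⟨(StructTerm.extract L l _ rfl).perm.trans (.braid _ _), by
        rw [Rewiring.trans_apply, StructTerm.perm_extract_self]; rfl⟩
    have hs : ∀ K : ObjTerm S.Obj, ∀ P : ObjTerm S.Obj,
      (((Rewiring.refl K).sum ((Rewiring.refl P).sum ψ)).trans
        (Rewiring.split _ _ _ _).symm) (Sum.inr (Sum.inr l)) = Sum.inr () := by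
      intro K P
      change (Rewiring.split _ _ _ _).symm (Sum.inr (Sum.inr (ψ l))) = _
      rw [hψ]
      rfl
    let a := ((Rewiring.refl A).sum ((Rewiring.refl (M.subst S.cod)).sum ψ)).trans
        (Rewiring.split _ _ _ _).symm
    let b := ((Rewiring.refl B).sum ((Rewiring.refl (M.subst S.dom)).sum ψ)).trans
        (Rewiring.split _ _ _ _).symm
    -- `g` is `e` with the wire `l` singled out on both sides.
    let g := a.symm.trans (e.trans b)
    have hg : g (Sum.inr ()) ≠ Sum.inr () := by
      have ha : a.symm (Sum.inr ()) = Sum.inr (Sum.inr l) := a.symm_apply_eq.2 (hs _ _).symm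
      exact fun h => hl (b.injective ((congrArg (fun z => b (e z)) ha).symm.trans
        (h.trans (hs B _).symm)))
    obtain ⟨f, p, hp, hfp, hf⟩ := g.exists_yank hg
    have hge : ∀ p, ((Rewiring.split _ _ _ _).symm.trans (g.trans (Rewiring.split _ _ _ _)))
        ((Rewiring.refl _).sum ((Rewiring.refl _).sum ψ) p) =
          (Rewiring.refl _).sum ((Rewiring.refl _).sum ψ) (e p) := by
      intro p
      change Rewiring.split _ _ _ _ ((Rewiring.split _ _ _ _).symm
        ((Rewiring.refl _).sum ((Rewiring.refl _).sum ψ) (e (a.symm (a p))))) = _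
      rw [Rewiring.apply_symm_apply, Rewiring.symm_apply_apply]
    have d1 := (d.rewire ψ _ hge).yank f p hp hfp hf
    obtain ⟨L', e', h1, h2⟩ := ih _ (hn ▸ L.card_erase l) f d1 rfl
    refine ⟨L', e', ?_, h2⟩
    rw [← h1, ← net_eq_of_yank x g f p hp hfp hf]
    refine net_congr x _ _ (.refl M) ψ ?_
    rw [Rewiring.subst_refl, Rewiring.subst_refl]
    exact hge

theorem TraceDiagram.boxOut_congr (D : TraceDiagram S A B) {m m' : S.Mor} {b : D.Box m}
    {b' : D.Box m'} (h : (⟨m, b⟩ : Σ m, D.Box m) = ⟨m', b'⟩) {p : (S.cod m).Pos}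
    {p' : (S.cod m').Pos} (hp : HEq p p') : D.boxOut b p = D.boxOut b' p' := by
  cases h
  cases hp
  rfl

theorem TraceDiagram.boxIn_congr (D : TraceDiagram S A B) {m m' : S.Mor} {b : D.Box m}
    {b' : D.Box m'} (h : (⟨m, b⟩ : Σ m, D.Box m) = ⟨m', b'⟩) {p : (S.dom m).Pos}
    {p' : (S.dom m').Pos} (hp : HEq p p') : D.boxIn b p = D.boxIn b' p' := by
  cases h
  cases hp
  rfl

/-- Two networks that draw the same diagram, and whose additional wires are all loops, have the
same value. -/
theorem net_eq_of_drawnBy {D : TraceDiagram S A B} {M M' : ObjTerm S.Mor} {L L' : ObjTerm S.Obj}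
    {e : NetWiring A B M L} {e' : NetWiring A B M' L'} (d : D.DrawnBy e) (d' : D.DrawnBy e')
    (he : ∀ l, e (Sum.inr (Sum.inr l)) = Sum.inr (Sum.inr l))
    (he' : ∀ l, e' (Sum.inr (Sum.inr l)) = Sum.inr (Sum.inr l)) : net x e = net x e' := by
  have inj := d.src_injective he
  have inj' := d'.src_injective he'
  -- Boxes of the two networks correspond if they are drawn as the same box of `D`.
  let φ₀ : M.Pos ≃ M'.Pos :=
    (Equiv.ofBijective _ d.box_bijective).trans (Equiv.ofBijective _ d'.box_bijective).symm
  have hφ₀ : ∀ b, (⟨M'.label (φ₀ b), d'.box (φ₀ b)⟩ : Σ m, D.Box m) = ⟨M.label b, d.box b⟩ :=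
    fun b => (Equiv.ofBijective _ d'.box_bijective).apply_symm_apply _
  let φ : Rewiring M M' := ⟨φ₀, fun b => congrArg Sigma.fst (hφ₀ b)⟩
  have hcod : ∀ q, d'.src (Sum.inr (Sum.inl (φ.subst S.cod q))) = d.src (Sum.inr (Sum.inl q)) := by
    intro q
    obtain ⟨b, p, rfl⟩ := M.exists_port S.cod q
    have hp : HEq p (cast (congrArg (fun m => (S.cod m).Pos) (φ.label_eq b).symm) p) :=
      (cast_heq _ _).symm
    rw [φ.subst_port S.cod b p _ hp]
    exact (d'.src_box _ _).trans ((D.boxOut_congr (hφ₀ b) hp.symm).trans (d.src_box b p).symm)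
  have hdom : ∀ q, d'.tgt (Sum.inr (Sum.inl (φ.subst S.dom q))) = d.tgt (Sum.inr (Sum.inl q)) := by
    intro q
    obtain ⟨b, p, rfl⟩ := M.exists_port S.dom q
    have hp : HEq p (cast (congrArg (fun m => (S.dom m).Pos) (φ.label_eq b).symm) p) :=
      (cast_heq _ _).symm
    rw [φ.subst_port S.dom b p _ hp]
    exact (d'.tgt_box _ _).trans ((D.boxIn_congr (hφ₀ b) hp.symm).trans (d.tgt_box b p).symm)
  -- In both networks the sources are in bijection with the wires of `D`. Inputs and box outputs
  -- already correspond, so the remaining wires, the loops, must correspond as well.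
  have hL : ∀ l, ∃ l', d'.src (Sum.inr (Sum.inr l')) = d.src (Sum.inr (Sum.inr l)) := by
    intro l
    obtain ⟨p | q | l', h⟩ := d'.surjective (d.src (Sum.inr (Sum.inr l)))
    · cases inj (((d.src_inp p).trans (d'.src_inp p).symm).trans h)
    · obtain ⟨q, rfl⟩ := (φ.subst S.cod).toEquiv.surjective q
      cases inj ((hcod q).symm.trans h)
    · exact ⟨l', h⟩
  have hL' : ∀ l', ∃ l, d.src (Sum.inr (Sum.inr l)) = d'.src (Sum.inr (Sum.inr l')) := by
    intro l'
    obtain ⟨p | q | l, h⟩ := d.surjective (d'.src (Sum.inr (Sum.inr l')))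
    · cases inj' (((d'.src_inp p).trans (d.src_inp p).symm).trans h)
    · cases inj' ((hcod q).trans h)
    · exact ⟨l, h⟩
  choose ψ₀ hψ₀ using hL
  have hψ : Function.Bijective ψ₀ := by
    refine ⟨fun l m h => ?_, fun l' => ?_⟩
    · have h1 := (hψ₀ l).symm.trans ((congrArg (fun l => d'.src (Sum.inr (Sum.inr l))) h).trans
        (hψ₀ m))
      exact Sum.inr.inj (Sum.inr.inj (inj h1))
    · obtain ⟨l, hl⟩ := hL' l'
      exact ⟨l, Sum.inr.inj (Sum.inr.inj (inj' ((hψ₀ l).trans hl)))⟩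
  let ψ : Rewiring L L' := ⟨Equiv.ofBijective ψ₀ hψ, fun l =>
    (d'.label_src (Sum.inr (Sum.inr _))).symm.trans ((congrArg D.label (hψ₀ l)).trans
      (d.label_src (Sum.inr (Sum.inr l))))⟩
  have hsrc : ∀ p, d'.src ((Rewiring.refl A).sum ((φ.subst S.cod).sum ψ) p) = d.src p := by
    rintro (p | q | l)
    · exact (d'.src_inp p).trans (d.src_inp p).symm
    · exact hcod q
    · exact hψ₀ l
  have htgt : ∀ p, d'.tgt ((Rewiring.refl B).sum ((φ.subst S.dom).sum ψ) p) = d.tgt p := by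
    rintro (p | q | l)
    · exact (d'.tgt_out p).trans (d.tgt_out p).symm
    · exact hdom q
    · exact (d'.tgt_loop _).trans ((hψ₀ l).trans (d.tgt_loop l).symm)
  -- The wirings are compared on the wires of `D`: pulled back along `e'`, both sides are sources of
  -- the second network, on which `d'.src` is injective.
  refine net_congr x e e' φ ψ fun p => e'.symm.injective (inj' ?_)
  rw [Rewiring.symm_apply_apply, hsrc, ← d'.tgt_apply, Rewiring.apply_symm_apply, htgt,
    d.tgt_apply]

/-- Terms with isomorphic diagrams have the same value when both are defined. -/
theorem eq_of_diagram_iso {s t : TraceTerm S A B} (i : s.diagram.Iso t.diagram)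
    {f g : A.eval x.obj ⟶ B.eval x.obj} (hf : f ∈ s.peval x) (hg : g ∈ t.peval x) : f = g := by
  obtain ⟨M, L, e, he, ⟨d⟩⟩ := exists_net_of_mem_peval x s f hf
  obtain ⟨M', L', e', he', ⟨d'⟩⟩ := exists_net_of_mem_peval x t g hg
  obtain ⟨L₁, e₁, h₁, ⟨d₁⟩, hl₁⟩ := exists_normal_net x e (d.ofIso i)
  obtain ⟨L₂, e₂, h₂, ⟨d₂⟩, hl₂⟩ := exists_normal_net x e' d'
  -- These are Kleene equalities between whole networks; definedness enters only through `he` and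
  -- `he'`.
  rw [h₁, net_eq_of_drawnBy x d₁ d₂ hl₁ hl₂] at he
  rw [h₂] at he'
  exact Part.mem_unique he he'

end Normalization

/-! ### Isomorphisms of diagrams -/

namespace TraceDiagram

variable {S : TraceSignature.{w}} {A B C D A' B' C' A'' B'' U V : ObjTerm S.Obj}

/-- Permutes the inputs of a diagram. -/
def pre (E : TraceDiagram S B C) (e : B.Pos ≃ A.Pos) (he : ∀ p, A.label (e p) = B.label p) :
    TraceDiagram S A C where
  __ := E
  inp p := E.inp (e.symm p)
  label_inp p := (E.label_inp _).trans (by rw [← he, Equiv.apply_symm_apply])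

namespace Iso

/-- Juxtaposition of isomorphisms. -/
def tensor {D D' : TraceDiagram S A B} {E E' : TraceDiagram S A' B'} (i : D.Iso D')
    (j : E.Iso E') : (D.tensor E).Iso (D'.tensor E') where
  wire := Equiv.sumCongr i.wire j.wire
  box m := Equiv.sumCongr (i.box m) (j.box m)
  label_wire := Sum.rec i.label_wire j.label_wire
  wire_inp := Sum.rec (fun p => congrArg Sum.inl (i.wire_inp p))
    (fun p => congrArg Sum.inr (j.wire_inp p))
  wire_out := Sum.rec (fun p => congrArg Sum.inl (i.wire_out p))
    (fun p => congrArg Sum.inr (j.wire_out p))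
  wire_boxIn := by
    rintro m (b | b) p
    exacts [congrArg Sum.inl (i.wire_boxIn b p), congrArg Sum.inr (j.wire_boxIn b p)]
  wire_boxOut := by
    rintro m (b | b) p
    exacts [congrArg Sum.inl (i.wire_boxOut b p), congrArg Sum.inr (j.wire_boxOut b p)]

/-- Composition of isomorphisms. -/
def comp {D D' : TraceDiagram S A B} {E E' : TraceDiagram S B C} (i : D.Iso D')
    (j : E.Iso E') : (D.comp E).Iso (D'.comp E') where
  wire :=
    { toFun := Quot.map (Sum.map i.wire j.wire) (by
        rintro _ _ ⟨p⟩
        simp only [Sum.map_inl, Sum.map_inr, i.wire_out, j.wire_inp]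
        exact ⟨p⟩)
      invFun := Quot.map (Sum.map i.wire.symm j.wire.symm) (by
        rintro _ _ ⟨p⟩
        simp only [Sum.map_inl, Sum.map_inr, ← i.wire_out, ← j.wire_inp, Equiv.symm_apply_apply]
        exact ⟨p⟩)
      left_inv := by
        rintro ⟨a | a⟩
        exacts [congrArg (fun a => Quot.mk _ (Sum.inl a)) (i.wire.symm_apply_apply a),
          congrArg (fun a => Quot.mk _ (Sum.inr a)) (j.wire.symm_apply_apply a)]
      right_inv := by
        rintro ⟨a | a⟩
        exacts [congrArg (fun a => Quot.mk _ (Sum.inl a)) (i.wire.apply_symm_apply a),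
          congrArg (fun a => Quot.mk _ (Sum.inr a)) (j.wire.apply_symm_apply a)] }
  box m := Equiv.sumCongr (i.box m) (j.box m)
  label_wire := by
    rintro ⟨a | a⟩
    exacts [i.label_wire a, j.label_wire a]
  wire_inp p := congrArg (fun a => Quot.mk _ (Sum.inl a)) (i.wire_inp p)
  wire_out p := congrArg (fun a => Quot.mk _ (Sum.inr a)) (j.wire_out p)
  wire_boxIn := by
    rintro m (b | b) p
    exacts [congrArg (fun a => Quot.mk _ (Sum.inl a)) (i.wire_boxIn b p),
      congrArg (fun a => Quot.mk _ (Sum.inr a)) (j.wire_boxIn b p)]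
  wire_boxOut := by
    rintro m (b | b) p
    exacts [congrArg (fun a => Quot.mk _ (Sum.inl a)) (i.wire_boxOut b p),
      congrArg (fun a => Quot.mk _ (Sum.inr a)) (j.wire_boxOut b p)]

/-- Trace of an isomorphism. -/
def trace {D D' : TraceDiagram S (A.tensor U) (B.tensor U)} (i : D.Iso D') :
    D.trace.Iso D'.trace where
  wire :=
    { toFun := Quot.lift (fun a => Quot.mk _ (i.wire a)) (by
        rintro _ _ ⟨p⟩
        exact (congrArg (Quot.mk _) (i.wire_out (Sum.inr p))).trans
          ((Quot.sound ⟨p⟩).trans (congrArg (Quot.mk _) (i.wire_inp (Sum.inr p))).symm))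
      invFun := Quot.lift (fun a => Quot.mk _ (i.wire.symm a)) (by
        rintro _ _ ⟨p⟩
        exact (congrArg (Quot.mk _) (i.symm.wire_out (Sum.inr p))).trans
          ((Quot.sound ⟨p⟩).trans (congrArg (Quot.mk _) (i.symm.wire_inp (Sum.inr p))).symm))
      left_inv := by
        rintro ⟨a⟩
        exact congrArg (Quot.mk _) (i.wire.symm_apply_apply a)
      right_inv := by
        rintro ⟨a⟩
        exact congrArg (Quot.mk _) (i.wire.apply_symm_apply a) }
  box := i.box
  label_wire := by
    rintro ⟨a⟩
    exact i.label_wire a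
  wire_inp p := congrArg (Quot.mk _) (i.wire_inp (Sum.inl p))
  wire_out p := congrArg (Quot.mk _) (i.wire_out (Sum.inl p))
  wire_boxIn b p := congrArg (Quot.mk _) (i.wire_boxIn b p)
  wire_boxOut b p := congrArg (Quot.mk _) (i.wire_boxOut b p)

end Iso

/-- Composition of diagrams is associative. -/
def compAssoc (D₁ : TraceDiagram S A B) (D₂ : TraceDiagram S B C) (D₃ : TraceDiagram S C D) :
    ((D₁.comp D₂).comp D₃).Iso (D₁.comp (D₂.comp D₃)) where
  wire :=
    { toFun := Quot.lift (Sum.elim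
        (Quot.lift (Sum.elim (fun a => Quot.mk _ (Sum.inl a))
          (fun a => Quot.mk _ (Sum.inr (Quot.mk _ (Sum.inl a)))))
            (by rintro _ _ ⟨p⟩; exact Quot.sound ⟨p⟩))
        (fun a => Quot.mk _ (Sum.inr (Quot.mk _ (Sum.inr a)))))
          (by rintro _ _ ⟨p⟩; exact congrArg (fun a => Quot.mk _ (Sum.inr a)) (Quot.sound ⟨p⟩))
      invFun := Quot.lift (Sum.elim
        (fun a => Quot.mk _ (Sum.inl (Quot.mk _ (Sum.inl a))))
        (Quot.lift (Sum.elim (fun a => Quot.mk _ (Sum.inl (Quot.mk _ (Sum.inr a))))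
          (fun a => Quot.mk _ (Sum.inr a)))
            (by rintro _ _ ⟨p⟩; exact Quot.sound (CompRel.join (D := D₁.comp D₂) p))))
          (by rintro _ _ ⟨p⟩; exact congrArg (fun a => Quot.mk _ (Sum.inl a)) (Quot.sound ⟨p⟩))
      left_inv := by
        rintro ⟨a | _⟩
        · rcases a with ⟨_ | _⟩ <;> rfl
        · rfl
      right_inv := by
        rintro ⟨_ | a⟩
        · rfl
        · rcases a with ⟨_ | _⟩ <;> rfl }
  box m := Equiv.sumAssoc _ _ _
  label_wire := by
    rintro ⟨a | _⟩
    · rcases a with ⟨_ | _⟩ <;> rfl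
    · rfl
  wire_inp _ := rfl
  wire_out _ := rfl
  wire_boxIn := by rintro _ ((_ | _) | _) _ <;> rfl
  wire_boxOut := by rintro _ ((_ | _) | _) _ <;> rfl

/-- Composition with a wiring permutes the outputs. -/
def compWiring (D : TraceDiagram S A B) (e : C.Pos ≃ B.Pos)
    (he : ∀ p, B.label (e p) = C.label p) : (D.comp (wiring e he)).Iso (D.post e he) where
  wire :=
    { toFun := Quot.lift (Sum.elim _root_.id D.out) (by rintro _ _ ⟨p⟩; rfl)
      invFun a := Quot.mk _ (Sum.inl a)
      left_inv := by
        rintro ⟨a | p⟩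
        exacts [rfl, Quot.sound (CompRel.join (E := wiring e he) p)]
      right_inv _ := rfl }
  box m := Equiv.sumEmpty _ Empty
  label_wire := by
    rintro ⟨a | p⟩
    exacts [rfl, D.label_out p]
  wire_inp _ := rfl
  wire_out _ := rfl
  wire_boxIn := by
    rintro m (b | b) p
    exacts [rfl, b.elim]
  wire_boxOut := by
    rintro m (b | b) p
    exacts [rfl, b.elim]

/-- Composition with a wiring permutes the inputs. -/
def wiringComp (e : B.Pos ≃ A.Pos) (he : ∀ p, A.label (e p) = B.label p)
    (D : TraceDiagram S B C) : ((wiring e he).comp D).Iso (D.pre e he) where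
  wire :=
    { toFun := Quot.lift (Sum.elim (fun p => D.inp (e.symm p)) _root_.id) (by
        rintro _ _ ⟨p⟩
        exact congrArg D.inp (e.symm_apply_apply p))
      invFun a := Quot.mk _ (Sum.inr a)
      left_inv := by
        rintro ⟨p | a⟩
        · obtain ⟨q, rfl⟩ := e.surjective p
          refine (congrArg (fun p => Quot.mk _ (Sum.inr (D.inp p))) (e.symm_apply_apply q)).trans ?_
          exact (Quot.sound (CompRel.join (D := wiring e he) q)).symm
        · rfl
      right_inv _ := rfl }
  box m := Equiv.emptySum Empty _
  label_wire := by
    rintro ⟨p | a⟩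
    exacts [(D.pre e he).label_inp p, rfl]
  wire_inp _ := rfl
  wire_out _ := rfl
  wire_boxIn := by
    rintro m (b | b) p
    exacts [b.elim, rfl]
  wire_boxOut := by
    rintro m (b | b) p
    exacts [b.elim, rfl]

/-- Equal bijections give isomorphic wirings. -/
def wiringCongr {e f : B.Pos ≃ A.Pos} (h : ∀ p, e p = f p)
    (he : ∀ p, A.label (e p) = B.label p) (hf : ∀ p, A.label (f p) = B.label p) :
    (wiring (S := S) e he).Iso (wiring f hf) where
  wire := Equiv.refl _
  box _ := Equiv.refl _
  label_wire _ := rfl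
  wire_inp _ := rfl
  wire_out p := h p
  wire_boxIn b := b.elim
  wire_boxOut b := b.elim

/-- The composite of two wirings. -/
def wiringTrans (e : B.Pos ≃ A.Pos) (he : ∀ p, A.label (e p) = B.label p)
    (f : C.Pos ≃ B.Pos) (hf : ∀ p, B.label (f p) = C.label p) :
    ((wiring (S := S) e he).comp (wiring f hf)).Iso
      (wiring (f.trans e) fun p => (he _).trans (hf p)) :=
  (compWiring _ f hf).trans
    { wire := Equiv.refl _
      box _ := Equiv.refl _
      label_wire _ := rfl
      wire_inp _ := rfl
      wire_out _ := rfl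
      wire_boxIn b := b.elim
      wire_boxOut b := b.elim }

/-- The juxtaposition of two wirings. -/
def wiringTensor (e : B.Pos ≃ A.Pos) (he : ∀ p, A.label (e p) = B.label p)
    (f : B'.Pos ≃ A'.Pos) (hf : ∀ p, A'.label (f p) = B'.label p) :
    ((wiring (S := S) e he).tensor (wiring f hf)).Iso
      (wiring (A := A.tensor A') (B := B.tensor B') (Equiv.sumCongr e f) (Sum.rec he hf)) where
  wire := Equiv.refl _
  box _ := Equiv.sumEmpty Empty Empty
  label_wire _ := rfl
  wire_inp := by rintro (_ | _) <;> rfl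
  wire_out := by rintro (_ | _) <;> rfl
  wire_boxIn := by
    rintro m (b | b) p
    exacts [b.elim, b.elim]
  wire_boxOut := by
    rintro m (b | b) p
    exacts [b.elim, b.elim]

/-- Juxtaposition commutes with composition. -/
def tensorComp (D : TraceDiagram S A B) (E : TraceDiagram S B C) (D' : TraceDiagram S A' B')
    (E' : TraceDiagram S B' C') :
    ((D.tensor D').comp (E.tensor E')).Iso ((D.comp E).tensor (D'.comp E')) where
  wire :=
    { toFun := Quot.lift (Sum.elim
        (Sum.map (fun a => Quot.mk _ (Sum.inl a)) (fun a => Quot.mk _ (Sum.inl a)))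
        (Sum.map (fun a => Quot.mk _ (Sum.inr a)) (fun a => Quot.mk _ (Sum.inr a)))) (by
          rintro _ _ ⟨p | p⟩
          · exact congrArg Sum.inl (Quot.sound ⟨p⟩)
          · exact congrArg Sum.inr (Quot.sound ⟨p⟩))
      invFun := Sum.elim
        (Quot.lift (Sum.elim (fun a => Quot.mk _ (Sum.inl (Sum.inl a)))
          (fun a => Quot.mk _ (Sum.inr (Sum.inl a)))) (by
            rintro _ _ ⟨p⟩
            exact Quot.sound (CompRel.join (D := D.tensor D') (E := E.tensor E') (Sum.inl p))))
        (Quot.lift (Sum.elim (fun a => Quot.mk _ (Sum.inl (Sum.inr a)))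
          (fun a => Quot.mk _ (Sum.inr (Sum.inr a)))) (by
            rintro _ _ ⟨p⟩
            exact Quot.sound (CompRel.join (D := D.tensor D') (E := E.tensor E') (Sum.inr p))))
      left_inv := by rintro ⟨(_ | _) | (_ | _)⟩ <;> rfl
      right_inv := by
        rintro (a | a)
        · rcases a with ⟨_ | _⟩ <;> rfl
        · rcases a with ⟨_ | _⟩ <;> rfl }
  box m := Equiv.sumSumSumComm _ _ _ _
  label_wire := by rintro ⟨(_ | _) | (_ | _)⟩ <;> rfl
  wire_inp := by rintro (_ | _) <;> rfl
  wire_out := by rintro (_ | _) <;> rfl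
  wire_boxIn := by rintro _ ((_ | _) | (_ | _)) _ <;> rfl
  wire_boxOut := by rintro _ ((_ | _) | (_ | _)) _ <;> rfl

/-- Juxtaposition is associative. -/
def tensorAssoc (D : TraceDiagram S A A') (E : TraceDiagram S B B') (F : TraceDiagram S C C') :
    (((D.tensor E).tensor F).post (B' := A'.tensor (B'.tensor C'))
      (Equiv.sumAssoc A'.Pos B'.Pos C'.Pos).symm (by rintro (_ | _ | _) <;> rfl)).Iso
    ((D.tensor (E.tensor F)).pre (A := (A.tensor B).tensor C)
      (Equiv.sumAssoc A.Pos B.Pos C.Pos).symm (by rintro (_ | _ | _) <;> rfl)) where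
  wire := Equiv.sumAssoc _ _ _
  box m := Equiv.sumAssoc _ _ _
  label_wire := by rintro ((_ | _) | _) <;> rfl
  wire_inp := by rintro ((_ | _) | _) <;> rfl
  wire_out := by rintro (_ | _ | _) <;> rfl
  wire_boxIn := by rintro _ ((_ | _) | _) _ <;> rfl
  wire_boxOut := by rintro _ ((_ | _) | _) _ <;> rfl

/-- The empty diagram is a left unit for juxtaposition. -/
def unitTensor (D : TraceDiagram S A B) :
    (((wiring (A := .unit) (Equiv.refl _) fun _ => rfl).tensor D).post
      (Equiv.emptySum Empty B.Pos).symm fun _ => rfl).Iso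
    (D.pre (A := ObjTerm.unit.tensor A) (Equiv.emptySum Empty A.Pos).symm fun _ => rfl) where
  wire := Equiv.emptySum Empty _
  box m := Equiv.emptySum Empty _
  label_wire := by
    rintro (p | _)
    exacts [p.elim, rfl]
  wire_inp := by
    rintro (p | _)
    exacts [p.elim, rfl]
  wire_out _ := rfl
  wire_boxIn := by
    rintro m (b | b) p
    exacts [b.elim, rfl]
  wire_boxOut := by
    rintro m (b | b) p
    exacts [b.elim, rfl]

/-- The empty diagram is a right unit for juxtaposition. -/
def tensorUnit (D : TraceDiagram S A B) :
    ((D.tensor (wiring (A := .unit) (Equiv.refl _) fun _ => rfl)).post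
      (Equiv.sumEmpty B.Pos Empty).symm fun _ => rfl).Iso
    (D.pre (A := A.tensor .unit) (Equiv.sumEmpty A.Pos Empty).symm fun _ => rfl) where
  wire := Equiv.sumEmpty _ Empty
  box m := Equiv.sumEmpty _ Empty
  label_wire := by
    rintro (_ | p)
    exacts [rfl, p.elim]
  wire_inp := by
    rintro (_ | p)
    exacts [rfl, p.elim]
  wire_out _ := rfl
  wire_boxIn := by
    rintro m (b | b) p
    exacts [rfl, b.elim]
  wire_boxOut := by
    rintro m (b | b) p
    exacts [rfl, b.elim]

/-- Juxtaposition is commutative. -/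
def tensorBraid (D : TraceDiagram S A A') (E : TraceDiagram S B B') :
    ((D.tensor E).post (B' := B'.tensor A')
      (Equiv.sumComm B'.Pos A'.Pos) (by rintro (_ | _) <;> rfl)).Iso
    ((E.tensor D).pre (A := A.tensor B)
      (Equiv.sumComm B.Pos A.Pos) (by rintro (_ | _) <;> rfl)) where
  wire := Equiv.sumComm _ _
  box m := Equiv.sumComm _ _
  label_wire := by rintro (_ | _) <;> rfl
  wire_inp := by rintro (_ | _) <;> rfl
  wire_out := by rintro (_ | _) <;> rfl
  wire_boxIn := by rintro _ (_ | _) _ <;> rfl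
  wire_boxOut := by rintro _ (_ | _) _ <;> rfl

/-- Naturality of the trace on the left. -/
def traceNaturalityLeft (G : TraceDiagram S A' A) (F : TraceDiagram S (A.tensor U) (B.tensor U)) :
    (G.comp F.trace).Iso
      (((G.tensor (wiring (Equiv.refl U.Pos) fun _ => rfl)).comp F).trace) where
  wire :=
    { toFun := Quot.lift (Sum.elim
        (fun a => Quot.mk _ (Quot.mk _ (Sum.inl (Sum.inl a))))
        (Quot.lift (fun a => Quot.mk _ (Quot.mk _ (Sum.inr a))) (by
          rintro _ _ ⟨p⟩
          refine (Quot.sound (TraceRel.join (D := (G.tensor (wiring (Equiv.refl U.Pos)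
            fun _ => rfl)).comp F) p)).trans (congrArg (Quot.mk _) ?_)
          exact Quot.sound (CompRel.join (D := G.tensor (wiring (Equiv.refl U.Pos)
            fun _ => rfl)) (E := F) (Sum.inr p))))) (by
          rintro _ _ ⟨p⟩
          exact congrArg (Quot.mk _) (Quot.sound (CompRel.join (D := G.tensor
            (wiring (Equiv.refl U.Pos) fun _ => rfl)) (E := F) (Sum.inl p))))
      invFun := Quot.lift (Quot.lift (Sum.elim
        (Sum.elim (fun a => Quot.mk _ (Sum.inl a))
          -- The strands of the added identity on `U` are absorbed into the input wires of `F` to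
          -- which they are joined.
          (fun p => Quot.mk _ (Sum.inr (Quot.mk _ (F.inp (Sum.inr p))))))
        (fun a => Quot.mk _ (Sum.inr (Quot.mk _ a)))) (by
          rintro _ _ ⟨p | p⟩
          · exact Quot.sound (CompRel.join (E := F.trace) p)
          · rfl)) (by
          rintro _ _ ⟨p⟩
          exact congrArg (fun a => Quot.mk _ (Sum.inr a)) (Quot.sound ⟨p⟩))
      left_inv := by
        rintro ⟨_ | a⟩
        · rfl
        · rcases a with ⟨_⟩; rfl
      right_inv := by
        rintro ⟨⟨a⟩⟩
        rcases a with (_ | p) | _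
        · rfl
        · exact congrArg (Quot.mk _) (Quot.sound (CompRel.join (D := G.tensor
            (wiring (Equiv.refl U.Pos) fun _ => rfl)) (E := F) (Sum.inr p))).symm
        · rfl }
  box m := Equiv.sumCongr (Equiv.sumEmpty _ Empty).symm (Equiv.refl _)
  label_wire := by
    rintro ⟨_ | a⟩
    · rfl
    · rcases a with ⟨_⟩; rfl
  wire_inp _ := rfl
  wire_out _ := rfl
  wire_boxIn := by rintro _ (_ | _) _ <;> rfl
  wire_boxOut := by rintro _ (_ | _) _ <;> rfl

/-- Naturality of the trace on the right. -/
def traceNaturalityRight (F : TraceDiagram S (A.tensor U) (B.tensor U)) (H : TraceDiagram S B B') :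
    (F.trace.comp H).Iso
      ((F.comp (H.tensor (wiring (Equiv.refl U.Pos) fun _ => rfl))).trace) where
  wire :=
    { toFun := Quot.lift (Sum.elim
        (Quot.lift (fun a => Quot.mk _ (Quot.mk _ (Sum.inl a))) (by
          rintro _ _ ⟨p⟩
          refine (congrArg (Quot.mk _) ?_).trans (Quot.sound (TraceRel.join (D := F.comp (H.tensor
            (wiring (Equiv.refl U.Pos) fun _ => rfl))) p))
          exact Quot.sound (CompRel.join (D := F) (E := H.tensor (wiring (Equiv.refl U.Pos)
            fun _ => rfl)) (Sum.inr p))))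
        (fun a => Quot.mk _ (Quot.mk _ (Sum.inr (Sum.inl a))))) (by
          rintro _ _ ⟨p⟩
          exact congrArg (Quot.mk _) (Quot.sound (CompRel.join (D := F) (E := H.tensor
            (wiring (Equiv.refl U.Pos) fun _ => rfl)) (Sum.inl p))))
      invFun := Quot.lift (Quot.lift (Sum.elim
        (fun a => Quot.mk _ (Sum.inl (Quot.mk _ a)))
        (Sum.elim (fun a => Quot.mk _ (Sum.inr a))
          -- Here the identity strands are absorbed into the output wires of `F`.
          (fun p => Quot.mk _ (Sum.inl (Quot.mk _ (F.out (Sum.inr p))))))) (by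
          rintro _ _ ⟨p | p⟩
          · exact Quot.sound (CompRel.join (D := F.trace) p)
          · rfl)) (by
          rintro _ _ ⟨p⟩
          exact congrArg (fun a => Quot.mk _ (Sum.inl a)) (Quot.sound ⟨p⟩))
      left_inv := by
        rintro ⟨a | _⟩
        · rcases a with ⟨_⟩; rfl
        · rfl
      right_inv := by
        rintro ⟨⟨a⟩⟩
        rcases a with _ | (_ | p)
        · rfl
        · rfl
        · exact congrArg (Quot.mk _) (Quot.sound (CompRel.join (D := F) (E := H.tensor
            (wiring (Equiv.refl U.Pos) fun _ => rfl)) (Sum.inr p))) }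
  box m := Equiv.sumCongr (Equiv.refl _) (Equiv.sumEmpty _ Empty).symm
  label_wire := by
    rintro ⟨a | _⟩
    · rcases a with ⟨_⟩; rfl
    · rfl
  wire_inp _ := rfl
  wire_out _ := rfl
  wire_boxIn := by rintro _ (_ | _) _ <;> rfl
  wire_boxOut := by rintro _ (_ | _) _ <;> rfl

/-- Dinaturality of the trace. -/
def traceDinaturality (F : TraceDiagram S (A.tensor U) (B.tensor V)) (G : TraceDiagram S V U) :
    ((F.comp ((wiring (Equiv.refl B.Pos) fun _ => rfl).tensor G)).trace).Iso
      ((((wiring (Equiv.refl A.Pos) fun _ => rfl).tensor G).comp F).trace) where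
  wire :=
    { toFun := Quot.lift (Quot.lift (Sum.elim
        (fun a => Quot.mk _ (Quot.mk _ (Sum.inr a)))
        -- An identity strand on `B` has no counterpart on the other side; it goes to the output
        -- wire of `F` that it prolongs.
        (Sum.elim (fun p => Quot.mk _ (Quot.mk _ (Sum.inr (F.out (Sum.inl p)))))
          (fun a => Quot.mk _ (Quot.mk _ (Sum.inl (Sum.inr a)))))) (by
          rintro _ _ ⟨p | p⟩
          · rfl
          · exact Quot.sound (TraceRel.join (D := ((wiring (Equiv.refl A.Pos)
              fun _ => rfl).tensor G).comp F) p))) (by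
          rintro _ _ ⟨p⟩
          exact congrArg (Quot.mk _) (Quot.sound (CompRel.join (D := (wiring (Equiv.refl A.Pos)
              fun _ => rfl).tensor G) (E := F) (Sum.inr p))))
      invFun := Quot.lift (Quot.lift (Sum.elim
        (Sum.elim (fun p => Quot.mk _ (Quot.mk _ (Sum.inl (F.inp (Sum.inl p)))))
          (fun a => Quot.mk _ (Quot.mk _ (Sum.inr (Sum.inr a)))))
        (fun a => Quot.mk _ (Quot.mk _ (Sum.inl a)))) (by
          rintro _ _ ⟨p | p⟩
          · rfl
          · exact Quot.sound (TraceRel.join (D := F.comp ((wiring (Equiv.refl B.Pos)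
              fun _ => rfl).tensor G)) p))) (by
          rintro _ _ ⟨p⟩
          exact congrArg (Quot.mk _) (Quot.sound (CompRel.join (D := F)
            (E := (wiring (Equiv.refl B.Pos) fun _ => rfl).tensor G) (Sum.inr p))))
      left_inv := by
        rintro ⟨⟨a⟩⟩
        rcases a with _ | (p | _)
        · rfl
        · exact congrArg (Quot.mk _) (Quot.sound (CompRel.join (D := F)
            (E := (wiring (Equiv.refl B.Pos) fun _ => rfl).tensor G) (Sum.inl p)))
        · rfl
      right_inv := by
        rintro ⟨⟨a⟩⟩
        rcases a with (p | _) | _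
        · exact congrArg (Quot.mk _) (Quot.sound (CompRel.join (D := (wiring (Equiv.refl A.Pos)
              fun _ => rfl).tensor G) (E := F) (Sum.inl p))).symm
        · rfl
        · rfl }
  box m := (Equiv.sumComm _ _).trans (Equiv.refl _)
  label_wire := by
    rintro ⟨⟨a⟩⟩
    rcases a with _ | (p | _)
    · rfl
    · exact F.label_out (Sum.inl p)
    · rfl
  wire_inp p := congrArg (Quot.mk _) (Quot.sound (CompRel.join (D := (wiring (Equiv.refl A.Pos)
    fun _ => rfl).tensor G) (E := F) (Sum.inl p))).symm
  wire_out _ := rfl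
  wire_boxIn := by
    rintro m (b | b | b) p
    exacts [rfl, b.elim, rfl]
  wire_boxOut := by
    rintro m (b | b | b) p
    exacts [rfl, b.elim, rfl]

/-- Strength of the trace. -/
def traceStrength (G : TraceDiagram S A' B') (F : TraceDiagram S (A.tensor U) (B.tensor U)) :
    (G.tensor F.trace).Iso (trace (A := A'.tensor A) (B := B'.tensor B)
      (((G.tensor F).post (B' := (B'.tensor B).tensor U) (Equiv.sumAssoc B'.Pos B.Pos U.Pos)
        (by rintro ((_ | _) | _) <;> rfl)).pre (A := (A'.tensor A).tensor U)
          (Equiv.sumAssoc A'.Pos A.Pos U.Pos).symm (by rintro (_ | _ | _) <;> rfl))) where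
  wire :=
    { toFun := Sum.elim (fun a => Quot.mk _ (Sum.inl a)) (Quot.map Sum.inr (by
        rintro _ _ ⟨p⟩
        exact ⟨p⟩))
      invFun := Quot.lift (Sum.map _root_.id (Quot.mk _)) (by
        rintro _ _ ⟨p⟩
        exact congrArg Sum.inr (Quot.sound ⟨p⟩))
      left_inv := by
        rintro (_ | a)
        · rfl
        · rcases a with ⟨_⟩; rfl
      right_inv := by rintro ⟨_ | _⟩ <;> rfl }
  box m := Equiv.refl _
  label_wire := by
    rintro (_ | a)
    · rfl
    · rcases a with ⟨_⟩; rfl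
  wire_inp := by rintro (_ | _) <;> rfl
  wire_out := by rintro (_ | _) <;> rfl
  wire_boxIn := by rintro _ (_ | _) _ <;> rfl
  wire_boxOut := by rintro _ (_ | _) _ <;> rfl

/-- The trace over the unit. -/
def traceUnit (F : TraceDiagram S (A.tensor .unit) (B.tensor .unit)) :
    ((F.post (Equiv.sumEmpty B.Pos Empty).symm fun _ => rfl).pre (Equiv.sumEmpty A.Pos Empty)
      (by rintro (_ | p); exacts [rfl, p.elim])).Iso F.trace where
  wire :=
    { toFun a := Quot.mk _ a
      invFun := Quot.lift _root_.id (by rintro _ _ ⟨p⟩; exact p.elim)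
      left_inv _ := rfl
      right_inv := by rintro ⟨_⟩; rfl }
  box m := Equiv.refl _
  label_wire _ := rfl
  wire_inp _ := rfl
  wire_out _ := rfl
  wire_boxIn _ _ := rfl
  wire_boxOut _ _ := rfl

/-- The trace over a tensor product. -/
def traceTensor (F : TraceDiagram S ((A.tensor U).tensor V) ((B.tensor U).tensor V)) :
    F.trace.trace.Iso (trace (U := U.tensor V)
      ((F.post (B' := B.tensor (U.tensor V)) (Equiv.sumAssoc B.Pos U.Pos V.Pos).symm
        (by rintro (_ | _ | _) <;> rfl)).pre (A := A.tensor (U.tensor V))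
          (Equiv.sumAssoc A.Pos U.Pos V.Pos) (by rintro ((_ | _) | _) <;> rfl))) where
  wire :=
    { toFun := Quot.lift (Quot.lift (fun a => Quot.mk _ a) (by
        rintro _ _ ⟨p⟩
        exact Quot.sound (TraceRel.join (U := U.tensor V) (D := ((F.post
          (B' := B.tensor (U.tensor V)) (Equiv.sumAssoc B.Pos U.Pos V.Pos).symm
          (by rintro (_ | _ | _) <;> rfl)).pre (A := A.tensor (U.tensor V))
          (Equiv.sumAssoc A.Pos U.Pos V.Pos) (by rintro ((_ | _) | _) <;> rfl))) (Sum.inr p)))) (by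
        rintro _ _ ⟨p⟩
        exact Quot.sound (TraceRel.join (U := U.tensor V) (D := ((F.post
          (B' := B.tensor (U.tensor V)) (Equiv.sumAssoc B.Pos U.Pos V.Pos).symm
          (by rintro (_ | _ | _) <;> rfl)).pre (A := A.tensor (U.tensor V))
          (Equiv.sumAssoc A.Pos U.Pos V.Pos) (by rintro ((_ | _) | _) <;> rfl))) (Sum.inl p)))
      invFun := Quot.lift (fun a => Quot.mk _ (Quot.mk _ a)) (by
        rintro _ _ ⟨p | p⟩
        · exact Quot.sound (TraceRel.join (D := F.trace) p)
        · exact congrArg (Quot.mk _) (Quot.sound ⟨p⟩))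
      left_inv := by rintro ⟨⟨_⟩⟩; rfl
      right_inv := by rintro ⟨_⟩; rfl }
  box m := Equiv.refl _
  label_wire := by rintro ⟨⟨_⟩⟩; rfl
  wire_inp _ := rfl
  wire_out _ := rfl
  wire_boxIn _ _ := rfl
  wire_boxOut _ _ := rfl

/-- Yanking. -/
def traceBraid (A : ObjTerm S.Obj) :
    (trace (S := S) (U := A) (wiring (A := A.tensor A) (B := A.tensor A)
      (Equiv.sumComm A.Pos A.Pos) (by rintro (_ | _) <;> rfl))).Iso
    (wiring (Equiv.refl A.Pos) fun _ => rfl) where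
  wire :=
    -- The feedback joins the two copies of `A` position by position.
    { toFun := Quot.lift (Sum.elim _root_.id _root_.id) (by rintro _ _ ⟨p⟩; rfl)
      invFun a := Quot.mk _ (Sum.inl a)
      left_inv := by
        rintro ⟨a | a⟩
        exacts [rfl, Quot.sound (TraceRel.join (D := wiring (A := A.tensor A) (B := A.tensor A)
          (Equiv.sumComm A.Pos A.Pos) (by rintro (_ | _) <;> rfl)) a)]
      right_inv _ := rfl }
  box m := Equiv.refl _
  label_wire := by rintro ⟨_ | _⟩ <;> rfl
  wire_inp _ := rfl
  wire_out _ := rfl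
  wire_boxIn b := b.elim
  wire_boxOut b := b.elim

end TraceDiagram

/-! ### The totally traced category of terms -/

namespace TraceDiagram

variable {S : TraceSignature.{w}} {A B C A' B' : ObjTerm S.Obj}

/-- A composite of two diagrams that are wirings up to isomorphism. -/
def Iso.compOfWiring {D : TraceDiagram S A B} {E : TraceDiagram S B C} {e : B.Pos ≃ A.Pos}
    {he : ∀ p, A.label (e p) = B.label p} {f : C.Pos ≃ B.Pos}
    {hf : ∀ p, B.label (f p) = C.label p} (i : D.Iso (wiring e he)) (j : E.Iso (wiring f hf)) :
    (D.comp E).Iso (wiring (f.trans e) fun p => (he _).trans (hf p)) :=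
  (i.comp j).trans (wiringTrans e he f hf)

/-- A juxtaposition of two diagrams that are wirings up to isomorphism. -/
def Iso.tensorOfWiring {D : TraceDiagram S A B} {E : TraceDiagram S A' B'} {e : B.Pos ≃ A.Pos}
    {he : ∀ p, A.label (e p) = B.label p} {f : B'.Pos ≃ A'.Pos}
    {hf : ∀ p, A'.label (f p) = B'.label p} (i : D.Iso (wiring e he)) (j : E.Iso (wiring f hf)) :
    (D.tensor E).Iso
      (wiring (A := A.tensor A') (B := B.tensor B') (Equiv.sumCongr e f) (Sum.rec he hf)) :=
  (i.tensor j).trans (wiringTensor e he f hf)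

/-- Diagrams that are isomorphic to the same wiring are isomorphic. -/
def Iso.ofWiring {D E : TraceDiagram S A B} {e f : B.Pos ≃ A.Pos}
    {he : ∀ p, A.label (e p) = B.label p} {hf : ∀ p, A.label (f p) = B.label p}
    (i : D.Iso (wiring e he)) (j : E.Iso (wiring f hf)) (h : ∀ p, e p = f p) : D.Iso E :=
  i.trans ((wiringCongr h he hf).trans j.symm)

/-- Identities are right units for composition. -/
def compId (D : TraceDiagram S A B) :
    (D.comp (wiring (Equiv.refl B.Pos) fun _ => rfl)).Iso D :=
  compWiring D _ _

/-- Identities are left units for composition. -/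
def idComp (D : TraceDiagram S A B) :
    ((wiring (Equiv.refl A.Pos) fun _ => rfl).comp D).Iso D :=
  wiringComp _ _ D

/-- Composition with wirings on both sides. -/
def wiringCompWiring (e : A.Pos ≃ A'.Pos) (he : ∀ p, A'.label (e p) = A.label p)
    (D : TraceDiagram S A B) (f : B'.Pos ≃ B.Pos) (hf : ∀ p, B.label (f p) = B'.label p) :
    ((wiring e he).comp (D.comp (wiring f hf))).Iso ((D.post f hf).pre e he) :=
  ((Iso.refl _).comp (compWiring D f hf)).trans (wiringComp e he _)

end TraceDiagram

namespace TraceTerm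

variable {S : TraceSignature.{w}}

/-- Terms are identified if their diagrams are isomorphic. -/
def isoSetoid (A B : ObjTerm S.Obj) : Setoid (TraceTerm S A B) where
  r s t := Nonempty (s.diagram.Iso t.diagram)
  iseqv := ⟨fun _ => ⟨.refl _⟩, fun ⟨i⟩ => ⟨i.symm⟩, fun ⟨i⟩ ⟨j⟩ => ⟨i.trans j⟩⟩

end TraceTerm

/-- The objects of the category of terms. The parameter `L` serves only to fix the universe of the
morphisms. -/
structure TermObj (S : TraceSignature.{w}) (L : Type v') : Type (max w u') where
  as : ObjTerm S.Obj

namespace TermObj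

open TraceDiagram

variable {S : TraceSignature.{w}} {L : Type v'}

/-- The morphisms of the category of terms: terms up to isomorphism of their diagrams. -/
structure Hom (X Y : TermObj.{w, u', v'} S L) : Type (max w v') where
  cls : Quotient (TraceTerm.isoSetoid X.as Y.as)

/-- The morphism that a term represents. -/
def Hom.of {X Y : TermObj.{w, u', v'} S L} (t : TraceTerm S X.as Y.as) : Hom X Y := ⟨Quotient.mk _ t⟩

theorem Hom.sound {X Y : TermObj.{w, u', v'} S L} {s t : TraceTerm S X.as Y.as}
    (i : s.diagram.Iso t.diagram) : (Hom.of s : Hom X Y) = Hom.of t :=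
  congrArg Hom.mk (Quotient.sound ⟨i⟩)

theorem Hom.exact {X Y : TermObj.{w, u', v'} S L} {s t : TraceTerm S X.as Y.as}
    (h : (Hom.of s : Hom X Y) = Hom.of t) : Nonempty (s.diagram.Iso t.diagram) :=
  Quotient.exact (congrArg Hom.cls h)

/-- Composition of morphisms of the category of terms. -/
def Hom.comp {X Y Z : TermObj.{w, u', v'} S L} (f : Hom X Y) (g : Hom Y Z) : Hom X Z :=
  ⟨Quotient.map₂ TraceTerm.comp (by
    rintro _ _ ⟨i⟩ _ _ ⟨j⟩
    exact ⟨Iso.comp i j⟩) f.cls g.cls⟩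

instance : Category.{max w v'} (TermObj.{w, u', v'} S L) where
  Hom := Hom
  id X := Hom.of (.id X.as)
  comp := Hom.comp
  id_comp := by
    rintro X Y ⟨⟨f⟩⟩
    exact Hom.sound (idComp f.diagram)
  comp_id := by
    rintro X Y ⟨⟨f⟩⟩
    exact Hom.sound (compId f.diagram)
  assoc := by
    rintro W X Y Z ⟨⟨f⟩⟩ ⟨⟨g⟩⟩ ⟨⟨h⟩⟩
    exact Hom.sound (compAssoc f.diagram g.diagram h.diagram)

/-- Tensor product of morphisms of the category of terms. -/
def Hom.tensor {X Y X' Y' : TermObj.{w, u', v'} S L} (f : X ⟶ Y) (g : X' ⟶ Y') :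
    (⟨X.as.tensor X'.as⟩ : TermObj.{w, u', v'} S L) ⟶ ⟨Y.as.tensor Y'.as⟩ :=
  ⟨Quotient.map₂ TraceTerm.tensor (by
    rintro _ _ ⟨i⟩ _ _ ⟨j⟩
    exact ⟨Iso.tensor i j⟩) (Hom.cls f) (Hom.cls g)⟩

/-- Terms with mutually inverse diagrams represent an isomorphism. -/
def isoOf {X Y : TermObj.{w, u', v'} S L} (s : TraceTerm S X.as Y.as) (t : TraceTerm S Y.as X.as)
    (i : (s.comp t).diagram.Iso (TraceTerm.id X.as).diagram)
    (j : (t.comp s).diagram.Iso (TraceTerm.id Y.as).diagram) : X ≅ Y where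
  hom := Hom.of s
  inv := Hom.of t
  hom_inv_id := Hom.sound i
  inv_hom_id := Hom.sound j

instance : MonoidalCategoryStruct (TermObj.{w, u', v'} S L) where
  tensorObj X Y := ⟨X.as.tensor Y.as⟩
  tensorUnit := ⟨.unit⟩
  tensorHom := Hom.tensor
  whiskerLeft X _ _ f := Hom.tensor (𝟙 X) f
  whiskerRight f X := Hom.tensor f (𝟙 X)
  associator X Y Z := isoOf (.assoc X.as Y.as Z.as) (.assocInv X.as Y.as Z.as)
    (.ofWiring (.compOfWiring (.refl _) (.refl _)) (.refl _) (by rintro ((_ | _) | _) <;> rfl))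
    (.ofWiring (.compOfWiring (.refl _) (.refl _)) (.refl _) (by rintro (_ | _ | _) <;> rfl))
  leftUnitor X := isoOf (.leftUnitor X.as) (.leftUnitorInv X.as)
    (.ofWiring (.compOfWiring (.refl _) (.refl _)) (.refl _)
      (by rintro (p | _); exacts [p.elim, rfl]))
    (.ofWiring (.compOfWiring (.refl _) (.refl _)) (.refl _) fun _ => rfl)
  rightUnitor X := isoOf (.rightUnitor X.as) (.rightUnitorInv X.as)
    (.ofWiring (.compOfWiring (.refl _) (.refl _)) (.refl _)
      (by rintro (_ | p); exacts [rfl, p.elim]))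
    (.ofWiring (.compOfWiring (.refl _) (.refl _)) (.refl _) fun _ => rfl)

instance : MonoidalCategory (TermObj.{w, u', v'} S L) := MonoidalCategory.ofTensorHom
  (id_tensorHom_id := fun X Y =>
    Hom.sound (.ofWiring (.tensorOfWiring (.refl _) (.refl _)) (.refl _)
      (by rintro (_ | _) <;> rfl)))
  (id_tensorHom := fun _ _ _ _ => rfl)
  (tensorHom_id := fun _ _ => rfl)
  (tensorHom_comp_tensorHom := by
    rintro _ _ _ _ _ _ ⟨⟨f⟩⟩ ⟨⟨f'⟩⟩ ⟨⟨g⟩⟩ ⟨⟨g'⟩⟩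
    exact Hom.sound (tensorComp f.diagram g.diagram f'.diagram g'.diagram))
  -- Composing with a wiring only permutes ports, so naturality compares one diagram with permuted
  -- outputs to another with permuted inputs.
  (associator_naturality := by
    rintro _ _ _ _ _ _ ⟨⟨f⟩⟩ ⟨⟨g⟩⟩ ⟨⟨h⟩⟩
    exact Hom.sound ((compWiring _ _ _).trans
      ((tensorAssoc f.diagram g.diagram h.diagram).trans (wiringComp _ _ _).symm)))
  (leftUnitor_naturality := by
    rintro _ _ ⟨⟨f⟩⟩
    exact Hom.sound ((compWiring _ _ _).trans
      ((unitTensor f.diagram).trans (wiringComp _ _ _).symm)))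
  (rightUnitor_naturality := by
    rintro _ _ ⟨⟨f⟩⟩
    exact Hom.sound ((compWiring _ _ _).trans
      ((tensorUnit f.diagram).trans (wiringComp _ _ _).symm)))
  -- Both sides of a coherence law are wirings, and their bijections are compared point by point.
  (pentagon := fun W X Y Z =>
    Hom.sound (.ofWiring (.compOfWiring (.tensorOfWiring (.refl _) (.refl _))
      (.compOfWiring (.refl _) (.tensorOfWiring (.refl _) (.refl _))))
      (.compOfWiring (.refl _) (.refl _)) (by rintro (_ | _ | _ | _) <;> rfl)))
  (triangle := fun X Y =>
    Hom.sound (.ofWiring (.compOfWiring (.refl _) (.tensorOfWiring (.refl _) (.refl _)))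
      (.tensorOfWiring (.refl _) (.refl _)) (by rintro (_ | _) <;> rfl)))

instance : SymmetricCategory (TermObj.{w, u', v'} S L) where
  braiding X Y := isoOf (.symm X.as Y.as) (.symm Y.as X.as)
    (.ofWiring (.compOfWiring (.refl _) (.refl _)) (.refl _) (by rintro (_ | _) <;> rfl))
    (.ofWiring (.compOfWiring (.refl _) (.refl _)) (.refl _) (by rintro (_ | _) <;> rfl))
  braiding_naturality_right := by
    rintro X _ _ ⟨⟨f⟩⟩
    exact Hom.sound ((compWiring _ _ _).trans
      ((tensorBraid (TraceTerm.id X.as).diagram f.diagram).trans (wiringComp _ _ _).symm))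
  braiding_naturality_left := by
    rintro _ _ ⟨⟨f⟩⟩ X
    exact Hom.sound ((compWiring _ _ _).trans
      ((tensorBraid f.diagram (TraceTerm.id X.as).diagram).trans (wiringComp _ _ _).symm))
  hexagon_forward X Y Z :=
    Hom.sound (.ofWiring (.compOfWiring (.refl _) (.compOfWiring (.refl _) (.refl _)))
      (.compOfWiring (.tensorOfWiring (.refl _) (.refl _))
        (.compOfWiring (.refl _) (.tensorOfWiring (.refl _) (.refl _))))
      (by rintro (_ | _ | _) <;> rfl))
  hexagon_reverse X Y Z :=
    Hom.sound (.ofWiring (.compOfWiring (.refl _) (.compOfWiring (.refl _) (.refl _)))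
      (.compOfWiring (.tensorOfWiring (.refl _) (.refl _))
        (.compOfWiring (.refl _) (.tensorOfWiring (.refl _) (.refl _))))
      (by rintro ((_ | _) | _) <;> rfl))
  symmetry X Y := (isoOf (.symm X.as Y.as) (.symm Y.as X.as) _ _).hom_inv_id

/-- Trace of morphisms of the category of terms. -/
def Hom.trace {X Y U : TermObj.{w, u', v'} S L} (f : X ⊗ U ⟶ Y ⊗ U) : X ⟶ Y :=
  ⟨Quotient.map TraceTerm.trace (by
    rintro _ _ ⟨i⟩
    exact ⟨Iso.trace i⟩) (Hom.cls f)⟩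

/-- Each trace axiom is an isomorphism of diagrams. This makes the category of terms a test model
for total laws, in which equality means isomorphism of diagrams. -/
instance : TracedCategory (TermObj.{w, u', v'} S L) where
  tr := Hom.trace
  naturality := by
    rintro X Y U X' Y' ⟨⟨f⟩⟩ ⟨⟨g⟩⟩ ⟨⟨h⟩⟩
    exact Hom.sound (((Iso.refl _).comp (traceNaturalityRight f.diagram h.diagram)).trans
      (traceNaturalityLeft g.diagram _))
  dinaturality := by
    rintro X Y U U' ⟨⟨f⟩⟩ ⟨⟨g⟩⟩
    exact Hom.sound (traceDinaturality f.diagram g.diagram)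
  strength := by
    rintro X Y U X' Y' ⟨⟨f⟩⟩ ⟨⟨g⟩⟩
    exact Hom.sound ((traceStrength g.diagram f.diagram).trans (wiringCompWiring _ _ _ _ _).trace.symm)
  vanishing_I := by
    rintro X Y ⟨⟨f⟩⟩
    exact Hom.sound ((wiringCompWiring _ _ _ _ _).trans (traceUnit f.diagram))
  vanishing_II := by
    rintro X Y U V ⟨⟨f⟩⟩
    exact Hom.sound ((traceTensor f.diagram).trans (wiringCompWiring _ _ _ _ _).trace.symm)
  yanking X := Hom.sound (traceBraid X.as)

end TermObj

/-! ### Laws of totally traced categories -/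

section HEq

variable {C : Type u} [Category.{v} C] {X X' Y Y' Z Z' W W' : C}

/-- In the category of terms an object term evaluates to itself only up to propositional equality
(`eval_var`), so the operations are needed as congruences for heterogeneous equality. -/
theorem heq_comp_of_heq (hX : X = X') (hY : Y = Y') (hZ : Z = Z') {f : X ⟶ Y} {f' : X' ⟶ Y'}
    {g : Y ⟶ Z} {g' : Y' ⟶ Z'} (hf : f ≍ f') (hg : g ≍ g') : (f ≫ g) ≍ (f' ≫ g') := by
  subst hX hY hZ hf hg
  rfl

variable [MonoidalCategory C]

theorem heq_tensorHom_of_heq (hX : X = X') (hY : Y = Y') (hZ : Z = Z') (hW : W = W') {f : X ⟶ Y}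
    {f' : X' ⟶ Y'} {g : Z ⟶ W} {g' : Z' ⟶ W'} (hf : f ≍ f') (hg : g ≍ g') :
    (f ⊗ₘ g) ≍ (f' ⊗ₘ g') := by
  subst hX hY hZ hW hf hg
  rfl

theorem heq_tr_of_heq [SymmetricCategory C] [TracedCategory C] (hX : X = X') (hY : Y = Y')
    (hZ : Z = Z') {f : X ⊗ Z ⟶ Y ⊗ Z} {f' : X' ⊗ Z' ⟶ Y' ⊗ Z'} (hf : f ≍ f') :
    TracedCategory.tr f ≍ TracedCategory.tr f' := by
  subst hX hY hZ hf
  rfl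

end HEq

namespace TermObj

variable (S : TraceSignature.{w}) (L : Type v')

theorem eval_var (A : ObjTerm S.Obj) :
    A.eval (fun X => (⟨.var X⟩ : TermObj.{w, u', v'} S L)) = ⟨A⟩ := by
  induction A with
  | var X => rfl
  | unit => rfl
  | tensor A B hA hB => exact congrArg₂ (fun X Y : TermObj.{w, u', v'} S L => X ⊗ Y) hA hB

/-- The assignment that sends every variable to itself. -/
def valuation : TraceValuation (TermObj.{w, u', v'} S L) S where
  obj X := ⟨.var X⟩
  mor m := cast (congrArg₂ (fun X Y : TermObj.{w, u', v'} S L => (X ⟶ Y))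
    (eval_var S L (S.dom m)) (eval_var S L (S.cod m))).symm
    (Hom.of (.var m) : Hom (⟨S.dom m⟩ : TermObj.{w, u', v'} S L) ⟨S.cod m⟩)

/-- The point of the term model: an equation that holds under the tautological assignment is an
equality of classes, hence an isomorphism of diagrams. -/
theorem eval_valuation {A B : ObjTerm S.Obj} (t : TraceTerm S A B) :
    t.eval (valuation.{w, u', v'} S L) ≍ (Hom.of t : Hom (⟨A⟩ : TermObj.{w, u', v'} S L) ⟨B⟩) := by
  have h (A : ObjTerm S.Obj) : A.eval (valuation.{w, u', v'} S L).obj = ⟨A⟩ := eval_var S L A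
  induction t with
  | var m => exact cast_heq _ _
  | id A => exact congr_arg_heq (fun X => 𝟙 X) (h A)
  | @comp A B C f g hf hg => exact heq_comp_of_heq (h A) (h B) (h C) hf hg
  | @tensor A B C D f g hf hg => exact heq_tensorHom_of_heq (h A) (h B) (h C) (h D) hf hg
  | assoc A B C =>
    change (α_ _ _ _).hom ≍ (α_ (⟨A⟩ : TermObj.{w, u', v'} S L) ⟨B⟩ ⟨C⟩).hom
    rw [h A, h B, h C]
  | assocInv A B C =>
    change (α_ _ _ _).inv ≍ (α_ (⟨A⟩ : TermObj.{w, u', v'} S L) ⟨B⟩ ⟨C⟩).inv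
    rw [h A, h B, h C]
  | leftUnitor A => exact congr_arg_heq (fun X : TermObj.{w, u', v'} S L => (λ_ X).hom) (h A)
  | leftUnitorInv A => exact congr_arg_heq (fun X : TermObj.{w, u', v'} S L => (λ_ X).inv) (h A)
  | rightUnitor A => exact congr_arg_heq (fun X : TermObj.{w, u', v'} S L => (ρ_ X).hom) (h A)
  | rightUnitorInv A => exact congr_arg_heq (fun X : TermObj.{w, u', v'} S L => (ρ_ X).inv) (h A)
  | symm A B =>
    change (β_ _ _).hom ≍ (β_ (⟨A⟩ : TermObj.{w, u', v'} S L) ⟨B⟩).hom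
    rw [h A, h B]
  | @trace A B U f hf => exact heq_tr_of_heq (h A) (h B) (h U) hf

end TermObj

/-- The terms of a law of totally traced categories have isomorphic diagrams. -/
theorem IsTracedLaw.nonempty_iso {S : TraceSignature.{w}} {A B : ObjTerm S.Obj}
    {s t : TraceTerm S A B} (h : IsTracedLaw.{w, max w u', max w v'} s t) :
    Nonempty (s.diagram.Iso t.diagram) :=
  TermObj.Hom.exact (eq_of_heq ((TermObj.eval_valuation.{w, u', v'} S PUnit s).symm.trans
    ((heq_of_eq (h _ _)).trans (TermObj.eval_valuation S PUnit t))))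

/-- Graphically provable equations are those between terms with isomorphic diagrams. -/
theorem GraphicallyProvable.nonempty_iso {S : TraceSignature.{w}} {A B : ObjTerm S.Obj}
    {s t : TraceTerm S A B} (h : GraphicallyProvable s t) :
    Nonempty (s.diagram.Iso t.diagram) := by
  induction h with
  | refl => exact ⟨.refl _⟩
  -- The chain is composed at the level of diagrams; values of intermediate terms play no part.
  | tail _ h ih =>
    obtain ⟨i⟩ := ih
    obtain ⟨j⟩ := h
    exact ⟨i.trans j⟩

/-- The universes of the categories in which the law is assumed are independent of those of `C`: the
law is used only in the category of terms, which exists in every universe above `w`. -/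
theorem mainTheorem3 (S : TraceSignature.{w}) (A B : ObjTerm S.Obj)
    (s t : TraceTerm S A B) :
    (IsTracedLaw.{w, max w u', max w v'} s t → HoldsWhenDefined.{w, u, v} s t) ∧
    (GraphicallyProvable s t → HoldsWhenDefined.{w, u, v} s t) := by
  constructor
  · intro h C _ _ _ _ x f hf g hg
    exact eq_of_diagram_iso x h.nonempty_iso.some hf hg
  · intro h C _ _ _ _ x f hf g hg
    exact eq_of_diagram_iso x h.nonempty_iso.some hf hg
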